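/- Let $\mathcal X,\mathcal Y_1,\mathcal Y_2,\mathcal Z,\mathcal S_1,\mathcal S_2$ be finite alphabets. A state-dependent memoryless broadcast channel with generalized feedback is given by a state law $P_{S_1S_2}$ and a transition law $P_{Y_1Y_2Z|S_1S_2X}$: the state pairs $(S_{1,i},S_{2,i})$ are i.i.d. with law $P_{S_1S_2}$, and given the time-$i$ input $x_i$ and states $s_{1,i},s_{2,i}$, the outputs $Y_{1,i},Y_{2,i}$ and the feedback $Z_i$ are drawn from $P_{Y_1Y_2Z|S_1S_2X}(\cdot|s_{1,i},s_{2,i},x_i)$, irrespective of the past. Let $\hat{\mathcal S}_1,\hat{\mathcal S}_2$ be reconstruction alphabets and $d_k:\mathcal S_k\times\hat{\mathcal S}_k\to[0,\infty)$, $k=1,2$, bounded distortion functions. For $R_0,R_1,R_2\ge 0$, a $(2^{nR_0},2^{nR_1},2^{nR_2},n)$ code consists of message sets $\mathcal W_j=\{1,\dots,\lfloor 2^{nR_j}\rfloor\}$, $j=0,1,2$; encoders $X_i=\phi_i(W_0,W_1,W_2,Z^{i-1})$, $i=1,\dots,n$; decoders $(\hat W_{0,k},\hat W_k)=g_k(S_k^n,Y_k^n)\in\mathcal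 W_0\times\mathcal W_k$, $k=1,2$; and state estimators $\hat S_k^n=h_k(X^n,Z^n)\in\hat{\mathcal S}_k^n$, $k=1,2$. The messages are independent, uniform on their sets, and independent of the states. A tuple $(R_0,R_1,R_2,D_1,D_2)$ with $R_0,R_1,R_2\ge0$ is achievable if there is a sequence (in $n$) of $(2^{nR_0},2^{nR_1},2^{nR_2},n)$ codes such that $$\Pr\big((\hat W_{0,1},\hat W_1)\ne(W_0,W_1)\ \text{or}\ (\hat W_{0,2},\hat W_2)\ne(W_0,W_2)\big)\to0,\qquad \varlimsup_{n\to\infty}\frac1n\sum_{i=1}^n\mathbb E[d_k(S_{k,i},\hat S_{k,i})]\le D_k,\quad k=1,2.$$ The capacity-distortion region $\mathcal{CD}$ is the closure of the set of achievable tuples. Let $\hat s_k^*(x,z)\in\arg\min_{s'\in\hat{\mathcal S}_k}\sum_{s_k\in\mathcal S_k}P_{S_k|XZ}(s_k|x,z)\,d_k(s_k,s')$, $k=1,2$, where ties are broken arbitrarily, these minima are assumed to exist (which is automatic if $\hat{\mathcal S}_k$ is finite and nonempty), and $\hat s_k^*(x,z)$ is arbitrary if $z$ has probability zero under the input $x$.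 Suppose that the channel is physically degraded, i.e., that there are conditional laws $P_{Y_1|XS_1}$ and $P_{S_2Y_2|S_1Y_1}$ with $P_{Y_1Y_2|S_1S_2X}P_{S_1S_2}=P_{S_1}P_{Y_1|S_1X}P_{S_2Y_2|S_1Y_1}$. Then $\mathcal{CD}$ is the closure of the set of all tuples $(R_0,R_1,R_2,D_1,D_2)$ with $R_0,R_1,R_2\ge 0$ for which there are a finite-alphabet random variable $U$ and a joint law $P_{UX}$ such that, for $(U,X,S_1,S_2,Y_1,Y_2,Z)\sim P_{UX}P_{S_1S_2}P_{Y_1Y_2Z|S_1S_2X}$, $$R_1\le I(X;Y_1|U,S_1),\qquad R_0+R_2\le I(U;Y_2|S_2),\qquad \mathbb E[d_k(S_k,\hat s_k^*(X,Z))]\le D_k,\quad k=1,2,$$ with mutual informations measured in bits. In particular, feedback helps only for sensing: the region $\mathcal{CD}$ is unchanged if the encoders are restricted to functions $X_i=\phi_i(W_0,W_1,W_2)$ of the messages alone, so that the feedback is used only by the state estimators $h_1,h_2$. -/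

import Mathlib

open Filter Topology

noncomputable section

namespace SDMBC

/-! ### Probability mass functions on finite sets and (conditional) mutual information -/

/-- Probability of the event `E` under the mass function `p` on a finite sample space. -/
def prob {Ω : Type*} [Fintype Ω] (p : Ω → ℝ) (E : Ω → Prop) : ℝ :=
  open Classical in ∑ ω, if E ω then p ω else 0

/-- Expectation of `f` under the mass function `p` on a finite sample space. -/
def expect {Ω : Type*} [Fintype Ω] (p : Ω → ℝ) (f : Ω → ℝ) : ℝ :=
  ∑ ω, p ω * f ω

/-- Conditional mutual information `I(A; B | C)` in bits,
`∑ P(a,b,c) log₂ (P(a,b,c) P(c) / (P(a,c) P(b,c)))`.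
Triples of probability zero contribute zero; in all other terms the argument of the
logarithm is a quotient of positive numbers. -/
def condMutualInfo {Ω α β γ : Type*} [Fintype Ω] [Fintype α] [Fintype β] [Fintype γ]
    (p : Ω → ℝ) (A : Ω → α) (B : Ω → β) (C : Ω → γ) : ℝ :=
  ∑ a, ∑ b, ∑ c,
    prob p (fun ω => A ω = a ∧ B ω = b ∧ C ω = c) *
      Real.logb 2
        (prob p (fun ω => A ω = a ∧ B ω = b ∧ C ω = c) * prob p (fun ω => C ω = c) /
          (prob p (fun ω => A ω = a ∧ C ω = c) * prob p (fun ω => B ω = b ∧ C ω = c)))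

end SDMBC

/-! ### State-dependent memoryless broadcast channels with generalized feedback -/

/-- A state-dependent memoryless broadcast channel with generalized feedback: the joint law of
the two states and the transition law of `(Y₁, Y₂, Z)` given the input and the two states. -/
structure SDMBC (X Y₁ Y₂ Z S₁ S₂ : Type*) [Fintype X] [Fintype Y₁] [Fintype Y₂] [Fintype Z]
    [Fintype S₁] [Fintype S₂] where
  /-- the law `P_{S₁S₂}` -/
  stateLaw : stdSimplex ℝ (S₁ × S₂)
  /-- the transition law `P_{Y₁Y₂Z|S₁S₂X}` -/
  transition : X → S₁ × S₂ → stdSimplex ℝ (Y₁ × Y₂ × Z)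

namespace SDMBC

/-- `PS ch s` is `P_{S₁S₂}(s)`. -/
def PS {X Y₁ Y₂ Z S₁ S₂ : Type*} [Fintype X] [Fintype Y₁] [Fintype Y₂] [Fintype Z]
    [Fintype S₁] [Fintype S₂] (ch : SDMBC X Y₁ Y₂ Z S₁ S₂) (s : S₁ × S₂) : ℝ :=
  ch.stateLaw.1 s

/-- `PYZ ch x s o` is `P_{Y₁Y₂Z|S₁S₂X}(o | s, x)`, with `o = (y₁, y₂, z)`. -/
def PYZ {X Y₁ Y₂ Z S₁ S₂ : Type*} [Fintype X] [Fintype Y₁] [Fintype Y₂] [Fintype Z]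
    [Fintype S₁] [Fintype S₂] (ch : SDMBC X Y₁ Y₂ Z S₁ S₂) (x : X) (s : S₁ × S₂)
    (o : Y₁ × Y₂ × Z) : ℝ :=
  (ch.transition x s).1 o

/-- Physical degradedness: there are conditional laws `P_{Y₁|XS₁}` and `P_{S₂Y₂|S₁Y₁}` with
`P_{Y₁Y₂|S₁S₂X} P_{S₁S₂} = P_{S₁} P_{Y₁|S₁X} P_{S₂Y₂|S₁Y₁}`. -/
def PhysicallyDegraded {X Y₁ Y₂ Z S₁ S₂ : Type*} [Fintype X] [Fintype Y₁] [Fintype Y₂]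
    [Fintype Z] [Fintype S₁] [Fintype S₂] (ch : SDMBC X Y₁ Y₂ Z S₁ S₂) : Prop :=
  ∃ (Q₁ : X → S₁ → stdSimplex ℝ Y₁) (Q₂ : S₁ → Y₁ → stdSimplex ℝ (S₂ × Y₂)),
    ∀ (x : X) (s₁ : S₁) (s₂ : S₂) (y₁ : Y₁) (y₂ : Y₂),
      (∑ z, ch.PYZ x (s₁, s₂) (y₁, y₂, z)) * ch.PS (s₁, s₂) =
        (∑ s₂', ch.PS (s₁, s₂')) * (Q₁ x s₁).1 y₁ * (Q₂ s₁ y₁).1 (s₂, y₂)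

/-! ### Optimal symbol-by-symbol estimators -/

/-- `P(S = s, Z = z | X = x)`; the states are independent of the input. -/
def stateFeedbackLaw {X Y₁ Y₂ Z S₁ S₂ : Type*} [Fintype X] [Fintype Y₁] [Fintype Y₂]
    [Fintype Z] [Fintype S₁] [Fintype S₂] (ch : SDMBC X Y₁ Y₂ Z S₁ S₂)
    (x : X) (z : Z) (s : S₁ × S₂) : ℝ :=
  ch.PS s * ∑ y₁, ∑ y₂, ch.PYZ x s (y₁, y₂, z)

/-- The posterior `P_{S₁|XZ}(s₁ | x, z)`. -/
def posterior₁ {X Y₁ Y₂ Z S₁ S₂ : Type*} [Fintype X] [Fintype Y₁] [Fintype Y₂]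
    [Fintype Z] [Fintype S₁] [Fintype S₂] (ch : SDMBC X Y₁ Y₂ Z S₁ S₂)
    (x : X) (z : Z) (s₁ : S₁) : ℝ :=
  (∑ s₂, ch.stateFeedbackLaw x z (s₁, s₂)) / ∑ s, ch.stateFeedbackLaw x z s

/-- The posterior `P_{S₂|XZ}(s₂ | x, z)`. -/
def posterior₂ {X Y₁ Y₂ Z S₁ S₂ : Type*} [Fintype X] [Fintype Y₁] [Fintype Y₂]
    [Fintype Z] [Fintype S₁] [Fintype S₂] (ch : SDMBC X Y₁ Y₂ Z S₁ S₂)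
    (x : X) (z : Z) (s₂ : S₂) : ℝ :=
  (∑ s₁, ch.stateFeedbackLaw x z (s₁, s₂)) / ∑ s, ch.stateFeedbackLaw x z s

/-- `est x z` minimizes the expected distortion under the posterior `post x z` of the state,
for every `(x, z)`. When `(x, z)` has probability zero the posterior is taken to be `0`, so that
`est x z` is unconstrained there. -/
def IsOptimalEstimator {X Z S T : Type*} [Fintype S] (post : X → Z → S → ℝ) (d : S → T → ℝ)
    (est : X → Z → T) : Prop :=
  ∀ (x : X) (z : Z) (t : T),
    ∑ s, post x z s * d s (est x z) ≤ ∑ s, post x z s * d s t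

/-! ### Codes -/

/-- A code of blocklength `n` with message sets of sizes `M₀, M₁, M₂` and reconstruction
alphabets `T₁, T₂`. -/
structure Code (X Y₁ Y₂ Z S₁ S₂ T₁ T₂ : Type*) (n M₀ M₁ M₂ : ℕ) where
  /-- the time-`i` encoder maps the messages and the `i` past feedback symbols to an input -/
  enc : (i : Fin n) → Fin M₀ × Fin M₁ × Fin M₂ → (Fin (i : ℕ) → Z) → X
  dec₁ : (Fin n → S₁) → (Fin n → Y₁) → Fin M₀ × Fin M₁
  dec₂ : (Fin n → S₂) → (Fin n → Y₂) → Fin M₀ × Fin M₂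
  est₁ : (Fin n → X) → (Fin n → Z) → Fin n → T₁
  est₂ : (Fin n → X) → (Fin n → Z) → Fin n → T₂

/-- Sample space of a block: messages, states at times `i`, outputs `(y₁, y₂, z)` at times `i`. -/
abbrev Outcome (Y₁ Y₂ Z S₁ S₂ : Type*) (n M₀ M₁ M₂ : ℕ) :=
  (Fin M₀ × Fin M₁ × Fin M₂) × (Fin n → S₁ × S₂) × (Fin n → Y₁ × Y₂ × Z)

namespace Code

/-- The channel inputs `x_i = φ_i(w, z^{i-1})`. -/
def inputs {X Y₁ Y₂ Z S₁ S₂ T₁ T₂ : Type*} {n M₀ M₁ M₂ : ℕ}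
    (c : Code X Y₁ Y₂ Z S₁ S₂ T₁ T₂ n M₀ M₁ M₂)
    (w : Fin M₀ × Fin M₁ × Fin M₂) (z : Fin n → Z) (i : Fin n) : X :=
  c.enc i w (fun j => z (Fin.castLE i.isLt.le j))

/-- The encoders do not use the feedback. -/
def IgnoresFeedback {X Y₁ Y₂ Z S₁ S₂ T₁ T₂ : Type*} {n M₀ M₁ M₂ : ℕ}
    (c : Code X Y₁ Y₂ Z S₁ S₂ T₁ T₂ n M₀ M₁ M₂) : Prop :=
  ∀ (i : Fin n) (w : Fin M₀ × Fin M₁ × Fin M₂) (z z' : Fin (i : ℕ) → Z),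
    c.enc i w z = c.enc i w z'

/-- The joint law of messages, states and outputs: the messages are independent and uniform, the
states are i.i.d. and independent of the messages, and the channel is memoryless. -/
def blockLaw {X Y₁ Y₂ Z S₁ S₂ T₁ T₂ : Type*} [Fintype X] [Fintype Y₁] [Fintype Y₂] [Fintype Z]
    [Fintype S₁] [Fintype S₂] {n M₀ M₁ M₂ : ℕ}
    (c : Code X Y₁ Y₂ Z S₁ S₂ T₁ T₂ n M₀ M₁ M₂) (ch : SDMBC X Y₁ Y₂ Z S₁ S₂)
    (ω : Outcome Y₁ Y₂ Z S₁ S₂ n M₀ M₁ M₂) : ℝ :=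
  ((M₀ : ℝ) * M₁ * M₂)⁻¹ *
    ∏ i, ch.PS (ω.2.1 i) *
      ch.PYZ (c.inputs ω.1 (fun j => (ω.2.2 j).2.2) i) (ω.2.1 i) (ω.2.2 i)

/-- The probability that at least one receiver errs:
`(Ŵ₀₁, Ŵ₁) ≠ (W₀, W₁)` or `(Ŵ₀₂, Ŵ₂) ≠ (W₀, W₂)`. -/
def errorProb {X Y₁ Y₂ Z S₁ S₂ T₁ T₂ : Type*} [Fintype X] [Fintype Y₁] [Fintype Y₂] [Fintype Z]
    [Fintype S₁] [Fintype S₂] {n M₀ M₁ M₂ : ℕ}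
    (c : Code X Y₁ Y₂ Z S₁ S₂ T₁ T₂ n M₀ M₁ M₂) (ch : SDMBC X Y₁ Y₂ Z S₁ S₂) : ℝ :=
  prob (c.blockLaw ch) (fun ω =>
    c.dec₁ (fun i => (ω.2.1 i).1) (fun i => (ω.2.2 i).1) ≠ (ω.1.1, ω.1.2.1) ∨
    c.dec₂ (fun i => (ω.2.1 i).2) (fun i => (ω.2.2 i).2.1) ≠ (ω.1.1, ω.1.2.2))

/-- Expected average per-block distortion of the estimates of the first state. -/
def distortion₁ {X Y₁ Y₂ Z S₁ S₂ T₁ T₂ : Type*} [Fintype X] [Fintype Y₁] [Fintype Y₂]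
    [Fintype Z] [Fintype S₁] [Fintype S₂] {n M₀ M₁ M₂ : ℕ}
    (c : Code X Y₁ Y₂ Z S₁ S₂ T₁ T₂ n M₀ M₁ M₂) (ch : SDMBC X Y₁ Y₂ Z S₁ S₂)
    (d₁ : S₁ → T₁ → ℝ) : ℝ :=
  (1 / (n : ℝ)) * ∑ i, expect (c.blockLaw ch) (fun ω =>
    d₁ (ω.2.1 i).1
      (c.est₁ (c.inputs ω.1 (fun j => (ω.2.2 j).2.2)) (fun j => (ω.2.2 j).2.2) i))

/-- Expected average per-block distortion of the estimates of the second state. -/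
def distortion₂ {X Y₁ Y₂ Z S₁ S₂ T₁ T₂ : Type*} [Fintype X] [Fintype Y₁] [Fintype Y₂]
    [Fintype Z] [Fintype S₁] [Fintype S₂] {n M₀ M₁ M₂ : ℕ}
    (c : Code X Y₁ Y₂ Z S₁ S₂ T₁ T₂ n M₀ M₁ M₂) (ch : SDMBC X Y₁ Y₂ Z S₁ S₂)
    (d₂ : S₂ → T₂ → ℝ) : ℝ :=
  (1 / (n : ℝ)) * ∑ i, expect (c.blockLaw ch) (fun ω =>
    d₂ (ω.2.1 i).2
      (c.est₂ (c.inputs ω.1 (fun j => (ω.2.2 j).2.2)) (fun j => (ω.2.2 j).2.2) i))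

end Code

/-! ### Achievability and the capacity-distortion region -/

/-- The number of elements of `[1 : 2^{nR}]`. -/
def numMessages (n : ℕ) (R : ℝ) : ℕ := ⌊(2 : ℝ) ^ ((n : ℝ) * R)⌋₊

/-- A sequence of `(2^{nR₀}, 2^{nR₁}, 2^{nR₂}, n)` codes. -/
abbrev CodeSeq (X Y₁ Y₂ Z S₁ S₂ T₁ T₂ : Type*) (R₀ R₁ R₂ : ℝ) :=
  (n : ℕ) → Code X Y₁ Y₂ Z S₁ S₂ T₁ T₂ n (numMessages n R₀) (numMessages n R₁) (numMessages n R₂)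

/-- Vanishing error probability and asymptotic distortions at most `D₁` and `D₂`. The upper limits
are taken in the extended reals. -/
def CodeSeq.Attains {X Y₁ Y₂ Z S₁ S₂ T₁ T₂ : Type*} [Fintype X] [Fintype Y₁] [Fintype Y₂]
    [Fintype Z] [Fintype S₁] [Fintype S₂] {R₀ R₁ R₂ : ℝ}
    (c : CodeSeq X Y₁ Y₂ Z S₁ S₂ T₁ T₂ R₀ R₁ R₂) (ch : SDMBC X Y₁ Y₂ Z S₁ S₂)
    (d₁ : S₁ → T₁ → ℝ) (d₂ : S₂ → T₂ → ℝ) (D₁ D₂ : ℝ) : Prop :=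
  Tendsto (fun n => (c n).errorProb ch) atTop (𝓝 0) ∧
  limsup (fun n => (((c n).distortion₁ ch d₁ : ℝ) : EReal)) atTop ≤ (D₁ : EReal) ∧
  limsup (fun n => (((c n).distortion₂ ch d₂ : ℝ) : EReal)) atTop ≤ (D₂ : EReal)

/-- The set of achievable rate-distortion tuples `(R₀, R₁, R₂, D₁, D₂)`. -/
def achievable {X Y₁ Y₂ Z S₁ S₂ T₁ T₂ : Type*} [Fintype X] [Fintype Y₁] [Fintype Y₂]
    [Fintype Z] [Fintype S₁] [Fintype S₂] (ch : SDMBC X Y₁ Y₂ Z S₁ S₂)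
    (d₁ : S₁ → T₁ → ℝ) (d₂ : S₂ → T₂ → ℝ) : Set (ℝ × ℝ × ℝ × ℝ × ℝ) :=
  {t | match t with
    | (R₀, R₁, R₂, D₁, D₂) =>
      0 ≤ R₀ ∧ 0 ≤ R₁ ∧ 0 ≤ R₂ ∧
        ∃ c : CodeSeq X Y₁ Y₂ Z S₁ S₂ T₁ T₂ R₀ R₁ R₂, c.Attains ch d₁ d₂ D₁ D₂}

/-- The tuples that are achievable by codes whose encoders do not use the feedback (the state
estimators still do). -/
def achievableIgnoringFeedback {X Y₁ Y₂ Z S₁ S₂ T₁ T₂ : Type*} [Fintype X] [Fintype Y₁]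
    [Fintype Y₂] [Fintype Z] [Fintype S₁] [Fintype S₂] (ch : SDMBC X Y₁ Y₂ Z S₁ S₂)
    (d₁ : S₁ → T₁ → ℝ) (d₂ : S₂ → T₂ → ℝ) : Set (ℝ × ℝ × ℝ × ℝ × ℝ) :=
  {t | match t with
    | (R₀, R₁, R₂, D₁, D₂) =>
      0 ≤ R₀ ∧ 0 ≤ R₁ ∧ 0 ≤ R₂ ∧
        ∃ c : CodeSeq X Y₁ Y₂ Z S₁ S₂ T₁ T₂ R₀ R₁ R₂,
          (∀ n, (c n).IgnoresFeedback) ∧ c.Attains ch d₁ d₂ D₁ D₂}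

/-- The capacity-distortion region. -/
def capacityDistortionRegion {X Y₁ Y₂ Z S₁ S₂ T₁ T₂ : Type*} [Fintype X] [Fintype Y₁]
    [Fintype Y₂] [Fintype Z] [Fintype S₁] [Fintype S₂] (ch : SDMBC X Y₁ Y₂ Z S₁ S₂)
    (d₁ : S₁ → T₁ → ℝ) (d₂ : S₂ → T₂ → ℝ) : Set (ℝ × ℝ × ℝ × ℝ × ℝ) :=
  closure (ch.achievable d₁ d₂)

/-- The capacity-distortion region when the encoders may not use the feedback. -/
def capacityDistortionRegionIgnoringFeedback {X Y₁ Y₂ Z S₁ S₂ T₁ T₂ : Type*} [Fintype X]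
    [Fintype Y₁] [Fintype Y₂] [Fintype Z] [Fintype S₁] [Fintype S₂]
    (ch : SDMBC X Y₁ Y₂ Z S₁ S₂) (d₁ : S₁ → T₁ → ℝ) (d₂ : S₂ → T₂ → ℝ) :
    Set (ℝ × ℝ × ℝ × ℝ × ℝ) :=
  closure (ch.achievableIgnoringFeedback d₁ d₂)

/-! ### The single-letter region -/

/-- The law `P_{UX} P_{S₁S₂} P_{Y₁Y₂Z|S₁S₂X}` of `((U, X), (S₁, S₂), (Y₁, Y₂, Z))`. -/
def singleLetterLaw {X Y₁ Y₂ Z S₁ S₂ U : Type*} [Fintype X] [Fintype Y₁] [Fintype Y₂]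
    [Fintype Z] [Fintype S₁] [Fintype S₂] [Fintype U] (ch : SDMBC X Y₁ Y₂ Z S₁ S₂)
    (PUX : stdSimplex ℝ (U × X)) (ω : (U × X) × (S₁ × S₂) × (Y₁ × Y₂ × Z)) : ℝ :=
  PUX.1 ω.1 * ch.PS ω.2.1 * ch.PYZ ω.1.2 ω.2.1 ω.2.2

/-- The tuples `(R₀, R₁, R₂, D₁, D₂)` for which some finite-alphabet auxiliary variable `U` and some
law `P_{UX}` satisfy `R₁ ≤ I(X; Y₁ | U, S₁)`, `R₀ + R₂ ≤ I(U; Y₂ | S₂)` and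
`E[d_k(S_k, ŝ_k(X, Z))] ≤ D_k` for `k = 1, 2`. -/
def singleLetterSet {X Y₁ Y₂ Z S₁ S₂ T₁ T₂ : Type*} [Fintype X] [Fintype Y₁]
    [Fintype Y₂] [Fintype Z] [Fintype S₁] [Fintype S₂] (ch : SDMBC X Y₁ Y₂ Z S₁ S₂)
    (d₁ : S₁ → T₁ → ℝ) (d₂ : S₂ → T₂ → ℝ) (sh₁ : X → Z → T₁) (sh₂ : X → Z → T₂) :
    Set (ℝ × ℝ × ℝ × ℝ × ℝ) :=
  {t | match t with
    | (R₀, R₁, R₂, D₁, D₂) =>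
      0 ≤ R₀ ∧ 0 ≤ R₁ ∧ 0 ≤ R₂ ∧
        ∃ (m : ℕ) (PUX : stdSimplex ℝ (Fin m × X)),
          R₁ ≤ condMutualInfo (ch.singleLetterLaw PUX)
            (fun ω => ω.1.2) (fun ω => ω.2.2.1) (fun ω => (ω.1.1, ω.2.1.1)) ∧
          R₀ + R₂ ≤ condMutualInfo (ch.singleLetterLaw PUX)
            (fun ω => ω.1.1) (fun ω => ω.2.2.2.1) (fun ω => ω.2.1.2) ∧
          expect (ch.singleLetterLaw PUX)
            (fun ω => d₁ ω.2.1.1 (sh₁ ω.1.2 ω.2.2.2.2)) ≤ D₁ ∧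
          expect (ch.singleLetterLaw PUX)
            (fun ω => d₂ ω.2.1.2 (sh₂ ω.1.2 ω.2.2.2.2)) ≤ D₂}

end SDMBC

end

/-! The regions are sandwiched: every achievable tuple lies in the closure of the single-letter set
(`achievable_subset`), and every single-letter tuple is a limit of tuples attained by encoders that
ignore the feedback (`singleLetterSet_subset`). Both claims follow at once.

Converse. Let B_i = (S₁, Y₁, S₂, Y₂) at time i and let U_i consist of W₀, W₂ and all B_j with j < i.
Fano's inequality and the chain rule bound log M₁ by the sum of H(B_i | U_i) − H(B_i | U_i, X_i), up
to vanishing terms. Feedback does not help because, given the messages and the whole past, the law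
of B_i depends on X_i alone (`Code.condEnt_at`). By degradedness the law of (S₂, Y₂) given (S₁, Y₁)
does not involve (U, X), so each difference is an I(X; Y₁ | U, S₁) (`mutualInfo_input`). The rate R₀
+ R₂ is bounded in the same way with (S₂, Y₂), where enlarging the conditioning from the past of
receiver 2 to U_i goes in the right direction. A uniform time, made a component of U, turns the
averages into one single-letter law (`Code.law_timeLaw`). For sensing, once the messages and the
feedback sequence are fixed the joint law factors over time, so the symbol-by-symbol estimator beats
every other (`Code.expect_optimal_le`).

Achievability. Superposition coding: clouds carry (W₀, W₂), satellites carry W₁. Writing X = T(U)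
with T independent of U (`exists_functional_representation`) lets a single satellite codebook, drawn
independently of the clouds, serve all of them. Receivers apply threshold tests to likelihood
ratios: Chebyshev's inequality shows that the true codeword passes, Markov's inequality that wrong
ones fail. Receiver 1 must decode the cloud too, which costs nothing since I(U; Y₂ | S₂) ≤ I(U; Y₁ |
S₁) (`mutualInfo_cloud_le`). Second moments of the distortions are small as well, so one codebook is
good for the error and for both distortions (`exists_code_of_tests`). -/

namespace SDMBC

/-! ### Finite probability, entropy and Gibbs' inequality -/

section FiniteProbability

variable {Ω Ω' α β γ δ : Type*} [Fintype Ω] [Fintype Ω']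

/-- A probability mass function on a finite sample space. -/
structure IsPMF (p : Ω → ℝ) : Prop where
  nonneg : ∀ ω, 0 ≤ p ω
  sum_eq_one : ∑ ω, p ω = 1

theorem prob_nonneg {p : Ω → ℝ} (hp : ∀ ω, 0 ≤ p ω) (E : Ω → Prop) : 0 ≤ prob p E := by
  classical
  exact Finset.sum_nonneg fun ω _ => by split_ifs <;> simp [hp]

theorem prob_mono {p : Ω → ℝ} (hp : ∀ ω, 0 ≤ p ω) {E F : Ω → Prop} (h : ∀ ω, E ω → F ω) :
    prob p E ≤ prob p F := by
  classical
  refine Finset.sum_le_sum fun ω _ => ?_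
  have := hp ω
  have := h ω
  split_ifs <;> simp_all

theorem prob_congr (p : Ω → ℝ) {E F : Ω → Prop} (h : ∀ ω, E ω ↔ F ω) : prob p E = prob p F := by
  rw [show E = F from funext fun ω => propext (h ω)]

theorem self_le_prob {p : Ω → ℝ} (hp : ∀ ω, 0 ≤ p ω) {E : Ω → Prop} {ω : Ω} (h : E ω) :
    p ω ≤ prob p E := by
  classical
  have := Finset.single_le_sum (f := fun ω => if E ω then p ω else 0)
    (fun ω _ => by split_ifs <;> simp [hp]) (Finset.mem_univ ω)
  simpa [prob, h] using this

theorem prob_pos_of_pos {p : Ω → ℝ} (hp : ∀ ω, 0 ≤ p ω) {E : Ω → Prop} {ω : Ω} (h : E ω)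
    (hω : p ω ≠ 0) : 0 < prob p E :=
  lt_of_lt_of_le (lt_of_le_of_ne (hp ω) (Ne.symm hω)) (self_le_prob hp h)

/-- The indicator of a proposition. -/
noncomputable def ind (E : Prop) : ℝ := open Classical in if E then 1 else 0

@[simp] theorem ind_of_true {E : Prop} (h : E) : ind E = 1 := by simp [ind, h]

@[simp] theorem ind_of_false {E : Prop} (h : ¬E) : ind E = 0 := by simp [ind, h]

theorem ind_nonneg (E : Prop) : 0 ≤ ind E := by
  unfold ind
  split_ifs <;> norm_num

theorem ind_le_one (E : Prop) : ind E ≤ 1 := by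
  unfold ind
  split_ifs <;> norm_num

theorem prob_eq_sum_mul (p : Ω → ℝ) (E : Ω → Prop) : prob p E = ∑ ω, p ω * ind (E ω) := by
  simp [prob, ind]

theorem sum_prob_mul [Fintype α] (p : Ω → ℝ) (A : Ω → α) (f : α → ℝ) :
    ∑ a, prob p (fun ω => A ω = a) * f a = ∑ ω, p ω * f (A ω) := by
  classical
  simp only [prob, Finset.sum_mul]
  rw [Finset.sum_comm]
  refine Finset.sum_congr rfl fun ω _ => ?_
  simp [ite_mul]

theorem sum_prob_and [Fintype α] (p : Ω → ℝ) (A : Ω → α) (E : Ω → Prop) :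
    ∑ a, prob p (fun ω => A ω = a ∧ E ω) = prob p E := by
  classical
  simp only [prob]
  rw [Finset.sum_comm]
  refine Finset.sum_congr rfl fun ω _ => ?_
  by_cases h : E ω <;> simp [h]

theorem sum_prob [Fintype α] (p : Ω → ℝ) (A : Ω → α) :
    ∑ a, prob p (fun ω => A ω = a) = ∑ ω, p ω := by
  simpa using sum_prob_mul p A fun _ => 1

theorem IsPMF.prob_le_one {p : Ω → ℝ} (hp : IsPMF p) (E : Ω → Prop) : prob p E ≤ 1 := by
  classical
  rw [← hp.sum_eq_one]
  exact Finset.sum_le_sum fun ω _ => by split_ifs <;> simp [hp.nonneg ω]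

theorem IsPMF.law [Fintype α] {p : Ω → ℝ} (hp : IsPMF p) (A : Ω → α) :
    IsPMF fun a => prob p fun ω => A ω = a :=
  ⟨fun _ => prob_nonneg hp.nonneg _, by rw [sum_prob, hp.sum_eq_one]⟩

/-- The probability of an event under the law of a random variable. -/
theorem prob_law [Fintype α] (p : Ω → ℝ) (A : Ω → α) (E : α → Prop) :
    prob (fun a => prob p fun ω => A ω = a) E = prob p fun ω => E (A ω) := by
  classical
  rw [prob_eq_sum_mul, sum_prob_mul, prob_eq_sum_mul]

theorem expect_law [Fintype α] (p : Ω → ℝ) (A : Ω → α) (f : α → ℝ) :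
    expect (fun a => prob p fun ω => A ω = a) f = expect p fun ω => f (A ω) :=
  sum_prob_mul p A f

/-! ### Entropy, in nats -/

/-- The entropy of a random variable, in nats. -/
noncomputable def ent (p : Ω → ℝ) (A : Ω → α) : ℝ :=
  -∑ ω, p ω * Real.log (prob p fun ω' => A ω' = A ω)

/-- The conditional entropy `H(A | C)`, in nats. -/
noncomputable def condEnt (p : Ω → ℝ) (A : Ω → α) (C : Ω → γ) : ℝ :=
  ent p (fun ω => (A ω, C ω)) - ent p C

/-- Entropy sees a random variable only through its partition into fibers. Regroupings and
relabelings of coordinates therefore reduce to an equivalence of equalities, and no finiteness of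
the value type is needed. -/
theorem ent_congr (p : Ω → ℝ) {A : Ω → α} {B : Ω → β}
    (h : ∀ ω' ω, A ω' = A ω ↔ B ω' = B ω) : ent p A = ent p B := by
  unfold ent
  simp only [h]

theorem condEnt_congr (p : Ω → ℝ) {A : Ω → α} {B : Ω → β} {C : Ω → γ} {D : Ω → δ}
    (h : ∀ ω' ω, C ω' = C ω ↔ D ω' = D ω)
    (h' : ∀ ω' ω, C ω' = C ω → (A ω' = A ω ↔ B ω' = B ω)) : condEnt p A C = condEnt p B D := by
  unfold condEnt
  rw [ent_congr p h, ent_congr p (A := fun ω => (A ω, C ω)) (B := fun ω => (B ω, D ω))]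
  intro ω' ω
  simp only [Prod.mk.injEq]
  rw [← h]
  have := h' ω' ω
  tauto

theorem condEnt_prod (p : Ω → ℝ) (A : Ω → α) (B : Ω → β) (C : Ω → γ) :
    condEnt p (fun ω => (A ω, B ω)) C = condEnt p A C + condEnt p B (fun ω => (A ω, C ω)) := by
  unfold condEnt
  rw [ent_congr p (A := fun ω => ((A ω, B ω), C ω)) (B := fun ω => (B ω, A ω, C ω))]
  · ring
  · intro ω' ω
    simp only [Prod.mk.injEq]
    tauto

theorem condEnt_of_const (p : Ω → ℝ) (hp : IsPMF p) (A : Ω → α) {C : Ω → γ}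
    (h : ∀ ω' ω, C ω' = C ω) : condEnt p A C = ent p A := by
  have h1 : prob p (fun _ => True) = 1 := by simpa [prob] using hp.sum_eq_one
  have h0 : ent p C = 0 := by
    unfold ent
    have h2 : ∀ ω, (prob p fun ω' => C ω' = C ω) = 1 := fun ω =>
      (prob_congr p fun ω' => by simp only [h ω' ω]).trans h1
    simp only [h2, Real.log_one, mul_zero, Finset.sum_const_zero, neg_zero]
  rw [condEnt, h0, sub_zero]
  exact ent_congr p fun ω' ω => by simp [h ω' ω]

/-- Gibbs' inequality. -/
theorem ent_le_cross [Fintype α] {p : Ω → ℝ} (hp : IsPMF p) (A : Ω → α) (q : α → ℝ)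
    (hq : ∀ a, 0 ≤ q a) (hq1 : ∑ a, q a ≤ 1) (hpos : ∀ ω, p ω ≠ 0 → 0 < q (A ω)) :
    ent p A ≤ -∑ ω, p ω * Real.log (q (A ω)) := by
  have key : ∀ ω, p ω * Real.log (q (A ω)) - p ω * Real.log (prob p fun ω' => A ω' = A ω) ≤
      p ω * (q (A ω) / prob p (fun ω' => A ω' = A ω)) - p ω := by
    intro ω
    by_cases h : p ω = 0
    · simp [h]
    have h1 := hpos ω h
    have h2 : 0 < prob p fun ω' => A ω' = A ω := prob_pos_of_pos hp.nonneg rfl h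
    rw [← mul_sub, ← Real.log_div h1.ne' h2.ne']
    have := Real.log_le_sub_one_of_pos (div_pos h1 h2)
    nlinarith [hp.nonneg ω]
  have h1 := Finset.sum_le_sum fun ω (_ : ω ∈ Finset.univ) => key ω
  rw [Finset.sum_sub_distrib, Finset.sum_sub_distrib, hp.sum_eq_one,
    ← sum_prob_mul p A fun a => q a / prob p fun ω' => A ω' = a] at h1
  have h2 : ∑ a, prob p (fun ω => A ω = a) * (q a / prob p fun ω' => A ω' = a) ≤ ∑ a, q a := by
    refine Finset.sum_le_sum fun a _ => ?_
    rcases eq_or_ne (prob p fun ω' => A ω' = a) 0 with h | h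
    · simp [h, hq]
    · rw [mul_div_cancel₀ _ h]
  unfold ent
  linarith

/-- Gibbs' inequality for the pair (A, C) with reference weights P(c) q(c, a); the factor P(c)
accounts for H(C). A good choice of `q` gives both monotonicity under conditioning and Fano's
inequality. -/
theorem condEnt_le_cross [Fintype α] [Fintype γ] {p : Ω → ℝ} (hp : IsPMF p) (A : Ω → α)
    (C : Ω → γ) (q : γ → α → ℝ) (hq : ∀ c a, 0 ≤ q c a) (hq1 : ∀ c, ∑ a, q c a ≤ 1)
    (hpos : ∀ ω, p ω ≠ 0 → 0 < q (C ω) (A ω)) :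
    condEnt p A C ≤ -∑ ω, p ω * Real.log (q (C ω) (A ω)) := by
  have := ent_le_cross hp (fun ω => (A ω, C ω)) (fun x => prob p (fun ω => C ω = x.2) * q x.2 x.1)
    (fun x => mul_nonneg (prob_nonneg hp.nonneg _) (hq _ _))
    (by
      rw [Fintype.sum_prod_type, Finset.sum_comm]
      simp only [← Finset.mul_sum]
      calc _ ≤ ∑ c, prob p (fun ω => C ω = c) * 1 := Finset.sum_le_sum fun c _ =>
            mul_le_mul_of_nonneg_left (hq1 c) (prob_nonneg hp.nonneg _)
        _ = 1 := by simp [sum_prob, hp.sum_eq_one])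
    (fun ω hω => mul_pos (prob_pos_of_pos hp.nonneg rfl hω) (hpos ω hω))
  have h2 : ∑ ω, p ω * Real.log (prob p (fun ω' => C ω' = C ω) * q (C ω) (A ω)) =
      ∑ ω, p ω * Real.log (prob p (fun ω' => C ω' = C ω)) + ∑ ω, p ω * Real.log (q (C ω) (A ω)) := by
    rw [← Finset.sum_add_distrib]
    refine Finset.sum_congr rfl fun ω _ => ?_
    by_cases h : p ω = 0
    · simp [h]
    have h1 : 0 < prob p fun ω' => C ω' = C ω := prob_pos_of_pos hp.nonneg rfl h
    rw [Real.log_mul h1.ne' (hpos ω h).ne', mul_add]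
  dsimp only at this
  rw [h2] at this
  unfold condEnt
  unfold ent at this ⊢
  linarith

/-- If the conditional law of `A` given `C` is a kernel evaluated at `C`, then the conditional
entropy is an explicit expectation. -/
theorem condEnt_eq_of_kernel {p : Ω → ℝ} (hp : ∀ ω, 0 ≤ p ω) (A : Ω → α) (C : Ω → γ)
    (q : γ → α → ℝ)
    (h : ∀ a c, prob p (fun ω => A ω = a ∧ C ω = c) = prob p (fun ω => C ω = c) * q c a) :
    condEnt p A C = -∑ ω, p ω * Real.log (q (C ω) (A ω)) := by
  unfold condEnt ent
  simp only [Prod.mk.injEq, h]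
  rw [← sub_eq_zero]
  have : ∑ ω, p ω * Real.log (prob p (fun ω' => C ω' = C ω) * q (C ω) (A ω)) =
      ∑ ω, p ω * Real.log (prob p (fun ω' => C ω' = C ω)) + ∑ ω, p ω * Real.log (q (C ω) (A ω)) := by
    rw [← Finset.sum_add_distrib]
    refine Finset.sum_congr rfl fun ω _ => ?_
    by_cases hω : p ω = 0
    · simp [hω]
    have h1 : 0 < prob p fun ω' => C ω' = C ω := prob_pos_of_pos hp rfl hω
    have h2 : 0 < prob p fun ω' => A ω' = A ω ∧ C ω' = C ω := prob_pos_of_pos hp ⟨rfl, rfl⟩ hω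
    rw [h] at h2
    rw [Real.log_mul h1.ne' (right_ne_zero_of_mul h2.ne'), mul_add]
  rw [this]
  ring

/-- Conditioning reduces entropy. -/
theorem condEnt_anti [Fintype α] [Fintype γ] [Fintype δ] {p : Ω → ℝ} (hp : IsPMF p) (A : Ω → α)
    (C : Ω → γ) (D : Ω → δ) (f : δ → γ) (hf : ∀ ω, C ω = f (D ω)) :
    condEnt p A D ≤ condEnt p A C := by
  have hcond : ∀ a c, prob p (fun ω => A ω = a ∧ C ω = c) = prob p (fun ω => C ω = c) *
      (prob p (fun ω => A ω = a ∧ C ω = c) / prob p (fun ω => C ω = c)) := by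
    intro a c
    rcases eq_or_ne (prob p fun ω => C ω = c) 0 with h | h
    · rw [h, zero_mul]
      refine le_antisymm (h ▸ prob_mono hp.nonneg fun ω hω => hω.2) (prob_nonneg hp.nonneg _)
    · rw [mul_div_cancel₀ _ h]
  rw [condEnt_eq_of_kernel hp.nonneg A C _ hcond]
  simp only [hf]
  -- The reference kernel is the conditional law of A given the coarser variable f(D).
  refine condEnt_le_cross hp A D (fun d a => prob p (fun ω => A ω = a ∧ f (D ω) = f d) /
    prob p (fun ω => f (D ω) = f d)) (fun d a => div_nonneg (prob_nonneg hp.nonneg _)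
      (prob_nonneg hp.nonneg _)) (fun d => ?_) fun ω hω =>
      div_pos (prob_pos_of_pos hp.nonneg ⟨rfl, rfl⟩ hω) (prob_pos_of_pos hp.nonneg rfl hω)
  rw [← Finset.sum_div, sum_prob_and]
  exact div_self_le_one _

theorem condEnt_le_ent [Fintype α] [Fintype δ] {p : Ω → ℝ} (hp : IsPMF p) (A : Ω → α)
    (D : Ω → δ) : condEnt p A D ≤ ent p A := by
  rw [← condEnt_of_const p hp A (C := fun _ => ()) fun _ _ => rfl]
  exact condEnt_anti hp A _ D (fun _ => ()) fun _ => rfl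

/-! ### Conditional mutual information -/

/-- The ratio `P(a,b,c) P(c) / (P(a,c) P(b,c))` in the definition of `I(A; B | C)`. -/
noncomputable def infoRatio (p : Ω → ℝ) (A : Ω → α) (B : Ω → β) (C : Ω → γ) (a : α) (b : β)
    (c : γ) : ℝ :=
  prob p (fun ω => A ω = a ∧ B ω = b ∧ C ω = c) * prob p (fun ω => C ω = c) /
    (prob p (fun ω => A ω = a ∧ C ω = c) * prob p (fun ω => B ω = b ∧ C ω = c))

theorem infoRatio_nonneg {p : Ω → ℝ} (hp : ∀ ω, 0 ≤ p ω) (A : Ω → α) (B : Ω → β) (C : Ω → γ)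
    (a : α) (b : β) (c : γ) : 0 ≤ infoRatio p A B C a b c := by
  unfold infoRatio
  have := prob_nonneg hp
  exact div_nonneg (mul_nonneg (this _) (this _)) (mul_nonneg (this _) (this _))

theorem infoRatio_pos {p : Ω → ℝ} (hp : ∀ ω, 0 ≤ p ω) (A : Ω → α) (B : Ω → β) (C : Ω → γ)
    {ω : Ω} (h : p ω ≠ 0) : 0 < infoRatio p A B C (A ω) (B ω) (C ω) :=
  div_pos (mul_pos (prob_pos_of_pos hp ⟨rfl, rfl, rfl⟩ h) (prob_pos_of_pos hp rfl h))
    (mul_pos (prob_pos_of_pos hp ⟨rfl, rfl⟩ h) (prob_pos_of_pos hp ⟨rfl, rfl⟩ h))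

section MutualInfo

variable [Fintype α] [Fintype β] [Fintype γ]

theorem condMutualInfo_eq_sum (p : Ω → ℝ) (A : Ω → α) (B : Ω → β) (C : Ω → γ) :
    condMutualInfo p A B C =
      ∑ ω, p ω * Real.logb 2 (infoRatio p A B C (A ω) (B ω) (C ω)) := by
  have := sum_prob_mul p (fun ω => (A ω, B ω, C ω)) fun x =>
    Real.logb 2 (infoRatio p A B C x.1 x.2.1 x.2.2)
  rw [← this]
  simp only [Fintype.sum_prod_type, Prod.mk.injEq]
  rfl

/-- The logarithm of the ratio splits into four terms, whose expectations are joint entropies; the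
factor log 2 passes from bits to nats. From here on information is handled as a difference of
conditional entropies. -/
theorem condMutualInfo_mul_log_two {p : Ω → ℝ} (hp : ∀ ω, 0 ≤ p ω) (A : Ω → α) (B : Ω → β)
    (C : Ω → γ) :
    condMutualInfo p A B C * Real.log 2 =
      condEnt p B C - condEnt p B (fun ω => (A ω, C ω)) := by
  rw [condMutualInfo_eq_sum, Finset.sum_mul]
  unfold condEnt
  rw [ent_congr p (A := fun ω => (B ω, A ω, C ω)) (B := fun ω => (A ω, B ω, C ω))
    (fun ω' ω => by simp only [Prod.mk.injEq]; tauto)]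
  unfold ent
  have : ∀ ω, p ω * Real.logb 2 (infoRatio p A B C (A ω) (B ω) (C ω)) * Real.log 2 =
      p ω * Real.log (prob p fun ω' => (A ω', B ω', C ω') = (A ω, B ω, C ω)) +
      p ω * Real.log (prob p fun ω' => C ω' = C ω) -
      p ω * Real.log (prob p fun ω' => (A ω', C ω') = (A ω, C ω)) -
      p ω * Real.log (prob p fun ω' => (B ω', C ω') = (B ω, C ω)) := by
    intro ω
    by_cases h : p ω = 0
    · simp [h]
    have h1 : 0 < prob p fun ω' => (A ω', B ω', C ω') = (A ω, B ω, C ω) :=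
      prob_pos_of_pos hp rfl h
    have h2 : 0 < prob p fun ω' => C ω' = C ω := prob_pos_of_pos hp rfl h
    have h3 : 0 < prob p fun ω' => (A ω', C ω') = (A ω, C ω) := prob_pos_of_pos hp rfl h
    have h4 : 0 < prob p fun ω' => (B ω', C ω') = (B ω, C ω) := prob_pos_of_pos hp rfl h
    have hl : Real.log 2 ≠ 0 := (Real.log_pos one_lt_two).ne'
    rw [mul_assoc, Real.logb, div_mul_cancel₀ _ hl]
    simp only [Prod.mk.injEq] at h1 h3 h4 ⊢
    unfold infoRatio
    rw [Real.log_div (mul_pos h1 h2).ne' (mul_pos h3 h4).ne', Real.log_mul h1.ne' h2.ne',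
      Real.log_mul h3.ne' h4.ne']
    ring
  simp only [this, Finset.sum_sub_distrib, Finset.sum_add_distrib]
  ring

theorem condMutualInfo_nonneg {p : Ω → ℝ} (hp : IsPMF p) (A : Ω → α) (B : Ω → β) (C : Ω → γ) :
    0 ≤ condMutualInfo p A B C := by
  have h := condMutualInfo_mul_log_two hp.nonneg A B C
  have h2 := condEnt_anti hp B C (fun ω => (A ω, C ω)) Prod.snd fun _ => rfl
  have h3 : 0 < Real.log 2 := Real.log_pos one_lt_two
  by_contra! hc
  nlinarith

end MutualInfo

end FiniteProbability

/-! ### Single-letter identities and the effect of degradedness -/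

section SingleLetter

variable {X Y₁ Y₂ Z S₁ S₂ U γ : Type*} [Fintype X] [Fintype Y₁] [Fintype Y₂]
    [Fintype Z] [Fintype S₁] [Fintype S₂] [Fintype U]

theorem PS_nonneg (ch : SDMBC X Y₁ Y₂ Z S₁ S₂) (s : S₁ × S₂) : 0 ≤ ch.PS s :=
  ch.stateLaw.2.1 s

theorem sum_PS (ch : SDMBC X Y₁ Y₂ Z S₁ S₂) : ∑ s, ch.PS s = 1 := ch.stateLaw.2.2

theorem PYZ_nonneg (ch : SDMBC X Y₁ Y₂ Z S₁ S₂) (x : X) (s : S₁ × S₂) (o : Y₁ × Y₂ × Z) :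
    0 ≤ ch.PYZ x s o :=
  (ch.transition x s).2.1 o

theorem sum_PYZ (ch : SDMBC X Y₁ Y₂ Z S₁ S₂) (x : X) (s : S₁ × S₂) : ∑ o, ch.PYZ x s o = 1 :=
  (ch.transition x s).2.2

/-- Summing out the outputs of the channel. -/
theorem sum_singleLetterLaw_mul (ch : SDMBC X Y₁ Y₂ Z S₁ S₂) (PUX : stdSimplex ℝ (U × X))
    (F : U × X → S₁ × S₂ → ℝ) :
    ∑ ω, ch.singleLetterLaw PUX ω * F ω.1 ω.2.1 = ∑ v, PUX.1 v * ∑ s, ch.PS s * F v s := by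
  rw [Fintype.sum_prod_type]
  refine Finset.sum_congr rfl fun v _ => ?_
  rw [Fintype.sum_prod_type, Finset.mul_sum]
  refine Finset.sum_congr rfl fun s _ => ?_
  simp only [singleLetterLaw]
  rw [← Finset.sum_mul, ← Finset.mul_sum, sum_PYZ]
  ring

theorem isPMF_singleLetterLaw (ch : SDMBC X Y₁ Y₂ Z S₁ S₂) (PUX : stdSimplex ℝ (U × X)) :
    IsPMF (ch.singleLetterLaw PUX) where
  nonneg ω := mul_nonneg (mul_nonneg (PUX.2.1 _) (ch.PS_nonneg _)) (ch.PYZ_nonneg _ _ _)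
  sum_eq_one := by
    have := sum_singleLetterLaw_mul ch PUX fun _ _ => 1
    simpa [sum_PS, PUX.2.2] using this

/-- The states are independent of `(U, X)`. -/
theorem prob_state_and (ch : SDMBC X Y₁ Y₂ Z S₁ S₂) (PUX : stdSimplex ℝ (U × X))
    (E : S₁ × S₂ → Prop) (G : U × X → Prop) :
    prob (ch.singleLetterLaw PUX) (fun ω => E ω.2.1 ∧ G ω.1) =
      prob (ch.singleLetterLaw PUX) (fun ω => G ω.1) * prob ch.PS E := by
  classical
  simp only [prob_eq_sum_mul]
  rw [sum_singleLetterLaw_mul ch PUX fun v s => ind (E s ∧ G v),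
    sum_singleLetterLaw_mul ch PUX fun v _ => ind (G v), Finset.sum_mul]
  refine Finset.sum_congr rfl fun v _ => ?_
  by_cases h : G v <;> simp [h, sum_PS]

/-- The joint law of everything but the feedback in a physically degraded channel. -/
theorem sum_singleLetterLaw_mul_of_degraded (ch : SDMBC X Y₁ Y₂ Z S₁ S₂)
    {Q₁ : X → S₁ → stdSimplex ℝ Y₁} {Q₂ : S₁ → Y₁ → stdSimplex ℝ (S₂ × Y₂)}
    (hQ : ∀ (x : X) (s₁ : S₁) (s₂ : S₂) (y₁ : Y₁) (y₂ : Y₂),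
      (∑ z, ch.PYZ x (s₁, s₂) (y₁, y₂, z)) * ch.PS (s₁, s₂) =
        (∑ s₂', ch.PS (s₁, s₂')) * (Q₁ x s₁).1 y₁ * (Q₂ s₁ y₁).1 (s₂, y₂))
    (PUX : stdSimplex ℝ (U × X)) (F : U × X → S₁ → Y₁ → S₂ × Y₂ → ℝ) :
    ∑ ω, ch.singleLetterLaw PUX ω * F ω.1 ω.2.1.1 ω.2.2.1 (ω.2.1.2, ω.2.2.2.1) =
      ∑ v, ∑ s₁, ∑ y₁, PUX.1 v * (∑ s₂, ch.PS (s₁, s₂)) * (Q₁ v.2 s₁).1 y₁ *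
        ∑ b, (Q₂ s₁ y₁).1 b * F v s₁ y₁ b := by
  rw [Fintype.sum_prod_type]
  refine Finset.sum_congr rfl fun v _ => ?_
  simp only [Fintype.sum_prod_type, singleLetterLaw]
  refine Finset.sum_congr rfl fun s₁ _ => ?_
  rw [Finset.sum_comm]
  refine Finset.sum_congr rfl fun y₁ _ => ?_
  rw [Finset.mul_sum]
  refine Finset.sum_congr rfl fun s₂ _ => ?_
  rw [Finset.mul_sum]
  refine Finset.sum_congr rfl fun y₂ _ => ?_
  rw [← Finset.sum_mul, ← Finset.mul_sum]
  have := hQ v.2 s₁ s₂ y₁ y₂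
  calc _ = PUX.1 v * ((∑ z, ch.PYZ v.2 (s₁, s₂) (y₁, y₂, z)) * ch.PS (s₁, s₂)) *
        F v s₁ y₁ (s₂, y₂) := by ring
    _ = _ := by rw [this]; ring

/-- Independence of the states from (U, X) gives the same kernel formula for every `g`; a constant
`g` identifies the common value as the unconditional entropy. -/
theorem condEnt_state₁ (ch : SDMBC X Y₁ Y₂ Z S₁ S₂) (PUX : stdSimplex ℝ (U × X))
    (g : U × X → γ) :
    condEnt (ch.singleLetterLaw PUX) (fun ω => ω.2.1.1) (fun ω => g ω.1) =
      ent (ch.singleLetterLaw PUX) (fun ω => ω.2.1.1) := by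
  have key : ∀ {γ' : Type _} (g : U × X → γ'), condEnt (ch.singleLetterLaw PUX)
      (fun ω => ω.2.1.1) (fun ω => g ω.1) = -∑ ω, ch.singleLetterLaw PUX ω *
        Real.log (prob ch.PS fun s => s.1 = ω.2.1.1) := fun g =>
    condEnt_eq_of_kernel (isPMF_singleLetterLaw ch PUX).nonneg _ _
      (fun _ a => prob ch.PS fun s => s.1 = a)
      fun a c => prob_state_and ch PUX (fun s => s.1 = a) (fun v => g v = c)
  rw [← condEnt_of_const _ (isPMF_singleLetterLaw ch PUX) _ (C := fun _ => PUnit.unit) fun _ _ => rfl,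
    key, key fun _ => PUnit.unit]

theorem condEnt_state₂ (ch : SDMBC X Y₁ Y₂ Z S₁ S₂) (PUX : stdSimplex ℝ (U × X))
    (g : U × X → γ) :
    condEnt (ch.singleLetterLaw PUX) (fun ω => ω.2.1.2) (fun ω => g ω.1) =
      ent (ch.singleLetterLaw PUX) (fun ω => ω.2.1.2) := by
  have key : ∀ {γ' : Type _} (g : U × X → γ'), condEnt (ch.singleLetterLaw PUX)
      (fun ω => ω.2.1.2) (fun ω => g ω.1) = -∑ ω, ch.singleLetterLaw PUX ω *
        Real.log (prob ch.PS fun s => s.2 = ω.2.1.2) := fun g =>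
    condEnt_eq_of_kernel (isPMF_singleLetterLaw ch PUX).nonneg _ _
      (fun _ a => prob ch.PS fun s => s.2 = a)
      fun a c => prob_state_and ch PUX (fun s => s.2 = a) (fun v => g v = c)
  rw [← condEnt_of_const _ (isPMF_singleLetterLaw ch PUX) _ (C := fun _ => PUnit.unit) fun _ _ => rfl,
    key, key fun _ => PUnit.unit]

/-- In a physically degraded channel `(S₂, Y₂)` depends on `(U, X)` only through `(S₁, Y₁)`. -/
theorem condEnt_degraded (ch : SDMBC X Y₁ Y₂ Z S₁ S₂) (hdeg : ch.PhysicallyDegraded)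
    (PUX : stdSimplex ℝ (U × X)) (g : U × X → γ) :
    condEnt (ch.singleLetterLaw PUX) (fun ω => (ω.2.1.2, ω.2.2.2.1))
        (fun ω => ((ω.2.1.1, ω.2.2.1), g ω.1)) =
      condEnt (ch.singleLetterLaw PUX) (fun ω => (ω.2.1.2, ω.2.2.2.1))
        (fun ω => (ω.2.1.1, ω.2.2.1)) := by
  classical
  obtain ⟨Q₁, Q₂, hQ⟩ := hdeg
  have key : ∀ {γ' : Type _} (g : U × X → γ'), condEnt (ch.singleLetterLaw PUX)
      (fun ω => (ω.2.1.2, ω.2.2.2.1)) (fun ω => ((ω.2.1.1, ω.2.2.1), g ω.1)) =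
        -∑ ω, ch.singleLetterLaw PUX ω *
          Real.log ((Q₂ ω.2.1.1 ω.2.2.1).1 (ω.2.1.2, ω.2.2.2.1)) := by
    intro γ' g
    refine condEnt_eq_of_kernel (isPMF_singleLetterLaw ch PUX).nonneg _ _
      (fun (c : (S₁ × Y₁) × γ') b => (Q₂ c.1.1 c.1.2).1 b) fun a c => ?_
    rw [prob_eq_sum_mul, prob_eq_sum_mul,
      sum_singleLetterLaw_mul_of_degraded ch hQ PUX
        (fun v s₁ y₁ b => ind (b = a ∧ ((s₁, y₁), g v) = c)),
      sum_singleLetterLaw_mul_of_degraded ch hQ PUX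
        (fun v s₁ y₁ _ => ind (((s₁, y₁), g v) = c))]
    simp only [Finset.sum_mul]
    refine Finset.sum_congr rfl fun v _ => Finset.sum_congr rfl fun s₁ _ =>
      Finset.sum_congr rfl fun y₁ _ => ?_
    by_cases h : ((s₁, y₁), g v) = c
    · have h2 : ∑ b, (Q₂ s₁ y₁).1 b = 1 := (Q₂ s₁ y₁).2.2
      subst h
      simp [ind, h2]
    · simp [h]
  rw [key, ← key fun _ => PUnit.unit]
  exact condEnt_congr _ (by simp) (by simp)

/-- Chain rule in the order S₁, Y₁, (S₂, Y₂). The first term loses `g` by independence of the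
states, the last by degradedness, so only H(Y₁ | S₁, g) still feels the conditioning. -/
theorem condEnt_outputs_of_degraded (ch : SDMBC X Y₁ Y₂ Z S₁ S₂) (hdeg : ch.PhysicallyDegraded)
    (PUX : stdSimplex ℝ (U × X)) (g : U × X → γ) :
    condEnt (ch.singleLetterLaw PUX) (fun ω => ((ω.2.1.1, ω.2.2.1), (ω.2.1.2, ω.2.2.2.1)))
        (fun ω => g ω.1) =
      ent (ch.singleLetterLaw PUX) (fun ω => ω.2.1.1) +
        condEnt (ch.singleLetterLaw PUX) (fun ω => ω.2.2.1) (fun ω => (ω.2.1.1, g ω.1)) +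
        condEnt (ch.singleLetterLaw PUX) (fun ω => (ω.2.1.2, ω.2.2.2.1))
          (fun ω => (ω.2.1.1, ω.2.2.1)) := by
  rw [condEnt_prod (ch.singleLetterLaw PUX) (fun ω => (ω.2.1.1, ω.2.2.1)) (fun ω => (ω.2.1.2, ω.2.2.2.1)),
    condEnt_prod (ch.singleLetterLaw PUX) (fun ω => ω.2.1.1) (fun ω => ω.2.2.1),
    condEnt_degraded ch hdeg PUX g,
    condEnt_state₁ ch PUX g]

/-- In the difference of the expansions for g = U and g = (U, X) only the middle terms survive. This
lets the converse work with everything both receivers observe and still end with the information of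
receiver 1. -/
theorem mutualInfo_input (ch : SDMBC X Y₁ Y₂ Z S₁ S₂) (hdeg : ch.PhysicallyDegraded)
    (PUX : stdSimplex ℝ (U × X)) :
    condMutualInfo (ch.singleLetterLaw PUX) (fun ω => ω.1.2) (fun ω => ω.2.2.1)
        (fun ω => (ω.1.1, ω.2.1.1)) * Real.log 2 =
      condEnt (ch.singleLetterLaw PUX) (fun ω => ((ω.2.1.1, ω.2.2.1), (ω.2.1.2, ω.2.2.2.1)))
          (fun ω => ω.1.1) -
        condEnt (ch.singleLetterLaw PUX) (fun ω => ((ω.2.1.1, ω.2.2.1), (ω.2.1.2, ω.2.2.2.1)))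
          (fun ω => ω.1) := by
  rw [condMutualInfo_mul_log_two (isPMF_singleLetterLaw ch PUX).nonneg,
    condEnt_outputs_of_degraded ch hdeg PUX fun v => v.1,
    condEnt_outputs_of_degraded ch hdeg PUX fun v => v,
    condEnt_congr _ (A := fun ω => ω.2.2.1) (B := fun ω => ω.2.2.1)
      (C := fun ω : (U × X) × (S₁ × S₂) × (Y₁ × Y₂ × Z) => (ω.1.1, ω.2.1.1))
      (D := fun ω => (ω.2.1.1, ω.1.1)) (by simp [and_comm]) (by simp),
    condEnt_congr _ (A := fun ω => ω.2.2.1) (B := fun ω => ω.2.2.1)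
      (C := fun ω : (U × X) × (S₁ × S₂) × (Y₁ × Y₂ × Z) => (ω.1.2, ω.1.1, ω.2.1.1))
      (D := fun ω => (ω.2.1.1, ω.1)) (by simp only [Prod.ext_iff]; tauto) (by simp)]
  ring

/-- Since U and S₁ are independent, I(U; Y₁ | S₁) = I(U; S₁, Y₁). -/
theorem mutualInfo_cloud₁ (ch : SDMBC X Y₁ Y₂ Z S₁ S₂) (PUX : stdSimplex ℝ (U × X)) :
    condMutualInfo (ch.singleLetterLaw PUX) (fun ω => ω.1.1) (fun ω => ω.2.2.1)
        (fun ω => ω.2.1.1) * Real.log 2 =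
      ent (ch.singleLetterLaw PUX) (fun ω => (ω.2.1.1, ω.2.2.1)) -
        condEnt (ch.singleLetterLaw PUX) (fun ω => (ω.2.1.1, ω.2.2.1)) (fun ω => ω.1.1) := by
  have hp := isPMF_singleLetterLaw ch PUX
  rw [condMutualInfo_mul_log_two hp.nonneg]
  simp only [condEnt_prod]
  rw [condEnt_state₁ ch PUX fun v => v.1,
    condEnt_congr _ (A := fun ω => ω.2.2.1) (B := fun ω => ω.2.2.1)
      (C := fun ω : (U × X) × (S₁ × S₂) × (Y₁ × Y₂ × Z) => (ω.1.1, ω.2.1.1))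
      (D := fun ω => (ω.2.1.1, ω.1.1)) (by simp [and_comm]) (by simp)]
  have : condEnt (ch.singleLetterLaw PUX) (fun ω => ω.2.2.1) (fun ω => ω.2.1.1) =
      ent (ch.singleLetterLaw PUX) (fun ω => (ω.2.1.1, ω.2.2.1)) -
        ent (ch.singleLetterLaw PUX) (fun ω => ω.2.1.1) := by
    rw [condEnt, ent_congr _ (A := fun ω => (ω.2.2.1, ω.2.1.1))
      (B := fun ω : (U × X) × (S₁ × S₂) × (Y₁ × Y₂ × Z) => (ω.2.1.1, ω.2.2.1))]
    simp [and_comm]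
  linarith

theorem mutualInfo_cloud₂ (ch : SDMBC X Y₁ Y₂ Z S₁ S₂) (PUX : stdSimplex ℝ (U × X)) :
    condMutualInfo (ch.singleLetterLaw PUX) (fun ω => ω.1.1) (fun ω => ω.2.2.2.1)
        (fun ω => ω.2.1.2) * Real.log 2 =
      ent (ch.singleLetterLaw PUX) (fun ω => (ω.2.1.2, ω.2.2.2.1)) -
        condEnt (ch.singleLetterLaw PUX) (fun ω => (ω.2.1.2, ω.2.2.2.1)) (fun ω => ω.1.1) := by
  have hp := isPMF_singleLetterLaw ch PUX
  rw [condMutualInfo_mul_log_two hp.nonneg]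
  simp only [condEnt_prod]
  rw [condEnt_state₂ ch PUX fun v => v.1,
    condEnt_congr _ (A := fun ω => ω.2.2.2.1) (B := fun ω => ω.2.2.2.1)
      (C := fun ω : (U × X) × (S₁ × S₂) × (Y₁ × Y₂ × Z) => (ω.1.1, ω.2.1.2))
      (D := fun ω => (ω.2.1.2, ω.1.1)) (by simp [and_comm]) (by simp)]
  have : condEnt (ch.singleLetterLaw PUX) (fun ω => ω.2.2.2.1) (fun ω => ω.2.1.2) =
      ent (ch.singleLetterLaw PUX) (fun ω => (ω.2.1.2, ω.2.2.2.1)) -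
        ent (ch.singleLetterLaw PUX) (fun ω => ω.2.1.2) := by
    rw [condEnt, ent_congr _ (A := fun ω => (ω.2.2.2.1, ω.2.1.2))
      (B := fun ω : (U × X) × (S₁ × S₂) × (Y₁ × Y₂ × Z) => (ω.2.1.2, ω.2.2.2.1))]
    simp [and_comm]
  linarith

/-- The stronger receiver learns at least as much about `U` as the weaker one. -/
theorem mutualInfo_cloud_le (ch : SDMBC X Y₁ Y₂ Z S₁ S₂) (hdeg : ch.PhysicallyDegraded)
    (PUX : stdSimplex ℝ (U × X)) :
    condMutualInfo (ch.singleLetterLaw PUX) (fun ω => ω.1.1) (fun ω => ω.2.2.2.1)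
        (fun ω => ω.2.1.2) ≤
      condMutualInfo (ch.singleLetterLaw PUX) (fun ω => ω.1.1) (fun ω => ω.2.2.1)
        (fun ω => ω.2.1.1) := by
  have hp := isPMF_singleLetterLaw ch PUX
  refine le_of_mul_le_mul_right ?_ (Real.log_pos one_lt_two)
  rw [mutualInfo_cloud₁, mutualInfo_cloud₂]
  -- Data processing. With B₁ = (S₁, Y₁) and B₂ = (S₂, Y₂), expanding H(B₁, B₂) and H(B₁, B₂ | U) in
  -- both orders leaves I(U; B₁) − I(U; B₂) = I(U; B₁ | B₂) ≥ 0.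
  have h1 := condEnt_prod (ch.singleLetterLaw PUX) (fun ω => (ω.2.1.1, ω.2.2.1))
    (fun ω => (ω.2.1.2, ω.2.2.2.1)) (fun ω => ω.1.1)
  have h2 := condEnt_prod (ch.singleLetterLaw PUX) (fun ω => (ω.2.1.2, ω.2.2.2.1))
    (fun ω => (ω.2.1.1, ω.2.2.1)) (fun ω => ω.1.1)
  rw [condEnt_degraded ch hdeg PUX fun v => v.1] at h1
  have h3 := condEnt_anti hp (fun ω => (ω.2.1.1, ω.2.2.1)) (fun ω => (ω.2.1.2, ω.2.2.2.1))
    (fun ω => ((ω.2.1.2, ω.2.2.2.1), ω.1.1)) Prod.fst fun _ => rfl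
  have h4 := condEnt_congr (ch.singleLetterLaw PUX)
    (A := fun ω => ((ω.2.1.1, ω.2.2.1), (ω.2.1.2, ω.2.2.2.1)))
    (B := fun ω => ((ω.2.1.2, ω.2.2.2.1), (ω.2.1.1, ω.2.2.1)))
    (C := fun ω => ω.1.1) (D := fun ω => ω.1.1) (by simp)
    (by intro _ _ _; simp only [Prod.ext_iff]; tauto)
  have h5 := ent_congr (ch.singleLetterLaw PUX)
    (A := fun ω => ((ω.2.1.1, ω.2.2.1), (ω.2.1.2, ω.2.2.2.1)))
    (B := fun ω => ((ω.2.1.2, ω.2.2.2.1), (ω.2.1.1, ω.2.2.1)))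
    (by intro _ _; simp only [Prod.ext_iff]; tauto)
  unfold condEnt at *
  linarith

end SingleLetter

/-! ### Products of causal kernels -/

section Causal

variable {Θ : Type*}

/-- The first `i` entries of a sequence. -/
def prefixOf {n : ℕ} (i : Fin n) (θ : Fin n → Θ) : Fin (i : ℕ) → Θ :=
  fun l => θ (Fin.castLE i.isLt.le l)

theorem prefixOf_snoc_castSucc {n : ℕ} (i : Fin n) (θ : Fin n → Θ) (t : Θ) :
    prefixOf i.castSucc (Fin.snoc (α := fun _ => Θ) θ t) = prefixOf i θ := by
  funext l
  exact Fin.snoc_castSucc (α := fun _ => Θ) t θ (Fin.castLE i.isLt.le l)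

theorem prefixOf_snoc_last {n : ℕ} (θ : Fin n → Θ) (t : Θ) :
    prefixOf (Fin.last n) (Fin.snoc (α := fun _ => Θ) θ t) = θ := by
  funext l
  exact Fin.snoc_castSucc (α := fun _ => Θ) t θ l

theorem prod_causal_snoc {n : ℕ} (k : (i : Fin (n + 1)) → (Fin (i : ℕ) → Θ) → Θ → ℝ)
    (θ : Fin n → Θ) (t : Θ) :
    ∏ j, k j (prefixOf j (Fin.snoc (α := fun _ => Θ) θ t)) (Fin.snoc (α := fun _ => Θ) θ t j) =
      (∏ j : Fin n, k j.castSucc (prefixOf j θ) (θ j)) * k (Fin.last n) θ t := by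
  rw [Fin.prod_univ_castSucc, prefixOf_snoc_last, Fin.snoc_last]
  congr 1
  refine Finset.prod_congr rfl fun j _ => ?_
  rw [prefixOf_snoc_castSucc, Fin.snoc_castSucc]

variable [Fintype Θ]

theorem sum_snoc {n : ℕ} (f : (Fin (n + 1) → Θ) → ℝ) :
    ∑ θ, f θ = ∑ θ : Fin n → Θ, ∑ t, f (Fin.snoc (α := fun _ => Θ) θ t) := by
  rw [← Fintype.sum_equiv (Fin.snocEquiv fun _ : Fin (n + 1) => Θ) (fun x => f (Fin.snoc x.2 x.1))
    f fun _ => rfl, Fintype.sum_prod_type, Finset.sum_comm]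

/-- In a product of causal kernels, the conditional law of the `i`-th entry given its past is the
`i`-th kernel. -/
theorem sum_prod_causal_mul : ∀ {n : ℕ} (k : (i : Fin n) → (Fin (i : ℕ) → Θ) → Θ → ℝ)
    (_ : ∀ i π, ∑ t, k i π t = 1) (i : Fin n) (F : (Fin (i : ℕ) → Θ) → Θ → ℝ),
    ∑ θ : Fin n → Θ, (∏ j, k j (prefixOf j θ) (θ j)) * F (prefixOf i θ) (θ i) =
      ∑ θ : Fin n → Θ, (∏ j, k j (prefixOf j θ) (θ j)) *
        ∑ t, k i (prefixOf i θ) t * F (prefixOf i θ) t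
  | 0, _, _, i, _ => i.elim0
  | n + 1, k, hk, i, F => by
    rw [sum_snoc, sum_snoc]
    simp only [prod_causal_snoc]
    -- The kernel of the final symbol sums to one. At the last index this gives the claim directly;
    -- at an earlier index it removes the final symbol and leaves the shorter product.
    induction i using Fin.lastCases with
    | last =>
      refine Finset.sum_congr rfl fun θ _ => ?_
      simp only [prefixOf_snoc_last, Fin.snoc_last]
      have h1 := hk (Fin.last n) θ
      calc _ = (∏ j : Fin n, k j.castSucc (prefixOf j θ) (θ j)) *
            ∑ t, k (Fin.last n) θ t * F θ t := by
            rw [Finset.mul_sum]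
            exact Finset.sum_congr rfl fun t _ => by ring
        _ = (∏ j : Fin n, k j.castSucc (prefixOf j θ) (θ j)) * (∑ t, k (Fin.last n) θ t) *
            ∑ t, k (Fin.last n) θ t * F θ t := by rw [h1, mul_one]
        _ = _ := by rw [← Finset.sum_mul, ← Finset.mul_sum]
    | cast i =>
      simp only [prefixOf_snoc_castSucc, Fin.snoc_castSucc]
      have h1 := fun θ => hk (Fin.last n) θ
      have h2 := sum_prod_causal_mul (fun j : Fin n => k j.castSucc) (fun j => hk j.castSucc) i F
      calc _ = ∑ θ : Fin n → Θ, (∏ j : Fin n, k j.castSucc (prefixOf j θ) (θ j)) *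
            F (prefixOf i θ) (θ i) := by
            refine Finset.sum_congr rfl fun θ _ => ?_
            rw [← Finset.sum_mul, ← Finset.mul_sum]
            erw [h1]
            rw [mul_one]
        _ = _ := by
            rw [h2]
            refine Finset.sum_congr rfl fun θ _ => ?_
            rw [← Finset.sum_mul, ← Finset.mul_sum]
            erw [h1]
            rw [mul_one]

theorem sum_prod_causal : ∀ {n : ℕ} (k : (i : Fin n) → (Fin (i : ℕ) → Θ) → Θ → ℝ)
    (_ : ∀ i π, ∑ t, k i π t = 1),
    ∑ θ : Fin n → Θ, ∏ j, k j (prefixOf j θ) (θ j) = 1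
  | 0, _, _ => by simp
  | n + 1, k, hk => by
    rw [sum_snoc]
    simp only [prod_causal_snoc, ← Finset.mul_sum]
    rw [← sum_prod_causal (fun j : Fin n => k j.castSucc) (fun j => hk j.castSucc)]
    refine Finset.sum_congr rfl fun θ _ => ?_
    erw [hk (Fin.last n) θ]
    rw [mul_one]

end Causal

/-- Absorb `h` into the i-th factor and apply the distributive law. The factors are not assumed
normalized, so that the lemma also applies when each is restricted to a prescribed feedback symbol.
-/
theorem sum_pi_prod_mul_apply {ι κ : Type*} [Fintype ι] [DecidableEq ι] [Fintype κ]
    (f : ι → κ → ℝ) (i : ι) (h : κ → ℝ) :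
    ∑ θ : ι → κ, (∏ j, f j (θ j)) * h (θ i) =
      (∏ j ∈ Finset.univ.erase i, ∑ b, f j b) * ∑ b, f i b * h b := by
  have h1 : ∀ θ : ι → κ, (∏ j, f j (θ j)) * h (θ i) =
      ∏ j, f j (θ j) * (if j = i then h (θ j) else 1) := by
    intro θ
    rw [Finset.prod_mul_distrib]
    simp
  simp only [h1]
  rw [← Fintype.prod_sum (fun j b => f j b * (if j = i then h b else 1)),
    ← Finset.prod_erase_mul _ _ (Finset.mem_univ i)]
  congr 1
  · refine Finset.prod_congr rfl fun j hj => ?_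
    simp [Finset.ne_of_mem_erase hj]
  · simp

/-! ### The block law of a code with feedback -/

section Block

variable {X Y₁ Y₂ Z S₁ S₂ T₁ T₂ : Type*} [Fintype X] [Fintype Y₁] [Fintype Y₂] [Fintype Z]
    [Fintype S₁] [Fintype S₂] {n M₀ M₁ M₂ : ℕ}

/-- The joint law of the states and outputs given the input. -/
noncomputable def chanLaw (ch : SDMBC X Y₁ Y₂ Z S₁ S₂) (x : X)
    (θ : (S₁ × S₂) × (Y₁ × Y₂ × Z)) : ℝ :=
  ch.PS θ.1 * ch.PYZ x θ.1 θ.2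

theorem chanLaw_nonneg (ch : SDMBC X Y₁ Y₂ Z S₁ S₂) (x : X) (θ : (S₁ × S₂) × (Y₁ × Y₂ × Z)) :
    0 ≤ ch.chanLaw x θ :=
  mul_nonneg (ch.PS_nonneg _) (ch.PYZ_nonneg _ _ _)

theorem sum_chanLaw (ch : SDMBC X Y₁ Y₂ Z S₁ S₂) (x : X) : ∑ θ, ch.chanLaw x θ = 1 := by
  rw [Fintype.sum_prod_type]
  simp [chanLaw, ← Finset.mul_sum, sum_PYZ, sum_PS]

/-- States and outputs at time `i`. -/
def Outcome.at {Y₁ Y₂ Z S₁ S₂ : Type*} {n M₀ M₁ M₂ : ℕ} (ω : Outcome Y₁ Y₂ Z S₁ S₂ n M₀ M₁ M₂)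
    (i : Fin n) : (S₁ × S₂) × (Y₁ × Y₂ × Z) :=
  (ω.2.1 i, ω.2.2 i)

/-- The feedback sequence. -/
def Outcome.feedback {Y₁ Y₂ Z S₁ S₂ : Type*} {n M₀ M₁ M₂ : ℕ}
    (ω : Outcome Y₁ Y₂ Z S₁ S₂ n M₀ M₁ M₂) (i : Fin n) : Z :=
  (ω.2.2 i).2.2

theorem sum_outcome (f : (Fin M₀ × Fin M₁ × Fin M₂) → (Fin n → (S₁ × S₂) × (Y₁ × Y₂ × Z)) → ℝ) :
    ∑ ω : Outcome Y₁ Y₂ Z S₁ S₂ n M₀ M₁ M₂, f ω.1 ω.at =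
      ∑ w, ∑ θ, f w θ := by
  rw [Fintype.sum_prod_type]
  refine Finset.sum_congr rfl fun w _ => ?_
  exact Fintype.sum_equiv (Equiv.arrowProdEquivProdArrow (Fin n) (fun _ => S₁ × S₂)
    (fun _ => Y₁ × Y₂ × Z)).symm
    (fun x => f w fun i => (x.1 i, x.2 i)) (fun θ => f w θ) fun _ => rfl

/-- The kernel of the block law at time `i`, as a function of the past. -/
noncomputable def Code.kernel (c : Code X Y₁ Y₂ Z S₁ S₂ T₁ T₂ n M₀ M₁ M₂)
    (ch : SDMBC X Y₁ Y₂ Z S₁ S₂) (w : Fin M₀ × Fin M₁ × Fin M₂) (i : Fin n)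
    (π : Fin (i : ℕ) → (S₁ × S₂) × (Y₁ × Y₂ × Z)) : (S₁ × S₂) × (Y₁ × Y₂ × Z) → ℝ :=
  ch.chanLaw (c.enc i w fun l => (π l).2.2.2)

/-- Although the inputs depend on past feedback, the law is a product of kernels in the order of
time, which is what the lemmas on causal kernels require. -/
theorem Code.blockLaw_eq (c : Code X Y₁ Y₂ Z S₁ S₂ T₁ T₂ n M₀ M₁ M₂)
    (ch : SDMBC X Y₁ Y₂ Z S₁ S₂) (ω : Outcome Y₁ Y₂ Z S₁ S₂ n M₀ M₁ M₂) :
    c.blockLaw ch ω = ((M₀ : ℝ) * M₁ * M₂)⁻¹ *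
      ∏ i, c.kernel ch ω.1 i (prefixOf i ω.at) (ω.at i) := rfl

theorem Code.blockLaw_nonneg (c : Code X Y₁ Y₂ Z S₁ S₂ T₁ T₂ n M₀ M₁ M₂)
    (ch : SDMBC X Y₁ Y₂ Z S₁ S₂) (ω : Outcome Y₁ Y₂ Z S₁ S₂ n M₀ M₁ M₂) :
    0 ≤ c.blockLaw ch ω := by
  rw [Code.blockLaw_eq]
  have : ∀ i, 0 ≤ c.kernel ch ω.1 i (prefixOf i ω.at) (ω.at i) := fun i => ch.chanLaw_nonneg _ _
  have := Finset.prod_nonneg fun i (_ : i ∈ Finset.univ) => this i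
  positivity

theorem Code.sum_blockLaw_mul_message (c : Code X Y₁ Y₂ Z S₁ S₂ T₁ T₂ n M₀ M₁ M₂)
    (ch : SDMBC X Y₁ Y₂ Z S₁ S₂) (f : Fin M₀ × Fin M₁ × Fin M₂ → ℝ) :
    ∑ ω, c.blockLaw ch ω * f ω.1 = ((M₀ : ℝ) * M₁ * M₂)⁻¹ * ∑ w, f w := by
  have := sum_outcome (Y₁ := Y₁) (Y₂ := Y₂) (Z := Z) (S₁ := S₁) (S₂ := S₂) fun w θ =>
    ((M₀ : ℝ) * M₁ * M₂)⁻¹ * (∏ i, c.kernel ch w i (prefixOf i θ) (θ i)) * f w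
  simp only [Code.blockLaw_eq]
  rw [this, Finset.mul_sum]
  refine Finset.sum_congr rfl fun w _ => ?_
  rw [← Finset.sum_mul, ← Finset.mul_sum,
    sum_prod_causal (fun i => c.kernel ch w i) fun i π => ch.sum_chanLaw _, mul_one]

theorem Code.isPMF_blockLaw (c : Code X Y₁ Y₂ Z S₁ S₂ T₁ T₂ n M₀ M₁ M₂)
    (ch : SDMBC X Y₁ Y₂ Z S₁ S₂) (h₀ : 0 < M₀) (h₁ : 0 < M₁) (h₂ : 0 < M₂) :
    IsPMF (c.blockLaw ch) where
  nonneg := c.blockLaw_nonneg ch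
  sum_eq_one := by
    have := c.sum_blockLaw_mul_message ch fun _ => 1
    simp only [mul_one] at this
    rw [this]
    simp only [Finset.sum_const, Finset.card_univ, Fintype.card_prod, Fintype.card_fin,
      nsmul_eq_mul, mul_one, Nat.cast_mul]
    rw [mul_assoc]
    exact inv_mul_cancel₀ (by positivity)

/-- Given the messages and the past, the states and outputs at time `i` are drawn from the
channel. -/
theorem Code.sum_blockLaw_mul_at (c : Code X Y₁ Y₂ Z S₁ S₂ T₁ T₂ n M₀ M₁ M₂)
    (ch : SDMBC X Y₁ Y₂ Z S₁ S₂) (i : Fin n)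
    (F : Outcome Y₁ Y₂ Z S₁ S₂ n M₀ M₁ M₂ → (S₁ × S₂) × (Y₁ × Y₂ × Z) → ℝ)
    (hF : ∀ ω ω', ω.1 = ω'.1 → (∀ j < i, ω.at j = ω'.at j) → F ω = F ω') :
    ∑ ω, c.blockLaw ch ω * F ω (ω.at i) =
      ∑ ω, c.blockLaw ch ω * ∑ t, ch.chanLaw (c.inputs ω.1 ω.feedback i) t * F ω t := by
  classical
  rcases isEmpty_or_nonempty ((S₁ × S₂) × (Y₁ × Y₂ × Z)) with hE | ⟨⟨θ₀⟩⟩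
  · have : IsEmpty (Outcome Y₁ Y₂ Z S₁ S₂ n M₀ M₁ M₂) := ⟨fun ω => hE.false (ω.at i)⟩
    simp
  -- `F` is causal, so it can be evaluated after replacing the symbols from time i on by the dummy
  -- θ₀. This exhibits it as a function of the messages and the prefix.
  let ext : Fin M₀ × Fin M₁ × Fin M₂ → (Fin (i : ℕ) → (S₁ × S₂) × (Y₁ × Y₂ × Z)) →
      Outcome Y₁ Y₂ Z S₁ S₂ n M₀ M₁ M₂ := fun w π =>
    (w, fun j => if h : j < i then (π ⟨j, h⟩).1 else θ₀.1,
      fun j => if h : j < i then (π ⟨j, h⟩).2 else θ₀.2)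
  have hext : ∀ ω : Outcome Y₁ Y₂ Z S₁ S₂ n M₀ M₁ M₂, F ω = F (ext ω.1 (prefixOf i ω.at)) := by
    intro ω
    refine hF _ _ rfl fun j hj => ?_
    simp [Outcome.at, ext, hj, prefixOf]
  have hL : ∀ ω : Outcome Y₁ Y₂ Z S₁ S₂ n M₀ M₁ M₂, c.blockLaw ch ω * F ω (ω.at i) =
      ((M₀ : ℝ) * M₁ * M₂)⁻¹ * ((∏ j, c.kernel ch ω.1 j (prefixOf j ω.at) (ω.at j)) *
        F (ext ω.1 (prefixOf i ω.at)) (ω.at i)) := by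
    intro ω
    rw [Code.blockLaw_eq, ← hext, mul_assoc]
  have hR : ∀ ω : Outcome Y₁ Y₂ Z S₁ S₂ n M₀ M₁ M₂,
      c.blockLaw ch ω * ∑ t, ch.chanLaw (c.inputs ω.1 ω.feedback i) t * F ω t =
      ((M₀ : ℝ) * M₁ * M₂)⁻¹ * ((∏ j, c.kernel ch ω.1 j (prefixOf j ω.at) (ω.at j)) *
        ∑ t, c.kernel ch ω.1 i (prefixOf i ω.at) t * F (ext ω.1 (prefixOf i ω.at)) t) := by
    intro ω
    rw [Code.blockLaw_eq, ← hext, mul_assoc]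
    rfl
  simp only [hL, hR]
  rw [sum_outcome fun w θ => ((M₀ : ℝ) * M₁ * M₂)⁻¹ * ((∏ j, c.kernel ch w j (prefixOf j θ) (θ j)) *
        F (ext w (prefixOf i θ)) (θ i)),
    sum_outcome fun w θ => ((M₀ : ℝ) * M₁ * M₂)⁻¹ * ((∏ j, c.kernel ch w j (prefixOf j θ) (θ j)) *
        ∑ t, c.kernel ch w i (prefixOf i θ) t * F (ext w (prefixOf i θ)) t)]
  refine Finset.sum_congr rfl fun w _ => ?_
  rw [← Finset.mul_sum, ← Finset.mul_sum, sum_prod_causal_mul (fun i => c.kernel ch w i)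
    (fun i π => ch.sum_chanLaw _) i fun π t => F (ext w π) t]

/-- The conditional entropy of a function of the states and outputs at time `i`, given anything
that determines the input and depends on the messages and the past only. -/
theorem Code.condEnt_at {α γ : Type*} (c : Code X Y₁ Y₂ Z S₁ S₂ T₁ T₂ n M₀ M₁ M₂)
    (ch : SDMBC X Y₁ Y₂ Z S₁ S₂) (i : Fin n) (A : (S₁ × S₂) × (Y₁ × Y₂ × Z) → α)
    (C : Outcome Y₁ Y₂ Z S₁ S₂ n M₀ M₁ M₂ → γ)
    (hC : ∀ ω ω', ω.1 = ω'.1 → (∀ j < i, ω.at j = ω'.at j) → C ω = C ω')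
    (ξ : γ → X) (hξ : ∀ ω, ξ (C ω) = c.inputs ω.1 ω.feedback i) :
    condEnt (c.blockLaw ch) (fun ω => A (ω.at i)) C =
      -∑ ω, c.blockLaw ch ω * Real.log
        (prob (ch.chanLaw (c.inputs ω.1 ω.feedback i)) fun t => A t = A (ω.at i)) := by
  simp only [← hξ]
  refine condEnt_eq_of_kernel (c.blockLaw_nonneg ch) _ C
    (fun g a => prob (ch.chanLaw (ξ g)) fun t => A t = a) fun a g => ?_
  rw [prob_eq_sum_mul, c.sum_blockLaw_mul_at ch i (fun ω t => ind (A t = a ∧ C ω = g))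
    (fun ω ω' h h' => by rw [hC ω ω' h h']), prob_eq_sum_mul, prob_eq_sum_mul, Finset.sum_mul]
  refine Finset.sum_congr rfl fun ω _ => ?_
  rw [← hξ]
  by_cases h : C ω = g <;> simp [h]

/-- Symbol-by-symbol optimal estimates are no worse than any estimates from the messages and the
entire feedback. -/
theorem Code.expect_optimal_le {T : Type*} (c : Code X Y₁ Y₂ Z S₁ S₂ T₁ T₂ n M₀ M₁ M₂)
    (ch : SDMBC X Y₁ Y₂ Z S₁ S₂) (i : Fin n) (d : S₁ × S₂ → T → ℝ) (sh : X → Z → T)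
    (hsh : ∀ x z t, ∑ s, ch.stateFeedbackLaw x z s * d s (sh x z) ≤
      ∑ s, ch.stateFeedbackLaw x z s * d s t)
    (g : Fin M₀ × Fin M₁ × Fin M₂ → (Fin n → Z) → T) :
    expect (c.blockLaw ch) (fun ω => d (ω.2.1 i) (sh (c.inputs ω.1 ω.feedback i) (ω.feedback i))) ≤
      expect (c.blockLaw ch) (fun ω => d (ω.2.1 i) (g ω.1 ω.feedback)) := by
  classical
  -- Fixing the messages and the feedback sequence z fixes all inputs, so the remaining sum over
  -- states and outputs factors over time. Only coordinate i sees the estimate; the others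
  -- contribute a nonnegative weight that does not depend on it.
  have key : ∀ g : Fin M₀ × Fin M₁ × Fin M₂ → (Fin n → Z) → T,
      expect (c.blockLaw ch) (fun ω => d (ω.2.1 i) (g ω.1 ω.feedback)) =
      ∑ w, ∑ z : Fin n → Z, ((M₀ : ℝ) * M₁ * M₂)⁻¹ *
        ((∏ j ∈ Finset.univ.erase i, ∑ s, ch.stateFeedbackLaw (c.inputs w z j) (z j) s) *
          ∑ s, ch.stateFeedbackLaw (c.inputs w z i) (z i) s * d s (g w z)) := by
    intro g
    have hsum : ∀ (x : X) (z : Z) (h : S₁ × S₂ → ℝ),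
        ∑ θ : (S₁ × S₂) × (Y₁ × Y₂ × Z), ch.chanLaw x θ * (if θ.2.2.2 = z then 1 else 0) * h θ.1 =
          ∑ s, ch.stateFeedbackLaw x z s * h s := by
      intro x z h
      rw [Fintype.sum_prod_type]
      refine Finset.sum_congr rfl fun s _ => ?_
      refine (Finset.sum_mul Finset.univ _ (h s)).symm.trans ?_
      congr 1
      simp only [chanLaw, stateFeedbackLaw, Fintype.sum_prod_type, Finset.mul_sum]
      simp
    -- The sum over z with indicators that z is the actual feedback makes z a free parameter, which
    -- decouples the inputs from the outputs.
    have h1 : expect (c.blockLaw ch) (fun ω => d (ω.2.1 i) (g ω.1 ω.feedback)) =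
        ∑ ω : Outcome Y₁ Y₂ Z S₁ S₂ n M₀ M₁ M₂, ∑ z : Fin n → Z, ((M₀ : ℝ) * M₁ * M₂)⁻¹ *
          ((∏ j, ch.chanLaw (c.inputs ω.1 z j) (ω.at j) *
            (if (ω.at j).2.2.2 = z j then 1 else 0)) * d (ω.at i).1 (g ω.1 z)) := by
      refine Finset.sum_congr rfl fun ω _ => ?_
      rw [Finset.sum_eq_single ω.feedback]
      · have h : ∀ j, (if (ω.at j).2.2.2 = ω.feedback j then (1 : ℝ) else 0) = 1 :=
          fun j => if_pos rfl
        simp only [h, mul_one, ← mul_assoc]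
        rfl
      · intro z _ hz
        obtain ⟨j, hj⟩ := Function.ne_iff.1 hz
        rw [Finset.prod_eq_zero (Finset.mem_univ j), zero_mul, mul_zero]
        rw [if_neg, mul_zero]
        exact fun h => hj h.symm
      · simp
    rw [h1, sum_outcome fun w θ => ∑ z : Fin n → Z, ((M₀ : ℝ) * M₁ * M₂)⁻¹ *
          ((∏ j, ch.chanLaw (c.inputs w z j) (θ j) *
            (if (θ j).2.2.2 = z j then 1 else 0)) * d (θ i).1 (g w z))]
    refine Finset.sum_congr rfl fun w _ => ?_
    rw [Finset.sum_comm]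
    refine Finset.sum_congr rfl fun z _ => ?_
    rw [← Finset.mul_sum, sum_pi_prod_mul_apply (fun j θ => ch.chanLaw (c.inputs w z j) θ *
            (if θ.2.2.2 = z j then 1 else 0)) i fun θ => d θ.1 (g w z)]
    rw [hsum _ _ fun s => d s (g w z)]
    congr 2
    refine Finset.prod_congr rfl fun j _ => ?_
    simpa using hsum (c.inputs w z j) (z j) fun _ => 1
  rw [key g, key fun w z => sh (c.inputs w z i) (z i)]
  refine Finset.sum_le_sum fun w _ => Finset.sum_le_sum fun z _ => ?_
  refine mul_le_mul_of_nonneg_left (mul_le_mul_of_nonneg_left (hsh _ _ _)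
    (Finset.prod_nonneg fun j _ => Finset.sum_nonneg fun s _ => ?_)) (by positivity)
  exact mul_nonneg (ch.PS_nonneg _) (Finset.sum_nonneg fun _ _ => Finset.sum_nonneg fun _ _ =>
    ch.PYZ_nonneg _ _ _)

end Block

/-! ### Chain rule for sequences and Fano's inequality -/

section ChainRule

variable {Ω α β γ δ : Type*}

/-- The first `m` entries of a sequence of random variables. -/
def past {n : ℕ} (A : Fin n → Ω → α) (m : ℕ) (ω : Ω) : Fin n → Option α :=
  fun j => if (j : ℕ) < m then some (A j ω) else none

/-- Padding with `none` gives pasts of all lengths the same type, so the auxiliary variable has one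
finite alphabet for all times; the padding adds no information. -/
theorem past_eq_iff {n : ℕ} (A : Fin n → Ω → α) (m : ℕ) (ω' ω : Ω) :
    past A m ω' = past A m ω ↔ ∀ j : Fin n, (j : ℕ) < m → A j ω' = A j ω := by
  rw [funext_iff]
  refine forall_congr' fun j => ?_
  by_cases h : (j : ℕ) < m <;> simp [past, h]

variable [Fintype Ω]

/-- Each summand is H(C, past to i + 1) − H(C, past to i), and the sum telescopes. -/
theorem condEnt_sequence {n : ℕ} (p : Ω → ℝ) (A : Fin n → Ω → α) (C : Ω → γ) :
    condEnt p (fun ω j => A j ω) C = ∑ i, condEnt p (A i) (fun ω => (C ω, past A i ω)) := by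
  have h1 : ∀ i : Fin n, condEnt p (A i) (fun ω => (C ω, past A i ω)) =
      ent p (fun ω => (C ω, past A ((i : ℕ) + 1) ω)) - ent p (fun ω => (C ω, past A i ω)) := by
    intro i
    unfold condEnt
    congr 1
    refine ent_congr p fun ω' ω => ?_
    simp only [Prod.mk.injEq, past_eq_iff]
    constructor
    · rintro ⟨h1, h2, h3⟩
      refine ⟨h2, fun j hj => ?_⟩
      rcases Nat.lt_succ_iff_lt_or_eq.1 hj with h | h
      · exact h3 j h
      · rwa [Fin.ext h]
    · rintro ⟨h1, h2⟩
      exact ⟨h2 i (Nat.lt_succ_self _), h1, fun j hj => h2 j (Nat.lt_succ_of_lt hj)⟩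
  simp only [h1]
  rw [Fin.sum_univ_eq_sum_range (fun i => ent p (fun ω => (C ω, past A (i + 1) ω)) -
    ent p (fun ω => (C ω, past A i ω))) n, Finset.sum_range_sub
    (fun i => ent p (fun ω => (C ω, past A i ω)))]
  unfold condEnt
  congr 1
  · refine ent_congr p fun ω' ω => ?_
    rw [Prod.mk.injEq, Prod.mk.injEq, past_eq_iff, funext_iff]
    constructor
    · exact fun h => ⟨h.2, fun j _ => h.1 j⟩
    · exact fun h => ⟨fun j => h.2 j j.isLt, h.1⟩
  · exact ent_congr p fun ω' ω => by simp [past_eq_iff]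

/-- The mutual information is symmetric. -/
theorem condEnt_sub_comm (p : Ω → ℝ) (A : Ω → α) (B : Ω → β) (C : Ω → γ) :
    condEnt p A C - condEnt p A (fun ω => (C ω, B ω)) =
      condEnt p B C - condEnt p B (fun ω => (C ω, A ω)) := by
  unfold condEnt
  rw [ent_congr p (A := fun ω => (B ω, C ω, A ω)) (B := fun ω => (A ω, C ω, B ω)),
    ent_congr p (A := fun ω => (C ω, A ω)) (B := fun ω => (A ω, C ω)),
    ent_congr p (A := fun ω => (C ω, B ω)) (B := fun ω => (B ω, C ω))]
  · ring
  all_goals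
    intro ω' ω
    simp only [Prod.mk.injEq]
    tauto

/-- Fano's inequality. -/
theorem condEnt_le_of_decoder [Fintype α] [Nonempty α] [Fintype γ] {p : Ω → ℝ} (hp : IsPMF p)
    (A : Ω → α) (C : Ω → γ) (dec : γ → α) :
    condEnt p A C ≤ Real.log 2 + prob p (fun ω => dec (C ω) ≠ A ω) *
      Real.log (Fintype.card α) := by
  classical
  have hM : 0 < (Fintype.card α : ℝ) := by exact_mod_cast Fintype.card_pos
  -- The reference kernel puts mass 1/2 on the decoded value and 1/(2|α|) on each other value. A
  -- correct decision costs log 2 and a wrong one log 2 + log |α|.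
  refine (condEnt_le_cross hp A C
    (fun c a => if dec c = a then 1 / 2 else 1 / (2 * Fintype.card α)) (fun c a => ?_)
    (fun c => ?_) fun ω _ => ?_).trans ?_
  · split_ifs <;> positivity
  · calc ∑ a, (if dec c = a then (1 : ℝ) / 2 else 1 / (2 * Fintype.card α)) ≤
        ∑ a, ((if dec c = a then (1 : ℝ) / 2 else 0) + 1 / (2 * Fintype.card α)) := by
          refine Finset.sum_le_sum fun a _ => ?_
          have : 0 ≤ 1 / (2 * (Fintype.card α : ℝ)) := by positivity
          split_ifs <;> linarith
      _ = 1 := by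
          rw [Finset.sum_add_distrib]
          simp only [Finset.sum_ite_eq, Finset.mem_univ, if_true, Finset.sum_const,
            Finset.card_univ, nsmul_eq_mul]
          field_simp
          norm_num
  · split_ifs <;> positivity
  · have h1 : ∀ ω, p ω * Real.log (if dec (C ω) = A ω then 1 / 2 else 1 / (2 * Fintype.card α)) =
        -(p ω * Real.log 2) - p ω * ind (dec (C ω) ≠ A ω) * Real.log (Fintype.card α) := by
      intro ω
      by_cases h : dec (C ω) = A ω
      · simp [h]
      · rw [if_neg h, ind_of_true h, one_div, Real.log_inv, Real.log_mul two_ne_zero hM.ne']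
        ring
    simp only [h1, Finset.sum_sub_distrib, Finset.sum_neg_distrib, ← Finset.sum_mul,
      ← prob_eq_sum_mul, hp.sum_eq_one]
    linarith

theorem ent_law [Fintype δ] (p : Ω → ℝ) (D : Ω → δ) (A : δ → α) :
    ent (fun d => prob p fun ω => D ω = d) A = ent p fun ω => A (D ω) := by
  unfold ent
  simp only [prob_law]
  rw [sum_prob_mul p D fun d => Real.log (prob p fun ω => A (D ω) = A d)]

theorem condEnt_law [Fintype δ] (p : Ω → ℝ) (D : Ω → δ) (A : δ → α) (C : δ → γ) :
    condEnt (fun d => prob p fun ω => D ω = d) A C =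
      condEnt p (fun ω => A (D ω)) fun ω => C (D ω) := by
  unfold condEnt
  rw [ent_law, ent_law]

end ChainRule

/-! ### Entropies at a uniformly random time -/

section TimeSharing

variable {Ω α γ : Type*} [Fintype Ω] {n : ℕ}

/-- The law of a uniformly distributed time together with an independent outcome. -/
noncomputable def timeLaw (n : ℕ) (p : Ω → ℝ) (x : Fin n × Ω) : ℝ := p x.2 / n

theorem expect_timeLaw (p : Ω → ℝ) (f : Fin n × Ω → ℝ) :
    expect (timeLaw n p) f = 1 / (n : ℝ) * ∑ i, expect p fun ω => f (i, ω) := by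
  unfold expect timeLaw
  rw [Fintype.sum_prod_type, Finset.mul_sum]
  refine Finset.sum_congr rfl fun i _ => ?_
  rw [Finset.mul_sum]
  exact Finset.sum_congr rfl fun ω _ => by ring

theorem isPMF_timeLaw (hn : 0 < n) {p : Ω → ℝ} (hp : IsPMF p) : IsPMF (timeLaw n p) where
  nonneg x := div_nonneg (hp.nonneg _) (Nat.cast_nonneg _)
  sum_eq_one := by
    have := expect_timeLaw (n := n) p fun _ => 1
    simp only [expect, mul_one, hp.sum_eq_one] at this
    rw [this]
    have : (n : ℝ) ≠ 0 := by positivity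
    simp [this]

/-- The term log n is the entropy of the time itself; it cancels in conditional entropies given the
time. -/
theorem ent_timeLaw (hn : 0 < n) {p : Ω → ℝ} (hp : IsPMF p) (C : Fin n → Ω → γ) :
    ent (timeLaw n p) (fun x => (x.1, C x.1 x.2)) =
      1 / (n : ℝ) * ∑ i, ent p (C i) + Real.log n := by
  have hn' : (0 : ℝ) < n := by exact_mod_cast hn
  have h1 : ∀ (i : Fin n) (ω : Ω), prob (timeLaw n p)
      (fun x => (x.1, C x.1 x.2) = (i, C i ω)) = prob p (fun ω' => C i ω' = C i ω) / n := by
    intro i ω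
    rw [prob_eq_sum_mul, prob_eq_sum_mul, Fintype.sum_prod_type, Finset.sum_eq_single i]
    · rw [Finset.sum_div]
      refine Finset.sum_congr rfl fun ω' _ => ?_
      simp only [Prod.mk.injEq, true_and, timeLaw]
      ring
    · intro j _ hj
      refine Finset.sum_eq_zero fun ω' _ => ?_
      rw [ind_of_false, mul_zero]
      exact fun h => hj (Prod.mk.inj h).1
    · simp
  unfold ent
  change -expect (timeLaw n p) _ = _
  rw [expect_timeLaw]
  simp only [h1]
  have h2 : ∀ i : Fin n, expect p (fun ω => Real.log (prob p (fun ω' => C i ω' = C i ω) / n)) =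
      ∑ ω, p ω * Real.log (prob p fun ω' => C i ω' = C i ω) - Real.log n := by
    intro i
    have : Real.log n = ∑ ω, p ω * Real.log n := by
      rw [← Finset.sum_mul, hp.sum_eq_one, one_mul]
    rw [this, ← Finset.sum_sub_distrib]
    refine Finset.sum_congr rfl fun ω _ => ?_
    by_cases h : p ω = 0
    · simp [h]
    have h3 : 0 < prob p fun ω' => C i ω' = C i ω := prob_pos_of_pos hp.nonneg rfl h
    dsimp only
    rw [Real.log_div h3.ne' hn'.ne']
    ring
  simp only [h2, Finset.sum_sub_distrib, Finset.sum_neg_distrib, Finset.sum_const,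
    Finset.card_univ, Fintype.card_fin, nsmul_eq_mul]
  field_simp
  ring

theorem condEnt_timeLaw (hn : 0 < n) {p : Ω → ℝ} (hp : IsPMF p) (A : Fin n → Ω → α)
    (C : Fin n → Ω → γ) :
    condEnt (timeLaw n p) (fun x => A x.1 x.2) (fun x => (x.1, C x.1 x.2)) =
      1 / (n : ℝ) * ∑ i, condEnt p (A i) (C i) := by
  unfold condEnt
  rw [ent_timeLaw hn hp, ent_congr (timeLaw n p)
    (A := fun x => ((fun x => A x.1 x.2) x, (fun x => (x.1, C x.1 x.2)) x))
    (B := fun x => (x.1, A x.1 x.2, C x.1 x.2)), ent_timeLaw hn hp fun i ω => (A i ω, C i ω),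
    Finset.sum_sub_distrib]
  · ring
  · intro x y
    simp only [Prod.mk.injEq]
    tauto

end TimeSharing

/-! ### Converse: multi-letter rate bounds -/

section Converse

variable {X Y₁ Y₂ Z S₁ S₂ T₁ T₂ : Type*} {n M₀ M₁ M₂ : ℕ}

/-- States and outputs without the feedback, grouped by receiver. -/
def received (θ : (S₁ × S₂) × (Y₁ × Y₂ × Z)) : (S₁ × Y₁) × (S₂ × Y₂) :=
  ((θ.1.1, θ.2.1), (θ.1.2, θ.2.2.1))

/-- The auxiliary variable of the converse: the messages of the second receiver and everything
that the receivers observed before time `i`. -/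
def Outcome.aux (i : Fin n) (ω : Outcome Y₁ Y₂ Z S₁ S₂ n M₀ M₁ M₂) :
    (Fin M₀ × Fin M₂) × (Fin n → Option ((S₁ × Y₁) × (S₂ × Y₂))) :=
  ((ω.1.1, ω.1.2.2), past (fun j ω => received (Outcome.at ω j)) i ω)

theorem Code.inputs_congr (c : Code X Y₁ Y₂ Z S₁ S₂ T₁ T₂ n M₀ M₁ M₂) (i : Fin n)
    {ω ω' : Outcome Y₁ Y₂ Z S₁ S₂ n M₀ M₁ M₂} (h : ω.1 = ω'.1)
    (h' : ∀ j < i, ω.at j = ω'.at j) : c.inputs ω.1 ω.feedback i = c.inputs ω'.1 ω'.feedback i := by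
  unfold Code.inputs
  rw [h]
  congr 1
  funext l
  exact congrArg (fun θ => θ.2.2.2) (h' (Fin.castLE i.isLt.le l) l.isLt)

theorem Outcome.aux_congr (i : Fin n) {ω ω' : Outcome Y₁ Y₂ Z S₁ S₂ n M₀ M₁ M₂} (h : ω.1 = ω'.1)
    (h' : ∀ j < i, ω.at j = ω'.at j) : ω.aux i = ω'.aux i := by
  unfold Outcome.aux
  rw [h]
  congr 1
  exact (past_eq_iff _ _ _ _).2 fun j hj => congrArg received (h' j hj)

variable [Fintype X] [Fintype Y₁] [Fintype Y₂] [Fintype Z] [Fintype S₁] [Fintype S₂]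

/-- The form of `Code.condEnt_at` for a `C` that determines the input only implicitly: the input map
is extended arbitrarily off the range of `C`. -/
theorem Code.condEnt_at_of_factors {α γ : Type*} [Nonempty X]
    (c : Code X Y₁ Y₂ Z S₁ S₂ T₁ T₂ n M₀ M₁ M₂)
    (ch : SDMBC X Y₁ Y₂ Z S₁ S₂) (i : Fin n) (A : (S₁ × S₂) × (Y₁ × Y₂ × Z) → α)
    (C : Outcome Y₁ Y₂ Z S₁ S₂ n M₀ M₁ M₂ → γ)
    (hC : ∀ ω ω', ω.1 = ω'.1 → (∀ j < i, ω.at j = ω'.at j) → C ω = C ω')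
    (hξ : ∀ ω ω', C ω = C ω' → c.inputs ω.1 ω.feedback i = c.inputs ω'.1 ω'.feedback i) :
    condEnt (c.blockLaw ch) (fun ω => A (ω.at i)) C =
      -∑ ω, c.blockLaw ch ω * Real.log
        (prob (ch.chanLaw (c.inputs ω.1 ω.feedback i)) fun t => A t = A (ω.at i)) :=
  c.condEnt_at ch i A C hC
    (Function.extend C (fun ω => c.inputs ω.1 ω.feedback i) fun _ => Classical.arbitrary X)
    fun ω => Function.FactorsThrough.extend_apply (fun ω ω' h => hξ ω ω' h) _ ω

theorem Code.condEnt_message (c : Code X Y₁ Y₂ Z S₁ S₂ T₁ T₂ n M₀ M₁ M₂)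
    (ch : SDMBC X Y₁ Y₂ Z S₁ S₂) (h₀ : 0 < M₀) (h₁ : 0 < M₁) (h₂ : 0 < M₂) :
    condEnt (c.blockLaw ch) (fun ω => ω.1.2.1) (fun ω => (ω.1.1, ω.1.2.2)) = Real.log M₁ := by
  classical
  have hp := c.isPMF_blockLaw ch h₀ h₁ h₂
  have h₁' : (M₁ : ℝ) ≠ 0 := by positivity
  rw [condEnt_eq_of_kernel hp.nonneg _ _ (fun _ _ => (M₁ : ℝ)⁻¹), ← Finset.sum_mul, hp.sum_eq_one,
    Real.log_inv]
  · ring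
  · intro a v
    rw [prob_eq_sum_mul, prob_eq_sum_mul,
      c.sum_blockLaw_mul_message ch fun w => ind (w.2.1 = a ∧ (w.1, w.2.2) = v),
      c.sum_blockLaw_mul_message ch fun w => ind ((w.1, w.2.2) = v)]
    obtain ⟨v₀, v₂⟩ := v
    simp only [Fintype.sum_prod_type]
    have h : ∀ (b : Fin M₀) (a' : Fin M₁) (b' : Fin M₂),
        ind (a' = a ∧ (b, b') = (v₀, v₂)) =
        (if a' = a then 1 else 0) * ind ((b, b') = (v₀, v₂)) := by
      intro b a' b'
      by_cases h : a' = a <;> simp [h]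
    simp only [h, ← Finset.mul_sum, ← Finset.sum_mul]
    simp only [Finset.sum_ite_eq', Finset.mem_univ, if_true, one_mul, Finset.sum_const,
      Finset.card_univ, Fintype.card_fin, nsmul_eq_mul, ← Finset.mul_sum]
    field_simp

theorem Code.ent_message (c : Code X Y₁ Y₂ Z S₁ S₂ T₁ T₂ n M₀ M₁ M₂)
    (ch : SDMBC X Y₁ Y₂ Z S₁ S₂) (h₀ : 0 < M₀) (h₁ : 0 < M₁) (h₂ : 0 < M₂) :
    ent (c.blockLaw ch) (fun ω => (ω.1.1, ω.1.2.2)) = Real.log (M₀ * M₂) := by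
  classical
  have hp := c.isPMF_blockLaw ch h₀ h₁ h₂
  have h₀' : (M₀ : ℝ) ≠ 0 := by positivity
  have h₁' : (M₁ : ℝ) ≠ 0 := by positivity
  have h₂' : (M₂ : ℝ) ≠ 0 := by positivity
  have h : ∀ ω : Outcome Y₁ Y₂ Z S₁ S₂ n M₀ M₁ M₂, prob (c.blockLaw ch)
      (fun ω' => (ω'.1.1, ω'.1.2.2) = (ω.1.1, ω.1.2.2)) = ((M₀ : ℝ) * M₂)⁻¹ := by
    intro ω
    rw [prob_eq_sum_mul,
      c.sum_blockLaw_mul_message ch fun w => ind ((w.1, w.2.2) = (ω.1.1, ω.1.2.2))]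
    simp only [Fintype.sum_prod_type, Prod.mk.injEq]
    have h : ∀ (b : Fin M₀) (b' : Fin M₂),
        ind (b = ω.1.1 ∧ b' = ω.1.2.2) =
        (if b = ω.1.1 then 1 else 0) * (if b' = ω.1.2.2 then 1 else 0) := by
      intro b b'
      by_cases h : b = ω.1.1 <;> by_cases h' : b' = ω.1.2.2 <;> simp [h, h']
    simp only [h, ← Finset.mul_sum]
    simp only [Finset.sum_ite_eq', Finset.mem_univ, if_true, mul_one, Finset.sum_const,
      Finset.card_univ, Fintype.card_fin, nsmul_eq_mul]
    field_simp
    simp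
  unfold ent
  simp only [h]
  rw [← Finset.sum_mul, hp.sum_eq_one, Real.log_inv]
  ring

/-- By Fano's inequality the left side is at most I(W₁; Bⁿ | W₀, W₂), where B collects what both
receivers observe. The chain rule gives H(B_i | U_i) minus the entropy given all messages and the
past of B, and the latter is at least H(B_i | U_i, X_i). -/
theorem Code.rate₁_le (c : Code X Y₁ Y₂ Z S₁ S₂ T₁ T₂ n M₀ M₁ M₂) [Nonempty X]
    (ch : SDMBC X Y₁ Y₂ Z S₁ S₂) (h₀ : 0 < M₀) (h₁ : 0 < M₁) (h₂ : 0 < M₂) :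
    (1 - c.errorProb ch) * Real.log M₁ - Real.log 2 ≤
      ∑ i, (condEnt (c.blockLaw ch) (fun ω => received (ω.at i)) (Outcome.aux i) -
        condEnt (c.blockLaw ch) (fun ω => received (ω.at i))
          (fun ω => (ω.aux i, c.inputs ω.1 ω.feedback i))) := by
  classical
  have hp := c.isPMF_blockLaw ch h₀ h₁ h₂
  have : Nonempty (Fin M₁) := ⟨⟨0, h₁⟩⟩
  have hfano := condEnt_le_of_decoder hp (fun ω => ω.1.2.1)
    (fun ω => ((ω.1.1, ω.1.2.2), fun i => received (ω.at i)))
    (fun x => (c.dec₁ (fun i => (x.2 i).1.1) (fun i => (x.2 i).1.2)).2)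
  have herr : prob (c.blockLaw ch) (fun ω => (c.dec₁ (fun i => (received (ω.at i)).1.1)
      (fun i => (received (ω.at i)).1.2)).2 ≠ ω.1.2.1) ≤ c.errorProb ch := by
    refine prob_mono hp.nonneg fun ω hω => Or.inl fun h => hω ?_
    exact congrArg Prod.snd h
  have hcomm := condEnt_sub_comm (c.blockLaw ch) (fun ω => ω.1.2.1)
    (fun ω i => received (ω.at i)) (fun ω => (ω.1.1, ω.1.2.2))
  rw [c.condEnt_message ch h₀ h₁ h₂, condEnt_sequence (c.blockLaw ch) fun i ω => received (ω.at i),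
    condEnt_sequence (c.blockLaw ch) fun i ω => received (ω.at i), ← Finset.sum_sub_distrib] at hcomm
  rw [Fintype.card_fin] at hfano
  have hlog : 0 ≤ Real.log M₁ := Real.log_natCast_nonneg _
  have h1 := mul_le_mul_of_nonneg_right herr hlog
  have h2 : (1 - c.errorProb ch) * Real.log M₁ - Real.log 2 ≤ _ :=
    le_trans (by linarith) hcomm.le
  refine h2.trans (Finset.sum_le_sum fun i _ => sub_le_sub_left ?_ _)
  -- Both (U_i, X_i) and the full past with all messages determine X_i and are causal, hence give
  -- B_i the same conditional entropy. The full past, which contains the feedback, refines the past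
  -- of B, and conditioning reduces entropy.
  rw [c.condEnt_at_of_factors ch i received (fun ω => (ω.aux i, c.inputs ω.1 ω.feedback i))
    (fun ω ω' h h' => by rw [Outcome.aux_congr i h h', c.inputs_congr i h h'])
    (fun ω ω' h => (Prod.mk.inj h).2),
    ← c.condEnt_at_of_factors ch i received (fun ω => (ω.1, past (fun j ω => Outcome.at ω j) i ω))
    (fun ω ω' h h' => by
      rw [h]
      congr 1
      exact (past_eq_iff _ _ _ _).2 fun j hj => h' j hj)
    (fun ω ω' h => c.inputs_congr i (Prod.mk.inj h).1
      fun j hj => (past_eq_iff _ _ _ _).1 (Prod.mk.inj h).2 j hj)]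
  refine condEnt_anti hp _ _ _ (fun x => (((x.1.1, x.1.2.2), x.1.2.1),
    fun j => (x.2 j).map received)) fun ω => ?_
  congr 1
  funext j
  by_cases h : j < i <;> simp [past, h]

/-- The same scheme for (W₀, W₂) and the observations of receiver 2. U_i contains these messages and
the past of receiver 2, so both entropies move in the favorable direction. -/
theorem Code.rate₂_le (c : Code X Y₁ Y₂ Z S₁ S₂ T₁ T₂ n M₀ M₁ M₂)
    (ch : SDMBC X Y₁ Y₂ Z S₁ S₂) (h₀ : 0 < M₀) (h₁ : 0 < M₁) (h₂ : 0 < M₂) :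
    (1 - c.errorProb ch) * Real.log (M₀ * M₂) - Real.log 2 ≤
      ∑ i, (ent (c.blockLaw ch) (fun ω => (received (ω.at i)).2) -
        condEnt (c.blockLaw ch) (fun ω => (received (ω.at i)).2) (Outcome.aux i)) := by
  classical
  have hp := c.isPMF_blockLaw ch h₀ h₁ h₂
  have : Nonempty (Fin M₀ × Fin M₂) := ⟨⟨0, h₀⟩, ⟨0, h₂⟩⟩
  have hfano := condEnt_le_of_decoder hp (fun ω => (ω.1.1, ω.1.2.2))
    (fun ω => (PUnit.unit.{1}, fun i => (received (ω.at i)).2))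
    (fun x => c.dec₂ (fun i => (x.2 i).1) (fun i => (x.2 i).2))
  have herr : prob (c.blockLaw ch) (fun ω => c.dec₂ (fun i => (received (ω.at i)).2.1)
      (fun i => (received (ω.at i)).2.2) ≠ (ω.1.1, ω.1.2.2)) ≤ c.errorProb ch :=
    prob_mono hp.nonneg fun ω hω => Or.inr hω
  have hcomm := condEnt_sub_comm (c.blockLaw ch) (fun ω => (ω.1.1, ω.1.2.2))
    (fun ω i => (received (ω.at i)).2) (fun _ => PUnit.unit.{1})
  rw [condEnt_of_const _ hp _ (fun _ _ => rfl), c.ent_message ch h₀ h₁ h₂,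
    condEnt_sequence (c.blockLaw ch) fun i ω => (received (ω.at i)).2,
    condEnt_sequence (c.blockLaw ch) fun i ω => (received (ω.at i)).2, ← Finset.sum_sub_distrib] at hcomm
  rw [Fintype.card_prod, Fintype.card_fin, Fintype.card_fin] at hfano
  push_cast at hfano
  have hlog : 0 ≤ Real.log (M₀ * M₂) := by
    exact_mod_cast Real.log_natCast_nonneg (M₀ * M₂)
  have h1 := mul_le_mul_of_nonneg_right herr hlog
  have h2 : (1 - c.errorProb ch) * Real.log (M₀ * M₂) - Real.log 2 ≤ _ :=
    le_trans (by linarith) hcomm.le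
  refine h2.trans (Finset.sum_le_sum fun i _ => sub_le_sub (condEnt_le_ent hp _ _) ?_)
  refine condEnt_anti hp _ _ _ (fun x => ((PUnit.unit, x.1),
    fun j => (x.2 j).map Prod.snd)) fun ω => ?_
  unfold Outcome.aux
  congr 1
  funext j
  by_cases h : j < i <;> simp [past, h]

end Converse

/-! ### Converse: reduction to a single letter -/

section Converse

variable {X Y₁ Y₂ Z S₁ S₂ T₁ T₂ : Type*} [Fintype X] [Fintype Y₁] [Fintype Y₂] [Fintype Z]
    [Fintype S₁] [Fintype S₂] {n M₀ M₁ M₂ : ℕ}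

/-- At a uniformly distributed time, the auxiliary variable, the input, the states and the outputs
follow a single-letter law. -/
theorem Code.law_timeLaw {U : Type*} [Fintype U] (c : Code X Y₁ Y₂ Z S₁ S₂ T₁ T₂ n M₀ M₁ M₂)
    (ch : SDMBC X Y₁ Y₂ Z S₁ S₂) (f : Fin n → Outcome Y₁ Y₂ Z S₁ S₂ n M₀ M₁ M₂ → U)
    (hf : ∀ i ω ω', ω.1 = ω'.1 → (∀ j < i, ω.at j = ω'.at j) → f i ω = f i ω')
    (PUX : stdSimplex ℝ (U × X))
    (hPUX : ∀ v, PUX.1 v = prob (timeLaw n (c.blockLaw ch))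
      fun x => (f x.1 x.2, c.inputs x.2.1 x.2.feedback x.1) = v) :
    ch.singleLetterLaw PUX = fun d => prob (timeLaw n (c.blockLaw ch)) fun x =>
      ((f x.1 x.2, c.inputs x.2.1 x.2.feedback x.1), x.2.at x.1) = d := by
  classical
  funext ⟨v, s, o⟩
  have h1 : ch.singleLetterLaw PUX (v, s, o) = PUX.1 v * ch.chanLaw v.2 (s, o) := by
    simp [singleLetterLaw, chanLaw, mul_assoc]
  rw [h1, hPUX, prob_eq_sum_mul, prob_eq_sum_mul, Finset.sum_mul]
  simp only [Fintype.sum_prod_type (γ := ℝ) (α₁ := Fin n)]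
  refine Finset.sum_congr rfl fun i _ => ?_
  have h2 := c.sum_blockLaw_mul_at ch i (fun ω t => ind
    (((f i ω, c.inputs ω.1 ω.feedback i), t) = (v, s, o)))
    (fun ω ω' h h' => by rw [hf i ω ω' h h', c.inputs_congr i h h'])
  simp only [timeLaw, div_mul_eq_mul_div, ← Finset.sum_div]
  rw [h2]
  congr 1
  refine Finset.sum_congr rfl fun ω _ => ?_
  by_cases h : (f i ω, c.inputs ω.1 ω.feedback i) = v
  · subst h
    simp [ind]
  · have h3 : ∀ t, ((f i ω, c.inputs ω.1 ω.feedback i), t) ≠ (v, s, o) :=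
      fun t ht => h (Prod.mk.inj ht).1
    simp [h, h3]

/-- Every code satisfies single-letter bounds. -/
theorem Code.exists_singleLetter (c : Code X Y₁ Y₂ Z S₁ S₂ T₁ T₂ n M₀ M₁ M₂)
    (ch : SDMBC X Y₁ Y₂ Z S₁ S₂) (hdeg : ch.PhysicallyDegraded) (hn : 0 < n)
    (h₀ : 0 < M₀) (h₁ : 0 < M₁) (h₂ : 0 < M₂)
    (d₁ : S₁ → T₁ → ℝ) (d₂ : S₂ → T₂ → ℝ) (sh₁ : X → Z → T₁) (sh₂ : X → Z → T₂)
    (hsh₁ : ∀ x z t, ∑ s, ch.stateFeedbackLaw x z s * d₁ s.1 (sh₁ x z) ≤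
      ∑ s, ch.stateFeedbackLaw x z s * d₁ s.1 t)
    (hsh₂ : ∀ x z t, ∑ s, ch.stateFeedbackLaw x z s * d₂ s.2 (sh₂ x z) ≤
      ∑ s, ch.stateFeedbackLaw x z s * d₂ s.2 t) :
    ∃ (m : ℕ) (PUX : stdSimplex ℝ (Fin m × X)),
      (1 - c.errorProb ch) * Real.logb 2 M₁ - 1 ≤
        n * condMutualInfo (ch.singleLetterLaw PUX)
          (fun ω => ω.1.2) (fun ω => ω.2.2.1) (fun ω => (ω.1.1, ω.2.1.1)) ∧
      (1 - c.errorProb ch) * Real.logb 2 (M₀ * M₂) - 1 ≤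
        n * condMutualInfo (ch.singleLetterLaw PUX)
          (fun ω => ω.1.1) (fun ω => ω.2.2.2.1) (fun ω => ω.2.1.2) ∧
      expect (ch.singleLetterLaw PUX)
        (fun ω => d₁ ω.2.1.1 (sh₁ ω.1.2 ω.2.2.2.2)) ≤ c.distortion₁ ch d₁ ∧
      expect (ch.singleLetterLaw PUX)
        (fun ω => d₂ ω.2.1.2 (sh₂ ω.1.2 ω.2.2.2.2)) ≤ c.distortion₂ ch d₂ := by
  classical
  have hp := c.isPMF_blockLaw ch h₀ h₁ h₂
  have hp' := isPMF_timeLaw hn hp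
  have hn' : (0 : ℝ) < n := by exact_mod_cast hn
  have hX : Nonempty X := ⟨c.enc ⟨0, hn⟩ (⟨0, h₀⟩, ⟨0, h₁⟩, ⟨0, h₂⟩) fun l => l.elim0⟩
  -- The auxiliary variable is the pair of the random time and U at that time, relabeled because the
  -- single-letter set asks for an alphabet `Fin m`.
  let e := Fintype.equivFin
    (Fin n × (Fin M₀ × Fin M₂) × (Fin n → Option ((S₁ × Y₁) × (S₂ × Y₂))))
  let PUX : stdSimplex ℝ (Fin _ × X) :=
    ⟨fun v => prob (timeLaw n (c.blockLaw ch)) fun x =>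
      (e (x.1, x.2.aux x.1), c.inputs x.2.1 x.2.feedback x.1) = v,
      (hp'.law _).nonneg, (hp'.law _).sum_eq_one⟩
  have hlaw := c.law_timeLaw ch (fun i ω => e (i, ω.aux i))
    (fun i ω ω' h h' => by rw [Outcome.aux_congr i h h']) PUX fun _ => rfl
  have hlog2 : 0 < Real.log 2 := Real.log_pos one_lt_two
  refine ⟨_, PUX, ?_, ?_, ?_, ?_⟩
  · refine le_of_mul_le_mul_right ?_ hlog2
    rw [mul_assoc, mutualInfo_input ch hdeg PUX, hlaw, condEnt_law, condEnt_law]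
    have hr := c.rate₁_le ch h₀ h₁ h₂
    rw [Finset.sum_sub_distrib] at hr
    have h3 := condEnt_timeLaw hn hp (fun i ω => received (Outcome.at ω i)) fun i ω => ω.aux i
    have h4 := condEnt_timeLaw hn hp (fun i ω => received (Outcome.at ω i))
      fun i ω => (ω.aux i, c.inputs ω.1 ω.feedback i)
    have e1 := condEnt_congr (timeLaw n (c.blockLaw ch)) (A := fun x => received (x.2.at x.1))
      (B := fun x => received (x.2.at x.1)) (C := fun x => e (x.1, x.2.aux x.1))
      (D := fun x => (x.1, x.2.aux x.1)) (by simp) (fun _ _ _ => Iff.rfl)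
    have e2 := condEnt_congr (timeLaw n (c.blockLaw ch)) (A := fun x => received (x.2.at x.1))
      (B := fun x => received (x.2.at x.1))
      (C := fun x => (e (x.1, x.2.aux x.1), c.inputs x.2.1 x.2.feedback x.1))
      (D := fun x => (x.1, x.2.aux x.1, c.inputs x.2.1 x.2.feedback x.1))
      (by simp [and_assoc]) (fun _ _ _ => Iff.rfl)
    change _ ≤ n * (condEnt (timeLaw n (c.blockLaw ch)) (fun x => received (x.2.at x.1))
      (fun x => e (x.1, x.2.aux x.1)) - condEnt (timeLaw n (c.blockLaw ch))
        (fun x => received (x.2.at x.1))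
        (fun x => (e (x.1, x.2.aux x.1), c.inputs x.2.1 x.2.feedback x.1)))
    rw [e1, e2, h3, h4]
    have h5 : ((1 - c.errorProb ch) * Real.logb 2 M₁ - 1) * Real.log 2 =
        (1 - c.errorProb ch) * Real.log M₁ - Real.log 2 := by
      rw [Real.logb]
      field_simp
    rw [h5]
    refine hr.trans (le_of_eq ?_)
    field_simp
  · refine le_of_mul_le_mul_right ?_ hlog2
    rw [mul_assoc, mutualInfo_cloud₂ ch PUX, hlaw, condEnt_law, ent_law]
    have hr := c.rate₂_le ch h₀ h₁ h₂
    rw [Finset.sum_sub_distrib] at hr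
    have h3 := condEnt_timeLaw hn hp (fun i ω => (received (Outcome.at ω i)).2)
      fun i ω => ω.aux i
    have h4 := condEnt_timeLaw hn hp (fun i ω => (received (Outcome.at ω i)).2)
      fun _ _ => ()
    -- The average over i of the entropies of (S₂, Y₂) at time i is a conditional entropy given the
    -- time, hence at most the entropy at the random time.
    have h6 := condEnt_le_ent hp' (fun x => (received (x.2.at x.1)).2) fun x => (x.1, ())
    simp only [condEnt_of_const _ hp (C := fun _ => ()) _ fun _ _ => rfl] at h4
    have e1 := condEnt_congr (timeLaw n (c.blockLaw ch))
      (A := fun x => (received (x.2.at x.1)).2) (B := fun x => (received (x.2.at x.1)).2)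
      (C := fun x => e (x.1, x.2.aux x.1)) (D := fun x => (x.1, x.2.aux x.1))
      (by simp) (fun _ _ _ => Iff.rfl)
    change _ ≤ n * (ent (timeLaw n (c.blockLaw ch)) (fun x => (received (x.2.at x.1)).2) -
      condEnt (timeLaw n (c.blockLaw ch)) (fun x => (received (x.2.at x.1)).2)
        (fun x => e (x.1, x.2.aux x.1)))
    rw [e1, h3]
    rw [h4] at h6
    have h5 : ((1 - c.errorProb ch) * Real.logb 2 (M₀ * M₂) - 1) * Real.log 2 =
        (1 - c.errorProb ch) * Real.log (M₀ * M₂) - Real.log 2 := by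
      rw [Real.logb]
      field_simp
    rw [h5]
    refine hr.trans ?_
    have h7 := mul_le_mul_of_nonneg_left (sub_le_sub_right h6
      (1 / (n : ℝ) * ∑ i, condEnt (c.blockLaw ch) (fun ω => (received (ω.at i)).2)
        (Outcome.aux i))) hn'.le
    refine le_trans (le_of_eq ?_) h7
    field_simp
  · rw [hlaw, expect_law, expect_timeLaw]
    refine mul_le_mul_of_nonneg_left (Finset.sum_le_sum fun i _ => ?_) (by positivity)
    exact c.expect_optimal_le ch i (fun s t => d₁ s.1 t) sh₁ hsh₁
      fun w z => c.est₁ (c.inputs w z) z i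
  · rw [hlaw, expect_law, expect_timeLaw]
    refine mul_le_mul_of_nonneg_left (Finset.sum_le_sum fun i _ => ?_) (by positivity)
    exact c.expect_optimal_le ch i (fun s t => d₂ s.2 t) sh₂ hsh₂
      fun w z => c.est₂ (c.inputs w z) z i

end Converse

theorem numMessages_pos (n : ℕ) {R : ℝ} (hR : 0 ≤ R) : 0 < numMessages n R := by
  refine Nat.floor_pos.2 (Real.one_le_rpow one_le_two (by positivity))

/-- For t ≥ 1 one has ⌊t⌋ ≥ t/2, so rounding costs at most one bit. -/
theorem le_logb_numMessages (n : ℕ) {R : ℝ} (hR : 0 ≤ R) :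
    n * R - 1 ≤ Real.logb 2 (numMessages n R) := by
  have h1 : (1 : ℝ) ≤ numMessages n R := by exact_mod_cast numMessages_pos n hR
  rw [Real.le_logb_iff_rpow_le one_lt_two (by linarith), Real.rpow_sub two_pos, Real.rpow_one]
  have h2 : (2 : ℝ) ^ (n * R) < numMessages n R + 1 := Nat.lt_floor_add_one _
  linarith

/-! ### Converse: passage to the limit -/

section Converse

variable {X Y₁ Y₂ Z S₁ S₂ T₁ T₂ : Type*} [Fintype X] [Fintype Y₁] [Fintype Y₂] [Fintype Z]
    [Fintype S₁] [Fintype S₂]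

theorem stateFeedbackLaw_nonneg (ch : SDMBC X Y₁ Y₂ Z S₁ S₂) (x : X) (z : Z) (s : S₁ × S₂) :
    0 ≤ ch.stateFeedbackLaw x z s :=
  mul_nonneg (ch.PS_nonneg _) (Finset.sum_nonneg fun _ _ => Finset.sum_nonneg fun _ _ =>
    ch.PYZ_nonneg _ _ _)

/-- Multiplying by P(z | x) removes the normalization of the posterior; if P(z | x) = 0, all terms
vanish and any estimate will do. -/
theorem IsOptimalEstimator.sum_stateFeedbackLaw_le₁ {ch : SDMBC X Y₁ Y₂ Z S₁ S₂} {d : S₁ → T₁ → ℝ}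
    {sh : X → Z → T₁} (h : IsOptimalEstimator ch.posterior₁ d sh) (x : X) (z : Z) (t : T₁) :
    ∑ s, ch.stateFeedbackLaw x z s * d s.1 (sh x z) ≤ ∑ s, ch.stateFeedbackLaw x z s * d s.1 t := by
  rcases eq_or_ne (∑ s, ch.stateFeedbackLaw x z s) 0 with h0 | h0
  · have := (Finset.sum_eq_zero_iff_of_nonneg fun s _ => ch.stateFeedbackLaw_nonneg x z s).1 h0
    simp [this]
  · have key : ∀ t, ∑ s, ch.stateFeedbackLaw x z s * d s.1 t =
        (∑ s, ch.stateFeedbackLaw x z s) * ∑ s, ch.posterior₁ x z s * d s t := by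
      intro t
      rw [Fintype.sum_prod_type, Finset.mul_sum]
      refine Finset.sum_congr rfl fun s _ => ?_
      dsimp only
      rw [posterior₁, ← Finset.sum_mul]
      field_simp
    rw [key, key]
    exact mul_le_mul_of_nonneg_left (h x z t)
      (Finset.sum_nonneg fun s _ => ch.stateFeedbackLaw_nonneg x z s)

theorem IsOptimalEstimator.sum_stateFeedbackLaw_le₂ {ch : SDMBC X Y₁ Y₂ Z S₁ S₂} {d : S₂ → T₂ → ℝ}
    {sh : X → Z → T₂} (h : IsOptimalEstimator ch.posterior₂ d sh) (x : X) (z : Z) (t : T₂) :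
    ∑ s, ch.stateFeedbackLaw x z s * d s.2 (sh x z) ≤ ∑ s, ch.stateFeedbackLaw x z s * d s.2 t := by
  rcases eq_or_ne (∑ s, ch.stateFeedbackLaw x z s) 0 with h0 | h0
  · have := (Finset.sum_eq_zero_iff_of_nonneg fun s _ => ch.stateFeedbackLaw_nonneg x z s).1 h0
    simp [this]
  · have key : ∀ t, ∑ s, ch.stateFeedbackLaw x z s * d s.2 t =
        (∑ s, ch.stateFeedbackLaw x z s) * ∑ s, ch.posterior₂ x z s * d s t := by
      intro t
      rw [Fintype.sum_prod_type_right, Finset.mul_sum]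
      refine Finset.sum_congr rfl fun s _ => ?_
      dsimp only
      rw [posterior₂, ← Finset.sum_mul]
      field_simp
    rw [key, key]
    exact mul_le_mul_of_nonneg_left (h x z t)
      (Finset.sum_nonneg fun s _ => ch.stateFeedbackLaw_nonneg x z s)

/-- These are the rates certified at blocklength n, truncated at zero because the single-letter set
asks for nonnegative rates. -/
theorem tendsto_max_rate {e : ℕ → ℝ} (he : Tendsto e atTop (𝓝 0)) {R : ℝ} (hR : 0 ≤ R) (K : ℝ) :
    Tendsto (fun n : ℕ => max 0 (R * (1 - e n) - K / n)) atTop (𝓝 R) := by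
  have h1 : Tendsto (fun n : ℕ => max 0 (R * (1 - e n) - K / n)) atTop
      (𝓝 (max 0 (R * (1 - 0) - 0))) :=
    tendsto_const_nhds.max (((tendsto_const_nhds.sub he).const_mul R).sub
      (tendsto_const_div_atTop_nhds_zero_nat K))
  simpa [hR] using h1

theorem achievable_subset (ch : SDMBC X Y₁ Y₂ Z S₁ S₂) (hdeg : ch.PhysicallyDegraded)
    (d₁ : S₁ → T₁ → ℝ) (d₂ : S₂ → T₂ → ℝ) (sh₁ : X → Z → T₁) (sh₂ : X → Z → T₂)
    (hsh₁ : IsOptimalEstimator ch.posterior₁ d₁ sh₁)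
    (hsh₂ : IsOptimalEstimator ch.posterior₂ d₂ sh₂) :
    ch.achievable d₁ d₂ ⊆ closure (ch.singleLetterSet d₁ d₂ sh₁ sh₂) := by
  rintro ⟨R₀, R₁, R₂, D₁, D₂⟩ ⟨hR₀, hR₁, hR₂, c, herr, hD₁, hD₂⟩
  -- The bound on the upper limits only gives distortions eventually below D_k + ε; the slack
  -- disappears in a second closure.
  have step : ∀ ε > 0, (R₀, R₁, R₂, D₁ + ε, D₂ + ε) ∈
      closure (ch.singleLetterSet d₁ d₂ sh₁ sh₂) := by
    intro ε hε
    have h1 : ∀ᶠ n in atTop, (c n).distortion₁ ch d₁ ≤ D₁ + ε := by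
      have := eventually_lt_of_limsup_lt (lt_of_le_of_lt hD₁
        (EReal.coe_lt_coe_iff.2 (lt_add_of_pos_right D₁ hε)))
      filter_upwards [this] with n hn
      exact (EReal.coe_lt_coe_iff.1 hn).le
    have h2 : ∀ᶠ n in atTop, (c n).distortion₂ ch d₂ ≤ D₂ + ε := by
      have := eventually_lt_of_limsup_lt (lt_of_le_of_lt hD₂
        (EReal.coe_lt_coe_iff.2 (lt_add_of_pos_right D₂ hε)))
      filter_upwards [this] with n hn
      exact (EReal.coe_lt_coe_iff.1 hn).le
    -- Fano costs one bit and each rounding one bit: two bits for R₁, three for R₀ + R₂. The three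
    -- bits are charged to both R₀ and R₂, so that the sum is still bounded when only one of them is
    -- truncated to zero.
    refine mem_closure_of_tendsto (f := fun n : ℕ =>
      (max 0 (R₀ * (1 - (c n).errorProb ch) - 3 / n), max 0 (R₁ * (1 - (c n).errorProb ch) - 2 / n),
        max 0 (R₂ * (1 - (c n).errorProb ch) - 3 / n), D₁ + ε, D₂ + ε)) (b := atTop)
      ((tendsto_max_rate herr hR₀ 3).prodMk_nhds ((tendsto_max_rate herr hR₁ 2).prodMk_nhds
        ((tendsto_max_rate herr hR₂ 3).prodMk_nhds
          (tendsto_const_nhds.prodMk_nhds tendsto_const_nhds)))) ?_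
    filter_upwards [h1, h2, eventually_gt_atTop 0] with n hn1 hn2 hn
    have hM₀ := numMessages_pos n hR₀
    have hM₁ := numMessages_pos n hR₁
    have hM₂ := numMessages_pos n hR₂
    have hp := (c n).isPMF_blockLaw ch hM₀ hM₁ hM₂
    obtain ⟨m, PUX, hr1, hr2, hd1, hd2⟩ := (c n).exists_singleLetter ch hdeg hn hM₀ hM₁ hM₂ d₁ d₂
      sh₁ sh₂ hsh₁.sum_stateFeedbackLaw_le₁ hsh₂.sum_stateFeedbackLaw_le₂
    refine ⟨le_max_left _ _, le_max_left _ _, le_max_left _ _, m, PUX, ?_, ?_, hd1.trans hn1,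
      hd2.trans hn2⟩
    all_goals
      have hP := isPMF_singleLetterLaw ch PUX
      have hn' : (0 : ℝ) < n := by exact_mod_cast hn
      have he1 : (c n).errorProb ch ≤ 1 := hp.prob_le_one _
      have he0 : 0 ≤ (c n).errorProb ch := prob_nonneg hp.nonneg _
      set e := (c n).errorProb ch
    · have hI := condMutualInfo_nonneg hP (fun ω => ω.1.2) (fun ω => ω.2.2.1)
        (fun ω => (ω.1.1, ω.2.1.1))
      refine max_le hI ?_
      have h3 := mul_le_mul_of_nonneg_left (le_logb_numMessages n hR₁) (sub_nonneg.2 he1)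
      have h4 : n * (R₁ * (1 - e) - 2 / n) = (1 - e) * (n * R₁ - 1) - 1 - e := by
        field_simp
        ring
      refine le_of_mul_le_mul_left ?_ hn'
      rw [h4]
      linarith
    · have hI := condMutualInfo_nonneg hP (fun ω => ω.1.1) (fun ω => ω.2.2.2.1)
        (fun ω => ω.2.1.2)
      have h0' : (numMessages n R₀ : ℝ) ≠ 0 := by positivity
      have h2' : (numMessages n R₂ : ℝ) ≠ 0 := by positivity
      rw [Real.logb_mul h0' h2'] at hr2
      have h3 := mul_le_mul_of_nonneg_left
        (add_le_add (le_logb_numMessages n hR₀) (le_logb_numMessages n hR₂)) (sub_nonneg.2 he1)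
      have h4 : n * (R₀ * (1 - e) + R₂ * (1 - e) - 3 / n) =
          (1 - e) * (n * R₀ - 1 + (n * R₂ - 1)) - 1 - 2 * e := by
        field_simp
        ring
      have h5 : R₀ * (1 - e) + R₂ * (1 - e) - 3 / n ≤ condMutualInfo (ch.singleLetterLaw PUX)
          (fun ω => ω.1.1) (fun ω => ω.2.2.2.1) (fun ω => ω.2.1.2) := by
        refine le_of_mul_le_mul_left ?_ hn'
        rw [h4]
        linarith
      have h6 : 0 ≤ R₀ * (1 - e) := mul_nonneg hR₀ (sub_nonneg.2 he1)
      have h7 : 0 ≤ R₂ * (1 - e) := mul_nonneg hR₂ (sub_nonneg.2 he1)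
      have h8 : 0 ≤ 3 / (n : ℝ) := by positivity
      rcases max_cases 0 (R₀ * (1 - e) - 3 / n) with h | h <;>
        rcases max_cases 0 (R₂ * (1 - e) - 3 / n) with h' | h' <;>
        rw [h.1, h'.1] <;> linarith
  rw [← closure_closure]
  refine mem_closure_of_tendsto (f := fun n : ℕ =>
    (R₀, R₁, R₂, D₁ + 1 / ((n : ℝ) + 1), D₂ + 1 / ((n : ℝ) + 1))) (b := atTop) ?_
    (Eventually.of_forall fun n => step _ (by positivity))
  have h := tendsto_one_div_add_atTop_nhds_zero_nat (𝕜 := ℝ)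
  have h1 : Tendsto (fun n : ℕ => D₁ + 1 / ((n : ℝ) + 1)) atTop (𝓝 D₁) := by
    simpa using h.const_add D₁
  have h2 : Tendsto (fun n : ℕ => D₂ + 1 / ((n : ℝ) + 1)) atTop (𝓝 D₂) := by
    simpa using h.const_add D₂
  exact tendsto_const_nhds.prodMk_nhds (tendsto_const_nhds.prodMk_nhds
    (tendsto_const_nhds.prodMk_nhds (h1.prodMk_nhds h2)))

end Converse

/-! ### I.i.d. laws, Chebyshev's inequality and threshold decoding -/

section ProductLaw

variable {ι κ α β : Type*} [Fintype ι] [Fintype κ]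

/-- The law of independent and identically distributed random variables. -/
noncomputable def piLaw (q : κ → ℝ) (θ : ι → κ) : ℝ := ∏ i, q (θ i)

theorem sum_piLaw_mul_apply {q : κ → ℝ} (hq : IsPMF q) (i : ι) (h : κ → ℝ) [DecidableEq ι] :
    ∑ θ : ι → κ, piLaw q θ * h (θ i) = ∑ b, q b * h b := by
  have := sum_pi_prod_mul_apply (fun _ : ι => q) i h
  unfold piLaw
  rw [this, hq.sum_eq_one]
  simp

theorem isPMF_piLaw [DecidableEq ι] {q : κ → ℝ} (hq : IsPMF q) :
    IsPMF (piLaw q : (ι → κ) → ℝ) where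
  nonneg θ := Finset.prod_nonneg fun i _ => hq.nonneg _
  sum_eq_one := by
    unfold piLaw
    rw [← Fintype.prod_sum fun _ : ι => q]
    simp [hq.sum_eq_one]

theorem sum_piLaw_mul_apply₂ [DecidableEq ι] {q : κ → ℝ} (hq : IsPMF q) {i j : ι} (hij : j ≠ i)
    (h : κ → κ → ℝ) :
    ∑ θ : ι → κ, piLaw q θ * h (θ i) (θ j) = ∑ a, q a * ∑ b, q b * h a b := by
  rw [Fintype.sum_equiv (Equiv.funSplitAt i κ) _
    (fun x => q x.1 * piLaw q x.2 * h x.1 (x.2 ⟨j, hij⟩)), Fintype.sum_prod_type]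
  · refine Finset.sum_congr rfl fun a _ => ?_
    rw [← sum_piLaw_mul_apply hq (⟨j, hij⟩ : {j // j ≠ i}) (h a), Finset.mul_sum]
    exact Finset.sum_congr rfl fun θ _ => by ring
  · intro θ
    unfold piLaw
    rw [Fintype.prod_eq_mul_prod_subtype_ne _ i]
    rfl

/-- The second moment of an empirical mean. -/
theorem sum_piLaw_mul_sq {n : ℕ} (hn : 0 < n) {q : κ → ℝ} (hq : IsPMF q) (f : κ → ℝ) :
    ∑ θ : Fin n → κ, piLaw q θ * (1 / (n : ℝ) * ∑ i, f (θ i) - ∑ b, q b * f b) ^ 2 =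
      (∑ b, q b * (f b - ∑ b, q b * f b) ^ 2) / n := by
  set μ := ∑ b, q b * f b with hμ
  have hn' : (n : ℝ) ≠ 0 := by positivity
  have h0 : ∑ b, q b * (f b - μ) = 0 := by
    simp only [mul_sub, Finset.sum_sub_distrib, ← Finset.sum_mul, hq.sum_eq_one]
    simp [hμ]
  have h1 : ∀ θ : Fin n → κ, (1 / (n : ℝ) * ∑ i, f (θ i) - μ) ^ 2 =
      1 / (n : ℝ) ^ 2 * ∑ i, ∑ j, (f (θ i) - μ) * (f (θ j) - μ) := by
    intro θ
    have : ∑ i, f (θ i) = ∑ i, (f (θ i) - μ) + n * μ := by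
      simp [Finset.sum_sub_distrib]
    rw [← Finset.sum_mul_sum, this]
    field_simp
    ring
  have h2 : ∀ i j : Fin n, ∑ θ : Fin n → κ, piLaw q θ * ((f (θ i) - μ) * (f (θ j) - μ)) =
      if j = i then ∑ b, q b * (f b - μ) ^ 2 else 0 := by
    intro i j
    split_ifs with h
    · subst h
      rw [sum_piLaw_mul_apply hq j fun b => (f b - μ) * (f b - μ)]
      simp [sq]
    · rw [sum_piLaw_mul_apply₂ hq h fun a b => (f a - μ) * (f b - μ)]
      refine Finset.sum_eq_zero fun a _ => ?_
      have : ∑ b, q b * ((f a - μ) * (f b - μ)) = (f a - μ) * ∑ b, q b * (f b - μ) := by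
        rw [Finset.mul_sum]
        exact Finset.sum_congr rfl fun b _ => by ring
      rw [this, h0, mul_zero, mul_zero]
  calc _ = ∑ θ : Fin n → κ, 1 / (n : ℝ) ^ 2 * ∑ i, ∑ j,
        piLaw q θ * ((f (θ i) - μ) * (f (θ j) - μ)) := by
        refine Finset.sum_congr rfl fun θ _ => ?_
        rw [h1]
        simp only [← Finset.mul_sum]
        ring
    _ = 1 / (n : ℝ) ^ 2 * ∑ i, ∑ j, ∑ θ : Fin n → κ,
        piLaw q θ * ((f (θ i) - μ) * (f (θ j) - μ)) := by
        rw [← Finset.mul_sum, Finset.sum_comm]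
        congr 1
        exact Finset.sum_congr rfl fun i _ => Finset.sum_comm
    _ = _ := by
        simp only [h2, Finset.sum_ite_eq', Finset.mem_univ, if_true, Finset.sum_const,
          Finset.card_univ, Fintype.card_fin, nsmul_eq_mul]
        field_simp

/-- A product of likelihood ratios is unlikely to be exponentially smaller than expected. -/
theorem prob_prod_lt_le {n : ℕ} (hn : 0 < n) {q : κ → ℝ} (hq : IsPMF q) (ρ : κ → ℝ)
    (hρ : ∀ b, q b ≠ 0 → 0 < ρ b) {I δ : ℝ} (hI : ∑ b, q b * Real.logb 2 (ρ b) = I) (hδ : 0 < δ) :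
    ∑ θ : Fin n → κ, piLaw q θ * ind (∏ i, ρ (θ i) < 2 ^ (n * (I - δ))) ≤
      (∑ b, q b * (Real.logb 2 (ρ b) - I) ^ 2) / δ ^ 2 / n := by
  have h := sum_piLaw_mul_sq hn hq fun b => Real.logb 2 (ρ b)
  rw [hI] at h
  rw [div_right_comm, ← h, Finset.sum_div]
  have hn' : (0 : ℝ) < n := by exact_mod_cast hn
  -- Chebyshev, term by term: on the event the empirical mean of log₂ ρ is more than δ below I, so
  -- its squared deviation over δ² is at least 1. Sequences of probability zero, where ρ may vanish,
  -- contribute nothing.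
  refine Finset.sum_le_sum fun θ _ => ?_
  have hpi : 0 ≤ piLaw q θ := (isPMF_piLaw hq).nonneg θ
  rcases eq_or_ne (piLaw q θ) 0 with h0 | h0
  · simp [h0]
  rw [mul_div_assoc]
  refine mul_le_mul_of_nonneg_left ?_ hpi
  by_cases hE : ∏ i, ρ (θ i) < 2 ^ (n * (I - δ))
  · rw [ind_of_true hE, le_div_iff₀ (by positivity), one_mul]
    have hpos : ∀ i, 0 < ρ (θ i) := fun i => hρ _ fun hi => h0 (Finset.prod_eq_zero
      (Finset.mem_univ i) hi)
    have h1 : ∑ i, Real.logb 2 (ρ (θ i)) < n * (I - δ) := by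
      rw [← Real.logb_prod _ _ fun i _ => (hpos i).ne',
        Real.logb_lt_iff_lt_rpow one_lt_two (Finset.prod_pos fun i _ => hpos i)]
      exact hE
    have h2 : 1 / (n : ℝ) * ∑ i, Real.logb 2 (ρ (θ i)) - I < -δ := by
      have h3 := mul_lt_mul_of_pos_left h1 (show 0 < 1 / (n : ℝ) by positivity)
      have h4 : 1 / (n : ℝ) * (n * (I - δ)) = I - δ := by field_simp
      linarith
    nlinarith
  · rw [ind_of_false hE]
    positivity

theorem sum_arrow_prod [DecidableEq ι] [Fintype α] [Fintype β] (F : (ι → α × β) → ℝ) :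
    ∑ a : ι → α, ∑ b : ι → β, F (fun i => (a i, b i)) = ∑ c, F c := by
  rw [← Fintype.sum_prod_type' fun (a : ι → α) (b : ι → β) => F fun i => (a i, b i)]
  exact Fintype.sum_equiv (Equiv.arrowProdEquivProdArrow ι (fun _ => α) (fun _ => β)).symm
    _ _ fun _ => rfl

/-- The random-coding principle: some codebook is no worse than the average. -/
theorem exists_le_of_sum_mul_le {p G : κ → ℝ} (hp : IsPMF p) {B : ℝ} (h : ∑ x, p x * G x ≤ B) :
    ∃ x, G x ≤ B := by
  by_contra! hc
  obtain ⟨x, hx⟩ : ∃ x, p x ≠ 0 := by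
    by_contra! h0
    have := hp.sum_eq_one
    simp [h0] at this
  have h1 : ∑ x, p x * B < ∑ x, p x * G x :=
    Finset.sum_lt_sum (fun y _ => mul_le_mul_of_nonneg_left (hc y).le (hp.nonneg y))
      ⟨x, Finset.mem_univ x, mul_lt_mul_of_pos_left (hc x) ((hp.nonneg x).lt_of_ne' hx)⟩
  rw [← Finset.sum_mul, hp.sum_eq_one, one_mul] at h1
  linarith

end ProductLaw

/-- A threshold decoder errs only if the true codeword fails the test or a wrong one passes. -/
theorem ind_epsilon_ne_le {α : Type*} [Fintype α] [DecidableEq α] [Nonempty α] (π : α → ℝ)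
    (hπ : ∀ a, 0 ≤ π a) {γ : ℝ} (hγ : 0 < γ) (a : α) :
    ind (Classical.epsilon (fun b => γ ≤ π b) ≠ a) ≤
      ind (π a < γ) + ∑ b ∈ Finset.univ.erase a, π b / γ := by
  have hs : 0 ≤ ∑ b ∈ Finset.univ.erase a, π b / γ :=
    Finset.sum_nonneg fun b _ => div_nonneg (hπ b) hγ.le
  by_cases hE : Classical.epsilon (fun b => γ ≤ π b) = a
  · rw [ind_of_false (by simpa using hE)]
    exact add_nonneg (ind_nonneg _) hs
  rw [ind_of_true hE]
  by_cases h : π a < γ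
  · rw [ind_of_true h]
    linarith
  · have h1 : γ ≤ π (Classical.epsilon fun b => γ ≤ π b) :=
      Classical.epsilon_spec (p := fun b => γ ≤ π b) ⟨a, not_lt.1 h⟩
    have h2 := Finset.single_le_sum (f := fun b => π b / γ)
      (fun b _ => div_nonneg (hπ b) hγ.le) (Finset.mem_erase.2 ⟨hE, Finset.mem_univ _⟩)
    have h3 : 1 ≤ π (Classical.epsilon fun b => γ ≤ π b) / γ := (one_le_div hγ).2 h1
    linarith [ind_nonneg (π a < γ)]

/-! ### Superposition codes and random codebooks -/

section Superposition

variable {X Y₁ Y₂ Z S₁ S₂ T₁ T₂ U T : Type*} {n M₀ M₁ M₂ : ℕ}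

/-- A superposition code with cloud centers `cu`, satellites `ct`, and threshold decoders. -/
noncomputable def superpositionCode [Nonempty (Fin M₀ × Fin M₂)] [Nonempty (Fin M₁)]
    (f : U → T → X) (sh₁ : X → Z → T₁) (sh₂ : X → Z → T₂) (ρ₀ : U → Y₁ → S₁ → ℝ)
    (ρ₁ : U → T → Y₁ → S₁ → ℝ) (ρ₂ : U → Y₂ → S₂ → ℝ) (γ₀ γ₁ γ₂ : ℝ)
    (C : (Fin M₀ × Fin M₂ → Fin n → U) × (Fin M₁ → Fin n → T)) :
    Code X Y₁ Y₂ Z S₁ S₂ T₁ T₂ n M₀ M₁ M₂ where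
  enc i w _ := f (C.1 (w.1, w.2.2) i) (C.2 w.2.1 i)
  -- Receiver 1 decodes the whole cloud index, including W₂, then tests satellites on top of the
  -- decoded cloud and discards W₂.
  dec₁ s y :=
    ((Classical.epsilon fun v => γ₀ ≤ ∏ i, ρ₀ (C.1 v i) (y i) (s i)).1,
      Classical.epsilon fun w => γ₁ ≤ ∏ i, ρ₁
        (C.1 (Classical.epsilon fun v => γ₀ ≤ ∏ i, ρ₀ (C.1 v i) (y i) (s i)) i)
        (C.2 w i) (y i) (s i))
  dec₂ s y := Classical.epsilon fun v => γ₂ ≤ ∏ i, ρ₂ (C.1 v i) (y i) (s i)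
  est₁ x z i := sh₁ (x i) (z i)
  est₂ x z i := sh₂ (x i) (z i)

section Book

variable [Fintype U] [Fintype T] {V W : Type*} [Fintype V] [Fintype W]

/-- The law of two independent codebooks with independent and identically distributed letters. -/
noncomputable def bookLaw (PU : U → ℝ) (PT : T → ℝ) (C : (V → Fin n → U) × (W → Fin n → T)) : ℝ :=
  piLaw (piLaw PU) C.1 * piLaw (piLaw PT) C.2

variable {PU : U → ℝ} {PT : T → ℝ} [DecidableEq V] [DecidableEq W]

theorem isPMF_bookLaw (hU : IsPMF PU) (hT : IsPMF PT) :
    IsPMF (bookLaw PU PT : (V → Fin n → U) × (W → Fin n → T) → ℝ) where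
  nonneg C := mul_nonneg ((isPMF_piLaw (isPMF_piLaw hU)).nonneg _)
    ((isPMF_piLaw (isPMF_piLaw hT)).nonneg _)
  sum_eq_one := by
    simp only [bookLaw, Fintype.sum_prod_type, ← Finset.mul_sum,
      (isPMF_piLaw (isPMF_piLaw hT)).sum_eq_one, mul_one,
      (isPMF_piLaw (isPMF_piLaw hU)).sum_eq_one]

/-- Codewords that do not occur in the integrand sum out, leaving independent i.i.d. blocks. In the
two variants below a wrong codeword is a third independent block. -/
theorem sum_bookLaw_mul (hU : IsPMF PU) (hT : IsPMF PT) (v : V) (w : W)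
    (F : (Fin n → U) → (Fin n → T) → ℝ) :
    ∑ C, bookLaw PU PT C * F (C.1 v) (C.2 w) =
      ∑ u, piLaw PU u * ∑ t, piLaw PT t * F u t := by
  rw [← sum_piLaw_mul_apply (isPMF_piLaw hU) v, Fintype.sum_prod_type]
  refine Finset.sum_congr rfl fun cu _ => ?_
  rw [← sum_piLaw_mul_apply (isPMF_piLaw hT) w, Finset.mul_sum]
  exact Finset.sum_congr rfl fun ct _ => by simp only [bookLaw]; ring

theorem sum_bookLaw_mul_cloud (hU : IsPMF PU) (hT : IsPMF PT) {v v' : V} (hv : v' ≠ v) (w : W)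
    (F : (Fin n → U) → (Fin n → T) → (Fin n → U) → ℝ) :
    ∑ C, bookLaw PU PT C * F (C.1 v) (C.2 w) (C.1 v') =
      ∑ u, piLaw PU u * ∑ t, piLaw PT t * ∑ u', piLaw PU u' * F u t u' := by
  have h := sum_piLaw_mul_apply₂ (isPMF_piLaw hU) hv
    fun u u' => ∑ t, piLaw PT t * F u t u'
  have h1 : ∀ u, ∑ t : Fin n → T, piLaw PT t * ∑ u', piLaw PU u' * F u t u' =
      ∑ u', piLaw PU u' * ∑ t, piLaw PT t * F u t u' := by
    intro u
    simp only [Finset.mul_sum]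
    rw [Finset.sum_comm]
    exact Finset.sum_congr rfl fun _ _ => Finset.sum_congr rfl fun _ _ => by ring
  simp only [h1]
  rw [← h, Fintype.sum_prod_type]
  refine Finset.sum_congr rfl fun cu _ => ?_
  rw [← sum_piLaw_mul_apply (isPMF_piLaw hT) w, Finset.mul_sum]
  exact Finset.sum_congr rfl fun ct _ => by simp only [bookLaw]; ring

theorem sum_bookLaw_mul_satellite (hU : IsPMF PU) (hT : IsPMF PT) (v : V) {w w' : W} (hw : w' ≠ w)
    (F : (Fin n → U) → (Fin n → T) → (Fin n → T) → ℝ) :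
    ∑ C, bookLaw PU PT C * F (C.1 v) (C.2 w) (C.2 w') =
      ∑ u, piLaw PU u * ∑ t, piLaw PT t * ∑ t', piLaw PT t' * F u t t' := by
  rw [← sum_piLaw_mul_apply (isPMF_piLaw hU) v, Fintype.sum_prod_type]
  refine Finset.sum_congr rfl fun cu _ => ?_
  rw [← sum_piLaw_mul_apply₂ (isPMF_piLaw hT) hw, Finset.mul_sum]
  exact Finset.sum_congr rfl fun ct _ => by simp only [bookLaw]; ring

end Book

/-- The mean of a product over independent letters is the product of the means. The factors vary
with i because the output block is held fixed. -/
theorem sum_piLaw_mul_prod_le {κ : Type*} [Fintype κ] {q : κ → ℝ} (hq : IsPMF q)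
    (r : Fin n → κ → ℝ) (hr : ∀ i b, 0 ≤ r i b) (hr1 : ∀ i, ∑ b, q b * r i b ≤ 1) :
    ∑ a, piLaw q a * ∏ i, r i (a i) ≤ 1 := by
  simp only [piLaw, ← Finset.prod_mul_distrib]
  rw [← Fintype.prod_sum fun i b => q b * r i b]
  exact Finset.prod_le_one (fun i _ => Finset.sum_nonneg fun b _ =>
    mul_nonneg (hq.nonneg b) (hr i b)) fun i _ => hr1 i

variable [Fintype X] [Fintype Y₁] [Fintype Y₂] [Fintype Z] [Fintype S₁] [Fintype S₂] [Fintype U]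
  [Fintype T]

/-- The joint law of the cloud letter, the satellite letter, the states and the outputs. -/
noncomputable def letterLaw (ch : SDMBC X Y₁ Y₂ Z S₁ S₂) (f : U → T → X) (PU : U → ℝ) (PT : T → ℝ)
    (ξ : U × T × (S₁ × S₂) × (Y₁ × Y₂ × Z)) : ℝ :=
  PU ξ.1 * PT ξ.2.1 * ch.chanLaw (f ξ.1 ξ.2.1) ξ.2.2

variable {PU : U → ℝ} {PT : T → ℝ}

theorem sum_letterLaw_mul (ch : SDMBC X Y₁ Y₂ Z S₁ S₂) (f : U → T → X)
    (F : U → T → (S₁ × S₂) × (Y₁ × Y₂ × Z) → ℝ) :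
    ∑ ξ, ch.letterLaw f PU PT ξ * F ξ.1 ξ.2.1 ξ.2.2 =
      ∑ u, PU u * ∑ t, PT t * ∑ θ, ch.chanLaw (f u t) θ * F u t θ := by
  simp only [Fintype.sum_prod_type (α₁ := U), Fintype.sum_prod_type (α₁ := T), letterLaw,
    Finset.mul_sum]
  exact Finset.sum_congr rfl fun _ _ => Finset.sum_congr rfl fun _ _ =>
    Finset.sum_congr rfl fun _ _ => by ring

theorem isPMF_letterLaw (ch : SDMBC X Y₁ Y₂ Z S₁ S₂) (f : U → T → X) (hU : IsPMF PU)
    (hT : IsPMF PT) : IsPMF (ch.letterLaw f PU PT) where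
  nonneg ξ := mul_nonneg (mul_nonneg (hU.nonneg _) (hT.nonneg _)) (ch.chanLaw_nonneg _ _)
  sum_eq_one := by
    have := sum_letterLaw_mul (PU := PU) (PT := PT) ch f fun _ _ _ => 1
    simp only [mul_one, sum_chanLaw, hT.sum_eq_one, hU.sum_eq_one] at this
    exact this

/-- The law of a block of states and outputs given the input block. -/
noncomputable def blockChan (ch : SDMBC X Y₁ Y₂ Z S₁ S₂) (x : Fin n → X)
    (θ : Fin n → (S₁ × S₂) × (Y₁ × Y₂ × Z)) : ℝ :=
  ∏ i, ch.chanLaw (x i) (θ i)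

theorem blockChan_nonneg (ch : SDMBC X Y₁ Y₂ Z S₁ S₂) (x : Fin n → X)
    (θ : Fin n → (S₁ × S₂) × (Y₁ × Y₂ × Z)) : 0 ≤ ch.blockChan x θ :=
  Finset.prod_nonneg fun _ _ => ch.chanLaw_nonneg _ _

theorem sum_blockChan (ch : SDMBC X Y₁ Y₂ Z S₁ S₂) (x : Fin n → X) :
    ∑ θ, ch.blockChan x θ = 1 := by
  unfold blockChan
  rw [← Fintype.prod_sum fun i => ch.chanLaw (x i)]
  simp [sum_chanLaw]

theorem sum_piLaw_mul_blockChan (ch : SDMBC X Y₁ Y₂ Z S₁ S₂) (f : U → T → X)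
    (F : (Fin n → U × T × (S₁ × S₂) × (Y₁ × Y₂ × Z)) → ℝ) :
    ∑ u, piLaw PU u * ∑ t, piLaw PT t * ∑ θ, ch.blockChan (fun i => f (u i) (t i)) θ *
      F (fun i => (u i, t i, θ i)) = ∑ ξ, piLaw (ch.letterLaw f PU PT) ξ * F ξ := by
  rw [← sum_arrow_prod]
  refine Finset.sum_congr rfl fun u _ => ?_
  rw [← sum_arrow_prod, Finset.mul_sum]
  refine Finset.sum_congr rfl fun t _ => ?_
  rw [← mul_assoc, Finset.mul_sum]
  refine Finset.sum_congr rfl fun θ _ => ?_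
  simp only [piLaw, letterLaw, blockChan, Finset.prod_mul_distrib]
  ring

/-- A wrong cloud center rarely passes the threshold test. -/
theorem sum_blockChan_cloud_le (ch : SDMBC X Y₁ Y₂ Z S₁ S₂) (f : U → T → X) (hU : IsPMF PU)
    (hT : IsPMF PT) (r : U → (S₁ × S₂) × (Y₁ × Y₂ × Z) → ℝ) (hr : ∀ u θ, 0 ≤ r u θ)
    (hr1 : ∀ θ, ∑ u, PU u * r u θ ≤ 1) :
    ∑ u, piLaw PU u * ∑ t, piLaw PT t * ∑ u', piLaw PU u' *
      ∑ θ : Fin n → _, ch.blockChan (fun i => f (u i) (t i)) θ * ∏ i, r (u' i) (θ i) ≤ 1 := by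
  calc _ ≤ ∑ u : Fin n → U, piLaw PU u * ∑ t : Fin n → T, piLaw PT t * 1 := by
        refine Finset.sum_le_sum fun u _ => mul_le_mul_of_nonneg_left
          (Finset.sum_le_sum fun t _ => mul_le_mul_of_nonneg_left ?_
            ((isPMF_piLaw hT).nonneg t)) ((isPMF_piLaw hU).nonneg u)
        simp only [Finset.mul_sum]
        -- The wrong codeword is averaged first, with the output block fixed: whatever that block
        -- is, the test statistic has mean at most one.
        rw [Finset.sum_comm, ← ch.sum_blockChan fun i => f (u i) (t i)]
        refine Finset.sum_le_sum fun θ _ => ?_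
        have := sum_piLaw_mul_prod_le hU (fun i u => r u (θ i)) (fun i u => hr u _)
          fun i => hr1 (θ i)
        calc _ = ch.blockChan (fun i => f (u i) (t i)) θ *
              ∑ u', piLaw PU u' * ∏ i, r (u' i) (θ i) := by
              rw [Finset.mul_sum]
              exact Finset.sum_congr rfl fun _ _ => by ring
          _ ≤ _ := mul_le_of_le_one_right (ch.blockChan_nonneg _ _) this
    _ = 1 := by
        simp only [mul_one, (isPMF_piLaw hT).sum_eq_one, (isPMF_piLaw hU).sum_eq_one]

/-- A wrong satellite rarely passes the threshold test. -/
theorem sum_blockChan_satellite_le (ch : SDMBC X Y₁ Y₂ Z S₁ S₂) (f : U → T → X) (hU : IsPMF PU)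
    (hT : IsPMF PT) (r : U → T → (S₁ × S₂) × (Y₁ × Y₂ × Z) → ℝ) (hr : ∀ u t θ, 0 ≤ r u t θ)
    (hr1 : ∀ u θ, ∑ t, PT t * r u t θ ≤ 1) :
    ∑ u, piLaw PU u * ∑ t, piLaw PT t * ∑ t', piLaw PT t' *
      ∑ θ : Fin n → _, ch.blockChan (fun i => f (u i) (t i)) θ * ∏ i, r (u i) (t' i) (θ i) ≤ 1 := by
  calc _ ≤ ∑ u : Fin n → U, piLaw PU u * ∑ t : Fin n → T, piLaw PT t * 1 := by
        refine Finset.sum_le_sum fun u _ => mul_le_mul_of_nonneg_left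
          (Finset.sum_le_sum fun t _ => mul_le_mul_of_nonneg_left ?_
            ((isPMF_piLaw hT).nonneg t)) ((isPMF_piLaw hU).nonneg u)
        simp only [Finset.mul_sum]
        rw [Finset.sum_comm, ← ch.sum_blockChan fun i => f (u i) (t i)]
        refine Finset.sum_le_sum fun θ _ => ?_
        have := sum_piLaw_mul_prod_le hT (fun i t => r (u i) t (θ i)) (fun i t => hr _ t _)
          fun i => hr1 (u i) (θ i)
        calc _ = ch.blockChan (fun i => f (u i) (t i)) θ *
              ∑ t', piLaw PT t' * ∏ i, r (u i) (t' i) (θ i) := by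
              rw [Finset.mul_sum]
              exact Finset.sum_congr rfl fun _ _ => by ring
          _ ≤ _ := mul_le_of_le_one_right (ch.blockChan_nonneg _ _) this
    _ = 1 := by
        simp only [mul_one, (isPMF_piLaw hT).sum_eq_one, (isPMF_piLaw hU).sum_eq_one]

end Superposition

/-! ### Error analysis of random superposition codes -/

section Superposition

variable {X Y₁ Y₂ Z S₁ S₂ T₁ T₂ U T : Type*} {n M₀ M₁ M₂ : ℕ}
  [Fintype X] [Fintype Y₁] [Fintype Y₂] [Fintype Z] [Fintype S₁] [Fintype S₂]

/-- The error probability of a fixed superposition code, bounded through the threshold tests. -/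
theorem errorProb_superpositionCode_le [Nonempty (Fin M₀ × Fin M₂)] [Nonempty (Fin M₁)]
    (ch : SDMBC X Y₁ Y₂ Z S₁ S₂) (f : U → T → X) (sh₁ : X → Z → T₁) (sh₂ : X → Z → T₂)
    {ρ₀ : U → Y₁ → S₁ → ℝ} {ρ₁ : U → T → Y₁ → S₁ → ℝ} {ρ₂ : U → Y₂ → S₂ → ℝ}
    (hρ₀ : ∀ u y s, 0 ≤ ρ₀ u y s) (hρ₁ : ∀ u t y s, 0 ≤ ρ₁ u t y s) (hρ₂ : ∀ u y s, 0 ≤ ρ₂ u y s)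
    {γ₀ γ₁ γ₂ : ℝ} (hγ₀ : 0 < γ₀) (hγ₁ : 0 < γ₁) (hγ₂ : 0 < γ₂)
    (C : (Fin M₀ × Fin M₂ → Fin n → U) × (Fin M₁ → Fin n → T)) :
    (superpositionCode f sh₁ sh₂ ρ₀ ρ₁ ρ₂ γ₀ γ₁ γ₂ C).errorProb ch ≤
      ∑ w : Fin M₀ × Fin M₁ × Fin M₂, ((M₀ : ℝ) * M₁ * M₂)⁻¹ * ∑ θ,
        ch.blockChan (fun i => f (C.1 (w.1, w.2.2) i) (C.2 w.2.1 i)) θ *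
          ((ind (∏ i, ρ₀ (C.1 (w.1, w.2.2) i) (θ i).2.1 (θ i).1.1 < γ₀) +
            ∑ v ∈ Finset.univ.erase (w.1, w.2.2), (∏ i, ρ₀ (C.1 v i) (θ i).2.1 (θ i).1.1) / γ₀) +
          (ind (∏ i, ρ₁ (C.1 (w.1, w.2.2) i) (C.2 w.2.1 i) (θ i).2.1 (θ i).1.1 < γ₁) +
            ∑ w' ∈ Finset.univ.erase w.2.1,
              (∏ i, ρ₁ (C.1 (w.1, w.2.2) i) (C.2 w' i) (θ i).2.1 (θ i).1.1) / γ₁) +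
          (ind (∏ i, ρ₂ (C.1 (w.1, w.2.2) i) (θ i).2.2.1 (θ i).1.2 < γ₂) +
            ∑ v ∈ Finset.univ.erase (w.1, w.2.2),
              (∏ i, ρ₂ (C.1 v i) (θ i).2.2.1 (θ i).1.2) / γ₂)) := by
  set c := superpositionCode f sh₁ sh₂ ρ₀ ρ₁ ρ₂ γ₀ γ₁ γ₂ C with hc
  have h1 : c.errorProb ch = ∑ w : Fin M₀ × Fin M₁ × Fin M₂,
      ∑ θ, ((M₀ : ℝ) * M₁ * M₂)⁻¹ * (
        ch.blockChan (fun i => f (C.1 (w.1, w.2.2) i) (C.2 w.2.1 i)) θ *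
        ind (c.dec₁ (fun i => (θ i).1.1) (fun i => (θ i).2.1) ≠ (w.1, w.2.1) ∨
          c.dec₂ (fun i => (θ i).1.2) (fun i => (θ i).2.2.1) ≠ (w.1, w.2.2))) := by
    rw [← sum_outcome, Code.errorProb, prob_eq_sum_mul]
    refine Finset.sum_congr rfl fun ω _ => ?_
    rw [← mul_assoc]
    rfl
  rw [h1]
  simp only [Finset.mul_sum]
  refine Finset.sum_le_sum fun w _ => Finset.sum_le_sum fun θ _ => ?_
  refine mul_le_mul_of_nonneg_left (mul_le_mul_of_nonneg_left ?_ (ch.blockChan_nonneg _ _))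
    (by positivity)
  refine le_trans ?_ (add_le_add (add_le_add
    (ind_epsilon_ne_le (fun v => ∏ i, ρ₀ (C.1 v i) (θ i).2.1 (θ i).1.1)
      (fun v => Finset.prod_nonneg fun i _ => hρ₀ _ _ _) hγ₀ (w.1, w.2.2))
    (ind_epsilon_ne_le (fun w' => ∏ i, ρ₁ (C.1 (w.1, w.2.2) i) (C.2 w' i) (θ i).2.1 (θ i).1.1)
      (fun v => Finset.prod_nonneg fun i _ => hρ₁ _ _ _ _) hγ₁ w.2.1))
    (ind_epsilon_ne_le (fun v => ∏ i, ρ₂ (C.1 v i) (θ i).2.2.1 (θ i).1.2)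
      (fun v => Finset.prod_nonneg fun i _ => hρ₂ _ _ _) hγ₂ (w.1, w.2.2)))
  -- Once the cloud is decoded correctly, the satellite test runs on the true cloud; this is why the
  -- second bracket of the bound involves only the true cloud.
  by_cases h0 : Classical.epsilon (fun v => γ₀ ≤ ∏ i, ρ₀ (C.1 v i) (θ i).2.1 (θ i).1.1) =
      (w.1, w.2.2)
  · by_cases hE₁ : Classical.epsilon (fun w' => γ₁ ≤ ∏ i, ρ₁ (C.1 (w.1, w.2.2) i) (C.2 w' i)
        (θ i).2.1 (θ i).1.1) = w.2.1
    · by_cases hE₂ : Classical.epsilon (fun v => γ₂ ≤ ∏ i, ρ₂ (C.1 v i) (θ i).2.2.1 (θ i).1.2) =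
          (w.1, w.2.2)
      · rw [ind_of_false]
        · exact add_nonneg (add_nonneg (ind_nonneg _) (ind_nonneg _)) (ind_nonneg _)
        · rw [not_or, not_not, not_not]
          refine ⟨?_, hE₂⟩
          simp only [hc, superpositionCode]
          rw [h0, hE₁]
      · rw [ind_of_true hE₂]
        exact (ind_le_one _).trans (le_add_of_nonneg_left
          (add_nonneg (ind_nonneg _) (ind_nonneg _)))
    · rw [ind_of_true hE₁]
      refine (ind_le_one _).trans ?_
      rw [add_right_comm]
      exact le_add_of_nonneg_left (add_nonneg (ind_nonneg _) (ind_nonneg _))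
  · rw [ind_of_true h0]
    refine (ind_le_one _).trans ?_
    rw [add_assoc]
    exact le_add_of_nonneg_right (add_nonneg (ind_nonneg _) (ind_nonneg _))

/-- Expected distortion of a code without feedback whose estimator is symbol-by-symbol. -/
theorem Code.sum_expect_of_ignoresFeedback (c : Code X Y₁ Y₂ Z S₁ S₂ T₁ T₂ n M₀ M₁ M₂)
    (ch : SDMBC X Y₁ Y₂ Z S₁ S₂) (x : Fin M₀ × Fin M₁ × Fin M₂ → Fin n → X)
    (hx : ∀ w z i, c.inputs w z i = x w i) (h : X → (S₁ × S₂) × (Y₁ × Y₂ × Z) → ℝ) :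
    (1 / (n : ℝ)) * ∑ i, expect (c.blockLaw ch) (fun ω => h (c.inputs ω.1 ω.feedback i) (ω.at i)) =
      ((M₀ : ℝ) * M₁ * M₂)⁻¹ * ∑ w, (1 / (n : ℝ)) *
        ∑ i, ∑ θ, ch.chanLaw (x w i) θ * h (x w i) θ := by
  have h1 : ∀ i, expect (c.blockLaw ch) (fun ω => h (c.inputs ω.1 ω.feedback i) (ω.at i)) =
      ((M₀ : ℝ) * M₁ * M₂)⁻¹ * ∑ w, ∑ θ, ch.chanLaw (x w i) θ * h (x w i) θ := by
    intro i
    have h2 := c.sum_blockLaw_mul_at ch i (fun ω t => h (c.inputs ω.1 ω.feedback i) t)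
      (fun ω ω' e e' => by rw [c.inputs_congr i e e'])
    unfold expect
    rw [h2]
    simp only [hx]
    exact c.sum_blockLaw_mul_message ch fun w => ∑ θ, ch.chanLaw (x w i) θ * h (x w i) θ
  simp only [h1, ← Finset.mul_sum]
  rw [Finset.sum_comm]
  ring

variable [Fintype U] [Fintype T] {PU : U → ℝ} {PT : T → ℝ}

/-- By Chebyshev the true codeword rarely fails, and by Markov each of the |V| − 1 wrong ones passes
with probability at most the inverse threshold. Counting |V| − 1 exactly matters: with a single
message the second term vanishes, even if I = 0. -/
theorem sum_bookLaw_mul_cloud_error_le {V W : Type*} [Fintype V] [Fintype W] [DecidableEq V]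
    [DecidableEq W] (ch : SDMBC X Y₁ Y₂ Z S₁ S₂) (f : U → T → X) (hU : IsPMF PU) (hT : IsPMF PT)
    (hn : 0 < n) (r : U → (S₁ × S₂) × (Y₁ × Y₂ × Z) → ℝ) (hr : ∀ u θ, 0 ≤ r u θ)
    (hr1 : ∀ θ, ∑ u, PU u * r u θ ≤ 1)
    (hpos : ∀ ξ, ch.letterLaw f PU PT ξ ≠ 0 → 0 < r ξ.1 ξ.2.2) {I δ : ℝ}
    (hI : ∑ ξ, ch.letterLaw f PU PT ξ * Real.logb 2 (r ξ.1 ξ.2.2) = I) (hδ : 0 < δ)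
    (v : V) (w : W) :
    ∑ C, bookLaw PU PT C * ∑ θ, ch.blockChan (fun i : Fin n => f (C.1 v i) (C.2 w i)) θ *
        (ind (∏ i, r (C.1 v i) (θ i) < 2 ^ (n * (I - δ))) +
          ∑ v' ∈ Finset.univ.erase v, (∏ i, r (C.1 v' i) (θ i)) / 2 ^ (n * (I - δ))) ≤
      (∑ ξ, ch.letterLaw f PU PT ξ * (Real.logb 2 (r ξ.1 ξ.2.2) - I) ^ 2) / δ ^ 2 / n +
        ((Fintype.card V : ℝ) - 1) / 2 ^ (n * (I - δ)) := by
  set γ : ℝ := 2 ^ (n * (I - δ)) with hγ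
  have hγ0 : 0 < γ := by positivity
  have h1 := prob_prod_lt_le hn (ch.isPMF_letterLaw f hU hT) (fun ξ => r ξ.1 ξ.2.2) hpos hI hδ
  rw [← sum_piLaw_mul_blockChan ch f fun ξ => ind (∏ i, r (ξ i).1 (ξ i).2.2 < 2 ^ (n * (I - δ))),
    ← sum_bookLaw_mul hU hT v w fun u t => ∑ θ, ch.blockChan (fun i => f (u i) (t i)) θ *
      ind (∏ i, r (u i) (θ i) < 2 ^ (n * (I - δ)))] at h1
  have h2 : ∀ v' ∈ Finset.univ.erase v, ∑ C, bookLaw PU PT C * ∑ θ, ch.blockChan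
      (fun i : Fin n => f (C.1 v i) (C.2 w i)) θ * ((∏ i, r (C.1 v' i) (θ i)) / γ) ≤ 1 / γ := by
    intro v' hv'
    have h3 := sum_blockChan_cloud_le (n := n) ch f hU hT r hr hr1
    rw [← sum_bookLaw_mul_cloud hU hT (Finset.ne_of_mem_erase hv') w fun u t u' =>
      ∑ θ, ch.blockChan (fun i => f (u i) (t i)) θ * ∏ i, r (u' i) (θ i)] at h3
    refine le_trans (le_of_eq ?_) (div_le_div_of_nonneg_right h3 hγ0.le)
    simp only [Finset.sum_div, mul_div_assoc]
  have h4 := Finset.sum_le_sum h2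
  rw [Finset.sum_const, Finset.card_erase_of_mem (Finset.mem_univ v), Finset.card_univ,
    nsmul_eq_mul, Nat.cast_sub (Fintype.card_pos_iff.2 ⟨v⟩), Nat.cast_one, mul_one_div] at h4
  refine le_trans (le_of_eq ?_) (add_le_add h1 h4)
  rw [Finset.sum_comm, ← Finset.sum_add_distrib]
  refine Finset.sum_congr rfl fun C _ => ?_
  rw [← Finset.mul_sum, ← mul_add, Finset.sum_comm, ← Finset.sum_add_distrib]
  congr 1
  refine Finset.sum_congr rfl fun θ _ => ?_
  rw [← Finset.mul_sum, ← mul_add]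

/-- The same argument conditionally on the cloud, which the true and the wrong satellites share. -/
theorem sum_bookLaw_mul_satellite_error_le {V W : Type*} [Fintype V] [Fintype W] [DecidableEq V]
    [DecidableEq W] (ch : SDMBC X Y₁ Y₂ Z S₁ S₂) (f : U → T → X) (hU : IsPMF PU) (hT : IsPMF PT)
    (hn : 0 < n) (r : U → T → (S₁ × S₂) × (Y₁ × Y₂ × Z) → ℝ) (hr : ∀ u t θ, 0 ≤ r u t θ)
    (hr1 : ∀ u θ, ∑ t, PT t * r u t θ ≤ 1)
    (hpos : ∀ ξ, ch.letterLaw f PU PT ξ ≠ 0 → 0 < r ξ.1 ξ.2.1 ξ.2.2) {I δ : ℝ}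
    (hI : ∑ ξ, ch.letterLaw f PU PT ξ * Real.logb 2 (r ξ.1 ξ.2.1 ξ.2.2) = I) (hδ : 0 < δ)
    (v : V) (w : W) :
    ∑ C, bookLaw PU PT C * ∑ θ, ch.blockChan (fun i : Fin n => f (C.1 v i) (C.2 w i)) θ *
        (ind (∏ i, r (C.1 v i) (C.2 w i) (θ i) < 2 ^ (n * (I - δ))) +
          ∑ w' ∈ Finset.univ.erase w, (∏ i, r (C.1 v i) (C.2 w' i) (θ i)) / 2 ^ (n * (I - δ))) ≤
      (∑ ξ, ch.letterLaw f PU PT ξ * (Real.logb 2 (r ξ.1 ξ.2.1 ξ.2.2) - I) ^ 2) / δ ^ 2 / n +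
        ((Fintype.card W : ℝ) - 1) / 2 ^ (n * (I - δ)) := by
  set γ : ℝ := 2 ^ (n * (I - δ)) with hγ
  have hγ0 : 0 < γ := by positivity
  have h1 := prob_prod_lt_le hn (ch.isPMF_letterLaw f hU hT) (fun ξ => r ξ.1 ξ.2.1 ξ.2.2) hpos hI hδ
  rw [← sum_piLaw_mul_blockChan ch f fun ξ =>
      ind (∏ i, r (ξ i).1 (ξ i).2.1 (ξ i).2.2 < 2 ^ (n * (I - δ))),
    ← sum_bookLaw_mul hU hT v w fun u t => ∑ θ, ch.blockChan (fun i => f (u i) (t i)) θ *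
      ind (∏ i, r (u i) (t i) (θ i) < 2 ^ (n * (I - δ)))] at h1
  have h2 : ∀ w' ∈ Finset.univ.erase w, ∑ C, bookLaw PU PT C * ∑ θ, ch.blockChan
      (fun i : Fin n => f (C.1 v i) (C.2 w i)) θ * ((∏ i, r (C.1 v i) (C.2 w' i) (θ i)) / γ) ≤
        1 / γ := by
    intro w' hw'
    have h3 := sum_blockChan_satellite_le (n := n) ch f hU hT r hr hr1
    rw [← sum_bookLaw_mul_satellite hU hT v (Finset.ne_of_mem_erase hw') fun u t t' =>
      ∑ θ, ch.blockChan (fun i => f (u i) (t i)) θ * ∏ i, r (u i) (t' i) (θ i)] at h3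
    refine le_trans (le_of_eq ?_) (div_le_div_of_nonneg_right h3 hγ0.le)
    simp only [Finset.sum_div, mul_div_assoc]
  have h4 := Finset.sum_le_sum h2
  rw [Finset.sum_const, Finset.card_erase_of_mem (Finset.mem_univ w), Finset.card_univ,
    nsmul_eq_mul, Nat.cast_sub (Fintype.card_pos_iff.2 ⟨w⟩), Nat.cast_one, mul_one_div] at h4
  refine le_trans (le_of_eq ?_) (add_le_add h1 h4)
  rw [Finset.sum_comm, ← Finset.sum_add_distrib]
  refine Finset.sum_congr rfl fun C _ => ?_
  rw [← Finset.mul_sum, ← mul_add, Finset.sum_comm, ← Finset.sum_add_distrib]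
  congr 1
  refine Finset.sum_congr rfl fun θ _ => ?_
  rw [← Finset.mul_sum, ← mul_add]

end Superposition

/-- The squared deviation of an average is at most the average squared deviation. -/
theorem sq_average_sub_le {ι : Type*} [Fintype ι] [Nonempty ι] (a : ι → ℝ) (μ : ℝ) :
    ((Fintype.card ι : ℝ)⁻¹ * ∑ i, a i - μ) ^ 2 ≤
      (Fintype.card ι : ℝ)⁻¹ * ∑ i, (a i - μ) ^ 2 := by
  have hc : (0 : ℝ) < Fintype.card ι := by exact_mod_cast Fintype.card_pos
  have h := sq_sum_le_card_mul_sum_sq (s := Finset.univ) (f := fun i => a i - μ)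
  rw [Finset.card_univ] at h
  have h1 : (Fintype.card ι : ℝ)⁻¹ * ∑ i, a i - μ = (Fintype.card ι : ℝ)⁻¹ * ∑ i, (a i - μ) := by
    rw [Finset.sum_sub_distrib]
    simp only [Finset.sum_const, Finset.card_univ, nsmul_eq_mul]
    field_simp
  rw [h1, mul_pow, sq, mul_assoc]
  refine mul_le_mul_of_nonneg_left ?_ (by positivity)
  rw [inv_mul_le_iff₀ hc]
  exact h

/-! ### Random coding with simultaneous control of the distortions -/

section RandomCoding

variable {X Y₁ Y₂ Z S₁ S₂ T₁ T₂ U T : Type*} {n M₀ M₁ M₂ : ℕ}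
  [Fintype X] [Fintype Y₁] [Fintype Y₂] [Fintype Z] [Fintype S₁] [Fintype S₂] [Fintype U]
  [Fintype T] {PU : U → ℝ} {PT : T → ℝ}

theorem isPMF_prod (hU : IsPMF PU) (hT : IsPMF PT) :
    IsPMF (fun x : U × T => PU x.1 * PT x.2) where
  nonneg x := mul_nonneg (hU.nonneg _) (hT.nonneg _)
  sum_eq_one := by
    rw [Fintype.sum_prod_type]
    simp only [← Finset.mul_sum, hT.sum_eq_one, mul_one, hU.sum_eq_one]

/-- The second moment of the average of a single-letter cost over a random superposition code. -/
theorem sum_bookLaw_mul_average_sq_le (hU : IsPMF PU) (hT : IsPMF PT) (hn : 0 < n) (h₀ : 0 < M₀)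
    (h₁ : 0 < M₁) (h₂ : 0 < M₂) (g : U → T → ℝ) {μ : ℝ}
    (hμ : ∑ x : U × T, PU x.1 * PT x.2 * g x.1 x.2 = μ) :
    ∑ C : (Fin M₀ × Fin M₂ → Fin n → U) × (Fin M₁ → Fin n → T), bookLaw PU PT C *
        (((M₀ : ℝ) * M₁ * M₂)⁻¹ * ∑ w : Fin M₀ × Fin M₁ × Fin M₂, (1 / (n : ℝ)) *
          ∑ i, g (C.1 (w.1, w.2.2) i) (C.2 w.2.1 i) - μ) ^ 2 ≤
      (∑ x : U × T, PU x.1 * PT x.2 * (g x.1 x.2 - μ) ^ 2) / n := by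
  have : Nonempty (Fin M₀ × Fin M₁ × Fin M₂) := ⟨⟨0, h₀⟩, ⟨0, h₁⟩, ⟨0, h₂⟩⟩
  have hcard : (Fintype.card (Fin M₀ × Fin M₁ × Fin M₂) : ℝ) = (M₀ : ℝ) * M₁ * M₂ := by
    simp [mul_assoc]
  have hM : (M₀ : ℝ) * M₁ * M₂ ≠ 0 := by positivity
  have hw : ∀ w : Fin M₀ × Fin M₁ × Fin M₂,
      ∑ C : (Fin M₀ × Fin M₂ → Fin n → U) × (Fin M₁ → Fin n → T), bookLaw PU PT C *
        ((1 / (n : ℝ)) * ∑ i, g (C.1 (w.1, w.2.2) i) (C.2 w.2.1 i) - μ) ^ 2 =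
      (∑ x : U × T, PU x.1 * PT x.2 * (g x.1 x.2 - μ) ^ 2) / n := by
    intro w
    rw [sum_bookLaw_mul hU hT (w.1, w.2.2) w.2.1
      fun u t => ((1 / (n : ℝ)) * ∑ i, g (u i) (t i) - μ) ^ 2]
    have h := sum_piLaw_mul_sq hn (isPMF_prod hU hT) fun x => g x.1 x.2
    rw [hμ] at h
    rw [← h, ← sum_arrow_prod]
    refine Finset.sum_congr rfl fun u _ => ?_
    rw [Finset.mul_sum]
    refine Finset.sum_congr rfl fun t _ => ?_
    simp only [piLaw, Finset.prod_mul_distrib]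
    ring
  -- Messages share codewords, so their costs are dependent. Convexity of the square reduces to one
  -- message at a time, whose letters are i.i.d. pairs.
  calc _ ≤ ∑ C : (Fin M₀ × Fin M₂ → Fin n → U) × (Fin M₁ → Fin n → T), bookLaw PU PT C *
        (((M₀ : ℝ) * M₁ * M₂)⁻¹ * ∑ w : Fin M₀ × Fin M₁ × Fin M₂, ((1 / (n : ℝ)) *
          ∑ i, g (C.1 (w.1, w.2.2) i) (C.2 w.2.1 i) - μ) ^ 2) := by
        refine Finset.sum_le_sum fun C _ => mul_le_mul_of_nonneg_left ?_
          ((isPMF_bookLaw hU hT).nonneg C)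
        rw [← hcard]
        exact sq_average_sub_le _ _
    _ = ((M₀ : ℝ) * M₁ * M₂)⁻¹ * ∑ w : Fin M₀ × Fin M₁ × Fin M₂,
        ∑ C : (Fin M₀ × Fin M₂ → Fin n → U) × (Fin M₁ → Fin n → T), bookLaw PU PT C *
        ((1 / (n : ℝ)) * ∑ i, g (C.1 (w.1, w.2.2) i) (C.2 w.2.1 i) - μ) ^ 2 := by
        rw [Finset.sum_comm, Finset.mul_sum]
        refine Finset.sum_congr rfl fun C _ => ?_
        rw [← Finset.mul_sum]
        ring
    _ = _ := by
        simp only [hw, Finset.sum_const, Finset.card_univ, nsmul_eq_mul, hcard]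
        rw [inv_mul_cancel_left₀ hM]

/-- Random superposition coding with threshold decoders. -/
theorem exists_code_of_tests (ch : SDMBC X Y₁ Y₂ Z S₁ S₂) (f : U → T → X) (hU : IsPMF PU)
    (hT : IsPMF PT) (d₁ : S₁ → T₁ → ℝ) (d₂ : S₂ → T₂ → ℝ) (sh₁ : X → Z → T₁) (sh₂ : X → Z → T₂)
    {ρ₀ : U → Y₁ → S₁ → ℝ} {ρ₁ : U → T → Y₁ → S₁ → ℝ} {ρ₂ : U → Y₂ → S₂ → ℝ}
    (hρ₀ : ∀ u y s, 0 ≤ ρ₀ u y s) (hρ₁ : ∀ u t y s, 0 ≤ ρ₁ u t y s) (hρ₂ : ∀ u y s, 0 ≤ ρ₂ u y s)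
    (hs₀ : ∀ y s, ∑ u, PU u * ρ₀ u y s ≤ 1) (hs₁ : ∀ u y s, ∑ t, PT t * ρ₁ u t y s ≤ 1)
    (hs₂ : ∀ y s, ∑ u, PU u * ρ₂ u y s ≤ 1)
    (hpos₀ : ∀ ξ, ch.letterLaw f PU PT ξ ≠ 0 → 0 < ρ₀ ξ.1 ξ.2.2.2.1 ξ.2.2.1.1)
    (hpos₁ : ∀ ξ, ch.letterLaw f PU PT ξ ≠ 0 → 0 < ρ₁ ξ.1 ξ.2.1 ξ.2.2.2.1 ξ.2.2.1.1)
    (hpos₂ : ∀ ξ, ch.letterLaw f PU PT ξ ≠ 0 → 0 < ρ₂ ξ.1 ξ.2.2.2.2.1 ξ.2.2.1.2)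
    {I₀ I₁ I₂ δ : ℝ} (hδ : 0 < δ)
    (hI₀ : ∑ ξ, ch.letterLaw f PU PT ξ * Real.logb 2 (ρ₀ ξ.1 ξ.2.2.2.1 ξ.2.2.1.1) = I₀)
    (hI₁ : ∑ ξ, ch.letterLaw f PU PT ξ * Real.logb 2 (ρ₁ ξ.1 ξ.2.1 ξ.2.2.2.1 ξ.2.2.1.1) = I₁)
    (hI₂ : ∑ ξ, ch.letterLaw f PU PT ξ * Real.logb 2 (ρ₂ ξ.1 ξ.2.2.2.2.1 ξ.2.2.1.2) = I₂) :
    ∃ K : ℝ, ∀ n M₀ M₁ M₂ : ℕ, 0 < n → 0 < M₀ → 0 < M₁ → 0 < M₂ →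
      ∃ c : Code X Y₁ Y₂ Z S₁ S₂ T₁ T₂ n M₀ M₁ M₂, c.IgnoresFeedback ∧
        c.errorProb ch +
        (c.distortion₁ ch d₁ - ∑ ξ, ch.letterLaw f PU PT ξ *
          d₁ ξ.2.2.1.1 (sh₁ (f ξ.1 ξ.2.1) ξ.2.2.2.2.2)) ^ 2 +
        (c.distortion₂ ch d₂ - ∑ ξ, ch.letterLaw f PU PT ξ *
          d₂ ξ.2.2.1.2 (sh₂ (f ξ.1 ξ.2.1) ξ.2.2.2.2.2)) ^ 2 ≤
        K / n + ((M₀ : ℝ) * M₂ - 1) / 2 ^ (n * (I₀ - δ)) + ((M₁ : ℝ) - 1) / 2 ^ (n * (I₁ - δ)) +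
          ((M₀ : ℝ) * M₂ - 1) / 2 ^ (n * (I₂ - δ)) := by
  set E₁ := ∑ ξ, ch.letterLaw f PU PT ξ * d₁ ξ.2.2.1.1 (sh₁ (f ξ.1 ξ.2.1) ξ.2.2.2.2.2) with hE₁
  set E₂ := ∑ ξ, ch.letterLaw f PU PT ξ * d₂ ξ.2.2.1.2 (sh₂ (f ξ.1 ξ.2.1) ξ.2.2.2.2.2) with hE₂
  let g₁ : U → T → ℝ := fun u t => ∑ θ, ch.chanLaw (f u t) θ * d₁ θ.1.1 (sh₁ (f u t) θ.2.2.2)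
  let g₂ : U → T → ℝ := fun u t => ∑ θ, ch.chanLaw (f u t) θ * d₂ θ.1.2 (sh₂ (f u t) θ.2.2.2)
  have hg₁ : ∑ x : U × T, PU x.1 * PT x.2 * g₁ x.1 x.2 = E₁ := by
    rw [hE₁, sum_letterLaw_mul ch f fun u t θ => d₁ θ.1.1 (sh₁ (f u t) θ.2.2.2),
      Fintype.sum_prod_type]
    simp only [Finset.mul_sum, mul_assoc, g₁]
  have hg₂ : ∑ x : U × T, PU x.1 * PT x.2 * g₂ x.1 x.2 = E₂ := by
    rw [hE₂, sum_letterLaw_mul ch f fun u t θ => d₂ θ.1.2 (sh₂ (f u t) θ.2.2.2),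
      Fintype.sum_prod_type]
    simp only [Finset.mul_sum, mul_assoc, g₂]
  set K₀ := (∑ ξ, ch.letterLaw f PU PT ξ *
    (Real.logb 2 (ρ₀ ξ.1 ξ.2.2.2.1 ξ.2.2.1.1) - I₀) ^ 2) / δ ^ 2 with hK₀
  set K₁ := (∑ ξ, ch.letterLaw f PU PT ξ *
    (Real.logb 2 (ρ₁ ξ.1 ξ.2.1 ξ.2.2.2.1 ξ.2.2.1.1) - I₁) ^ 2) / δ ^ 2 with hK₁
  set K₂ := (∑ ξ, ch.letterLaw f PU PT ξ *
    (Real.logb 2 (ρ₂ ξ.1 ξ.2.2.2.2.1 ξ.2.2.1.2) - I₂) ^ 2) / δ ^ 2 with hK₂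
  set L₁ := ∑ x : U × T, PU x.1 * PT x.2 * (g₁ x.1 x.2 - E₁) ^ 2 with hL₁
  set L₂ := ∑ x : U × T, PU x.1 * PT x.2 * (g₂ x.1 x.2 - E₂) ^ 2 with hL₂
  -- The variances of the three log-likelihood ratios over δ² and of the two single-letter costs;
  -- none depends on the blocklength or on the numbers of messages.
  refine ⟨K₀ + K₁ + K₂ + L₁ + L₂, fun n M₀ M₁ M₂ hn h₀ h₁ h₂ => ?_⟩
  have hV : Nonempty (Fin M₀ × Fin M₂) := ⟨⟨0, h₀⟩, ⟨0, h₂⟩⟩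
  have hW : Nonempty (Fin M₁) := ⟨⟨0, h₁⟩⟩
  let γ : ℝ → ℝ := fun I => 2 ^ (n * (I - δ))
  have hγ : ∀ I, 0 < γ I := fun I => by positivity
  let c : (Fin M₀ × Fin M₂ → Fin n → U) × (Fin M₁ → Fin n → T) →
      Code X Y₁ Y₂ Z S₁ S₂ T₁ T₂ n M₀ M₁ M₂ :=
    superpositionCode f sh₁ sh₂ ρ₀ ρ₁ ρ₂ (γ I₀) (γ I₁) (γ I₂)
  have hM : (M₀ : ℝ) * M₁ * M₂ ≠ 0 := by positivity
  have hcard : (Fintype.card (Fin M₀ × Fin M₁ × Fin M₂) : ℝ) = (M₀ : ℝ) * M₁ * M₂ := by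
    simp [mul_assoc]
  have herr : ∑ C, bookLaw PU PT C * (c C).errorProb ch ≤
      K₀ / n + ((M₀ : ℝ) * M₂ - 1) / γ I₀ + (K₁ / n + ((M₁ : ℝ) - 1) / γ I₁) +
        (K₂ / n + ((M₀ : ℝ) * M₂ - 1) / γ I₂) := by
    refine (Finset.sum_le_sum fun C _ => mul_le_mul_of_nonneg_left
      (errorProb_superpositionCode_le ch f sh₁ sh₂ hρ₀ hρ₁ hρ₂ (hγ I₀) (hγ I₁) (hγ I₂) C)
      ((isPMF_bookLaw hU hT).nonneg C)).trans ?_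
    have hbound : ∀ w : Fin M₀ × Fin M₁ × Fin M₂, _ := fun w => add_le_add (add_le_add
      (sum_bookLaw_mul_cloud_error_le ch f hU hT hn (fun u θ => ρ₀ u θ.2.1 θ.1.1)
        (fun u θ => hρ₀ _ _ _) (fun θ => hs₀ _ _) hpos₀ hI₀ hδ (w.1, w.2.2) w.2.1)
      (sum_bookLaw_mul_satellite_error_le ch f hU hT hn (fun u t θ => ρ₁ u t θ.2.1 θ.1.1)
        (fun u t θ => hρ₁ _ _ _ _) (fun u θ => hs₁ _ _ _) hpos₁ hI₁ hδ (w.1, w.2.2) w.2.1))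
      (sum_bookLaw_mul_cloud_error_le ch f hU hT hn (fun u θ => ρ₂ u θ.2.2.1 θ.1.2)
        (fun u θ => hρ₂ _ _ _) (fun θ => hs₂ _ _) hpos₂ hI₂ hδ (w.1, w.2.2) w.2.1)
    have hsum := mul_le_mul_of_nonneg_left (Finset.sum_le_sum fun w
      (_ : w ∈ (Finset.univ : Finset (Fin M₀ × Fin M₁ × Fin M₂))) => hbound w)
      (show 0 ≤ ((M₀ : ℝ) * M₁ * M₂)⁻¹ by positivity)
    rw [Finset.sum_const, Finset.card_univ, nsmul_eq_mul, hcard, inv_mul_cancel_left₀ hM,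
      Fintype.card_prod, Fintype.card_fin, Fintype.card_fin, Fintype.card_fin,
      Nat.cast_mul] at hsum
    refine le_trans (le_of_eq ?_) hsum
    rw [Finset.mul_sum]
    simp only [Finset.mul_sum]
    rw [Finset.sum_comm]
    refine Finset.sum_congr rfl fun w _ => ?_
    simp only [← Finset.mul_sum, ← Finset.sum_add_distrib, ← mul_add]
    rw [Finset.mul_sum]
    exact Finset.sum_congr rfl fun C _ => by ring
  have hd₁ : ∑ C, bookLaw PU PT C * ((c C).distortion₁ ch d₁ - E₁) ^ 2 ≤ L₁ / n := by
    refine le_trans (le_of_eq ?_) (sum_bookLaw_mul_average_sq_le hU hT hn h₀ h₁ h₂ g₁ hg₁)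
    refine Finset.sum_congr rfl fun C _ => ?_
    congr 3
    exact (c C).sum_expect_of_ignoresFeedback ch
      (fun w i => f (C.1 (w.1, w.2.2) i) (C.2 w.2.1 i)) (fun _ _ _ => rfl)
      fun x θ => d₁ θ.1.1 (sh₁ x θ.2.2.2)
  have hd₂ : ∑ C, bookLaw PU PT C * ((c C).distortion₂ ch d₂ - E₂) ^ 2 ≤ L₂ / n := by
    refine le_trans (le_of_eq ?_) (sum_bookLaw_mul_average_sq_le hU hT hn h₀ h₁ h₂ g₂ hg₂)
    refine Finset.sum_congr rfl fun C _ => ?_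
    congr 3
    exact (c C).sum_expect_of_ignoresFeedback ch
      (fun w i => f (C.1 (w.1, w.2.2) i) (C.2 w.2.1 i)) (fun _ _ _ => rfl)
      fun x θ => d₂ θ.1.2 (sh₂ x θ.2.2.2)
  -- The three quantities are nonnegative, so bounding the mean of their sum makes one codebook good
  -- in all respects.
  obtain ⟨C, hC⟩ := exists_le_of_sum_mul_le
    (isPMF_bookLaw hU hT : IsPMF (bookLaw PU PT :
      (Fin M₀ × Fin M₂ → Fin n → U) × (Fin M₁ → Fin n → T) → ℝ))
    (G := fun C => (c C).errorProb ch + ((c C).distortion₁ ch d₁ - E₁) ^ 2 +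
      ((c C).distortion₂ ch d₂ - E₂) ^ 2) (B := _) (by
        simp only [mul_add, Finset.sum_add_distrib]
        exact add_le_add (add_le_add herr hd₁) hd₂)
  refine ⟨c C, fun _ _ _ _ => rfl, hC.trans (le_of_eq ?_)⟩
  simp only [add_div, γ]
  ring

end RandomCoding

/-- Under independent codewords the likelihood ratio has mean at most one. -/
theorem sum_mul_infoRatio_le_one {Ω α β γ : Type*} [Fintype Ω] [Fintype α] {p : Ω → ℝ}
    (hp : ∀ ω, 0 ≤ p ω) (A : Ω → α) (B : Ω → β) (C : Ω → γ) (w : α → ℝ) (b : β) (c : γ)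
    (hw : ∀ a, prob p (fun ω => A ω = a ∧ C ω = c) = w a * prob p (fun ω => C ω = c)) :
    ∑ a, w a * infoRatio p A B C a b c ≤ 1 := by
  calc _ ≤ ∑ a, prob p (fun ω => A ω = a ∧ B ω = b ∧ C ω = c) /
        prob p (fun ω => B ω = b ∧ C ω = c) := by
        refine Finset.sum_le_sum fun a _ => ?_
        have h0 : 0 ≤ prob p (fun ω => A ω = a ∧ B ω = b ∧ C ω = c) /
            prob p (fun ω => B ω = b ∧ C ω = c) := div_nonneg (prob_nonneg hp _) (prob_nonneg hp _)
        unfold infoRatio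
        rw [hw]
        rcases eq_or_ne (w a * prob p fun ω => C ω = c) 0 with h | h
        · simpa [h] using h0
        · refine le_of_eq ?_
          have h1 := left_ne_zero_of_mul h
          have h2 := right_ne_zero_of_mul h
          rcases eq_or_ne (prob p fun ω => B ω = b ∧ C ω = c) 0 with h3 | h3
          · simp [h3]
          · field_simp
    _ = prob p (fun ω => B ω = b ∧ C ω = c) / prob p (fun ω => B ω = b ∧ C ω = c) := by
        rw [← Finset.sum_div, sum_prob_and]
    _ ≤ 1 := div_self_le_one _

/-! ### Achievability of the single-letter set -/

section Achievability

variable {X Y₁ Y₂ Z S₁ S₂ T₁ T₂ : Type*} [Fintype X] [Fintype Y₁] [Fintype Y₂] [Fintype Z]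
    [Fintype S₁] [Fintype S₂]

theorem prob_singleLetterLaw_input {U : Type*} [Fintype U] (ch : SDMBC X Y₁ Y₂ Z S₁ S₂)
    (PUX : stdSimplex ℝ (U × X)) (G : U × X → Prop) :
    prob (ch.singleLetterLaw PUX) (fun ω => G ω.1) = prob PUX.1 G := by
  rw [prob_eq_sum_mul, prob_eq_sum_mul, sum_singleLetterLaw_mul ch PUX fun v _ => ind (G v)]
  simp only [← Finset.sum_mul, sum_PS, one_mul]

/-- Every joint law of `(U, X)` on a finite alphabet is the law of `(U, T U)` for a random function
`T` that is independent of `U`. -/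
theorem exists_functional_representation {U : Type*} [Fintype U] [DecidableEq U]
    (PUX : stdSimplex ℝ (U × X)) :
    ∃ (PU : U → ℝ) (W : U → X → ℝ) (PT : (U → X) → ℝ), IsPMF PU ∧ IsPMF PT ∧
      (∀ u, PU u = prob PUX.1 fun v => v.1 = u) ∧
      (∀ u x, PU u * W u x = PUX.1 (u, x)) ∧
      (∀ t, PT t = ∏ u, W u (t u)) ∧
      ∀ u (h : X → ℝ), ∑ t, PT t * h (t u) = ∑ x, W u x * h x := by
  classical
  have hX : Nonempty X := by
    by_contra hX
    have := not_nonempty_iff.1 hX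
    have h := PUX.2.2
    simp at h
  obtain ⟨x₀⟩ := hX
  have hPUX : IsPMF PUX.1 := ⟨PUX.2.1, PUX.2.2⟩
  let PU : U → ℝ := fun u => prob PUX.1 fun v => v.1 = u
  have hsum : ∀ u, ∑ x, PUX.1 (u, x) = PU u := by
    intro u
    simp only [PU]
    rw [prob_eq_sum_mul, Fintype.sum_prod_type, Finset.sum_eq_single u]
    · simp
    · intro u' _ hu'
      simp [hu']
    · simp
  -- The conditional law of X given U = u, set to a point mass where P(u) = 0 so that each `W u` is
  -- a probability law and the product over u is normalized.
  let W : U → X → ℝ := fun u x =>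
    if PU u = 0 then (if x = x₀ then 1 else 0) else PUX.1 (u, x) / PU u
  have hPU : IsPMF PU := hPUX.law Prod.fst
  have hW : ∀ u, IsPMF (W u) := by
    intro u
    by_cases h : PU u = 0
    · refine ⟨fun x => ?_, ?_⟩
      · simp only [W, h, if_true]
        split_ifs <;> norm_num
      · simp [W, h]
    · refine ⟨fun x => ?_, ?_⟩
      · simp only [W, h, if_false]
        exact div_nonneg (PUX.2.1 _) (hPU.nonneg u)
      · simp only [W, h, if_false]
        rw [← Finset.sum_div, hsum, div_self h]
  have key : ∀ u (h : X → ℝ), ∑ t : U → X, (∏ u, W u (t u)) * h (t u) = ∑ x, W u x * h x := by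
    intro u h
    rw [sum_pi_prod_mul_apply W u h, Finset.prod_eq_one fun u _ => (hW u).sum_eq_one, one_mul]
  refine ⟨PU, W, fun t => ∏ u, W u (t u), hPU, ⟨fun t => Finset.prod_nonneg fun u _ =>
    (hW u).nonneg _, ?_⟩, fun _ => rfl, fun u x => ?_, fun _ => rfl, key⟩
  · rw [← Fintype.prod_sum fun u x => W u x]
    exact Finset.prod_eq_one fun u _ => (hW u).sum_eq_one
  · by_cases h : PU u = 0
    · rw [h, zero_mul]
      have h1 := hsum u
      rw [h, Finset.sum_eq_zero_iff_of_nonneg fun x _ => PUX.2.1 _] at h1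
      exact (h1 x (Finset.mem_univ x)).symm
    · simp only [W, h, if_false]
      rw [mul_div_cancel₀ _ h]

/-- The satellite letter is a function t : U → X, sent through `f u t = t u`, and the tests use the
information densities. (U, T(U)) has the prescribed law, so the means are the mutual informations
and expected distortions of the single-letter law. The cloud information I₀ of receiver 1 is still
separate; no degradedness enters here. -/
theorem exists_code_of_singleLetter {U : Type*} [Fintype U] (ch : SDMBC X Y₁ Y₂ Z S₁ S₂)
    (PUX : stdSimplex ℝ (U × X)) (d₁ : S₁ → T₁ → ℝ) (d₂ : S₂ → T₂ → ℝ)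
    (sh₁ : X → Z → T₁) (sh₂ : X → Z → T₂) {I₀ I₁ I₂ E₁ E₂ δ : ℝ} (hδ : 0 < δ)
    (hI₀ : condMutualInfo (ch.singleLetterLaw PUX)
      (fun ω => ω.1.1) (fun ω => ω.2.2.1) (fun ω => ω.2.1.1) = I₀)
    (hI₁ : condMutualInfo (ch.singleLetterLaw PUX)
      (fun ω => ω.1.2) (fun ω => ω.2.2.1) (fun ω => (ω.1.1, ω.2.1.1)) = I₁)
    (hI₂ : condMutualInfo (ch.singleLetterLaw PUX)
      (fun ω => ω.1.1) (fun ω => ω.2.2.2.1) (fun ω => ω.2.1.2) = I₂)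
    (hE₁ : expect (ch.singleLetterLaw PUX) (fun ω => d₁ ω.2.1.1 (sh₁ ω.1.2 ω.2.2.2.2)) = E₁)
    (hE₂ : expect (ch.singleLetterLaw PUX) (fun ω => d₂ ω.2.1.2 (sh₂ ω.1.2 ω.2.2.2.2)) = E₂) :
    ∃ K : ℝ, ∀ n M₀ M₁ M₂ : ℕ, 0 < n → 0 < M₀ → 0 < M₁ → 0 < M₂ →
      ∃ c : Code X Y₁ Y₂ Z S₁ S₂ T₁ T₂ n M₀ M₁ M₂, c.IgnoresFeedback ∧
        c.errorProb ch + (c.distortion₁ ch d₁ - E₁) ^ 2 + (c.distortion₂ ch d₂ - E₂) ^ 2 ≤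
        K / n + ((M₀ : ℝ) * M₂ - 1) / 2 ^ (n * (I₀ - δ)) + ((M₁ : ℝ) - 1) / 2 ^ (n * (I₁ - δ)) +
          ((M₀ : ℝ) * M₂ - 1) / 2 ^ (n * (I₂ - δ)) := by
  classical
  obtain ⟨PU, W, PT, hU, hT, hPU, hW, hPT, hmarg⟩ := exists_functional_representation PUX
  have hp := isPMF_singleLetterLaw ch PUX
  let f : U → (U → X) → X := fun u t => t u
  have hlaw : ∀ F : U × X → S₁ × S₂ → Y₁ × Y₂ × Z → ℝ,
      ∑ ξ, ch.letterLaw f PU PT ξ * F (ξ.1, ξ.2.1 ξ.1) ξ.2.2.1 ξ.2.2.2 =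
        ∑ ω, ch.singleLetterLaw PUX ω * F ω.1 ω.2.1 ω.2.2 := by
    intro F
    rw [sum_letterLaw_mul ch f fun u t θ => F (u, t u) θ.1 θ.2, Fintype.sum_prod_type,
      Fintype.sum_prod_type]
    refine Finset.sum_congr rfl fun u _ => ?_
    rw [hmarg u fun x => ∑ θ, ch.chanLaw x θ * F (u, x) θ.1 θ.2, Finset.mul_sum]
    refine Finset.sum_congr rfl fun x _ => ?_
    rw [← mul_assoc, hW, Finset.mul_sum]
    exact Finset.sum_congr rfl fun θ _ => by simp only [chanLaw, singleLetterLaw]; ring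
  have hne : ∀ ξ, ch.letterLaw f PU PT ξ ≠ 0 →
      ch.singleLetterLaw PUX ((ξ.1, ξ.2.1 ξ.1), ξ.2.2.1, ξ.2.2.2) ≠ 0 := by
    intro ξ hξ
    have h1 : PU ξ.1 ≠ 0 := left_ne_zero_of_mul (left_ne_zero_of_mul hξ)
    have h2 : PT ξ.2.1 ≠ 0 := right_ne_zero_of_mul (left_ne_zero_of_mul hξ)
    have h3 : ch.chanLaw (ξ.2.1 ξ.1) ξ.2.2 ≠ 0 := right_ne_zero_of_mul hξ
    have h4 : W ξ.1 (ξ.2.1 ξ.1) ≠ 0 := by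
      rw [hPT] at h2
      exact Finset.prod_ne_zero_iff.1 h2 ξ.1 (Finset.mem_univ _)
    have h5 : ch.singleLetterLaw PUX ((ξ.1, ξ.2.1 ξ.1), ξ.2.2.1, ξ.2.2.2) =
        PU ξ.1 * W ξ.1 (ξ.2.1 ξ.1) * ch.chanLaw (ξ.2.1 ξ.1) ξ.2.2 := by
      simp only [hW, singleLetterLaw, chanLaw, mul_assoc]
    rw [h5]
    exact mul_ne_zero (mul_ne_zero h1 h4) h3
  have hcloud : ∀ (u : U) (E : S₁ × S₂ → Prop),
      prob (ch.singleLetterLaw PUX) (fun ω => ω.1.1 = u ∧ E ω.2.1) =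
        PU u * prob (ch.singleLetterLaw PUX) (fun ω => E ω.2.1) := by
    intro u E
    have h1 := prob_state_and ch PUX E fun v => v.1 = u
    have h2 := prob_state_and ch PUX E fun _ => True
    rw [prob_singleLetterLaw_input ch PUX fun v => v.1 = u, ← hPU] at h1
    rw [prob_singleLetterLaw_input ch PUX fun _ => True] at h2
    have h3 : prob PUX.1 (fun _ => True) = 1 := by simpa [prob] using PUX.2.2
    rw [h3, one_mul] at h2
    rw [prob_congr _ fun ω => and_comm, h1, ← h2]
    simp
  have hsat : ∀ (u : U) (s : S₁) (x : X),
      prob (ch.singleLetterLaw PUX) (fun ω => ω.1.2 = x ∧ (ω.1.1, ω.2.1.1) = (u, s)) =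
        W u x * prob (ch.singleLetterLaw PUX) (fun ω => (ω.1.1, ω.2.1.1) = (u, s)) := by
    intro u s x
    have h1 := prob_state_and ch PUX (fun s' => s'.1 = s) fun v => v = (u, x)
    have h2 := prob_state_and ch PUX (fun s' => s'.1 = s) fun v => v.1 = u
    have h3 : prob PUX.1 (fun v => v = (u, x)) = PUX.1 (u, x) := by
      unfold prob
      exact (Finset.sum_eq_single (u, x) (fun v _ hv => if_neg hv) fun h =>
        absurd (Finset.mem_univ _) h).trans (if_pos rfl)
    rw [prob_singleLetterLaw_input ch PUX fun v => v = (u, x), h3, ← hW] at h1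
    rw [prob_singleLetterLaw_input ch PUX fun v => v.1 = u, ← hPU] at h2
    rw [prob_congr (ch.singleLetterLaw PUX) (F := fun ω => ω.2.1.1 = s ∧ ω.1 = (u, x)), h1,
      prob_congr (ch.singleLetterLaw PUX) (F := fun ω => ω.2.1.1 = s ∧ ω.1.1 = u), h2]
    · ring
    · intro ω
      simp only [Prod.mk.injEq]
      tauto
    · intro ω
      simp only [Prod.ext_iff]
      tauto
  have hmean₀ := hlaw fun v s o => Real.logb 2 (infoRatio (ch.singleLetterLaw PUX)
    (fun ω => ω.1.1) (fun ω => ω.2.2.1) (fun ω => ω.2.1.1) v.1 o.1 s.1)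
  have hmean₁ := hlaw fun v s o => Real.logb 2 (infoRatio (ch.singleLetterLaw PUX)
    (fun ω => ω.1.2) (fun ω => ω.2.2.1) (fun ω => (ω.1.1, ω.2.1.1)) v.2 o.1 (v.1, s.1))
  have hmean₂ := hlaw fun v s o => Real.logb 2 (infoRatio (ch.singleLetterLaw PUX)
    (fun ω => ω.1.1) (fun ω => ω.2.2.2.1) (fun ω => ω.2.1.2) v.1 o.2.1 s.2)
  rw [← condMutualInfo_eq_sum, hI₀] at hmean₀
  rw [← condMutualInfo_eq_sum, hI₁] at hmean₁
  rw [← condMutualInfo_eq_sum, hI₂] at hmean₂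
  have h := exists_code_of_tests (T₁ := T₁) (T₂ := T₂) ch f hU hT d₁ d₂ sh₁ sh₂
    (ρ₀ := fun u y s => infoRatio (ch.singleLetterLaw PUX)
      (fun ω => ω.1.1) (fun ω => ω.2.2.1) (fun ω => ω.2.1.1) u y s)
    (ρ₁ := fun u t y s => infoRatio (ch.singleLetterLaw PUX)
      (fun ω => ω.1.2) (fun ω => ω.2.2.1) (fun ω => (ω.1.1, ω.2.1.1)) (t u) y (u, s))
    (ρ₂ := fun u y s => infoRatio (ch.singleLetterLaw PUX)
      (fun ω => ω.1.1) (fun ω => ω.2.2.2.1) (fun ω => ω.2.1.2) u y s)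
    (fun _ _ _ => infoRatio_nonneg hp.nonneg _ _ _ _ _ _)
    (fun _ _ _ _ => infoRatio_nonneg hp.nonneg _ _ _ _ _ _)
    (fun _ _ _ => infoRatio_nonneg hp.nonneg _ _ _ _ _ _)
    (fun y s => sum_mul_infoRatio_le_one hp.nonneg _ _ _ _ _ _ fun u =>
      hcloud u fun s' => s'.1 = s)
    (fun u y s => by
      rw [hmarg u fun x => infoRatio (ch.singleLetterLaw PUX)
        (fun ω => ω.1.2) (fun ω => ω.2.2.1) (fun ω => (ω.1.1, ω.2.1.1)) x y (u, s)]
      exact sum_mul_infoRatio_le_one hp.nonneg _ _ _ _ _ _ fun x => hsat u s x)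
    (fun y s => sum_mul_infoRatio_le_one hp.nonneg _ _ _ _ _ _ fun u =>
      hcloud u fun s' => s'.2 = s)
    (fun ξ hξ => infoRatio_pos hp.nonneg (fun ω => ω.1.1) (fun ω => ω.2.2.1)
      (fun ω => ω.2.1.1) (hne ξ hξ))
    (fun ξ hξ => infoRatio_pos hp.nonneg (fun ω => ω.1.2) (fun ω => ω.2.2.1)
      (fun ω => (ω.1.1, ω.2.1.1)) (hne ξ hξ))
    (fun ξ hξ => infoRatio_pos hp.nonneg (fun ω => ω.1.1) (fun ω => ω.2.2.2.1)
      (fun ω => ω.2.1.2) (hne ξ hξ)) hδ hmean₀ hmean₁ hmean₂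
  have hd₁ := hlaw fun v s o => d₁ s.1 (sh₁ v.2 o.2.2)
  have hd₂ := hlaw fun v s o => d₂ s.2 (sh₂ v.2 o.2.2)
  rw [← hE₁, ← hE₂]
  unfold expect
  rw [← hd₁, ← hd₂]
  exact h

theorem numMessages_zero (n : ℕ) : numMessages n 0 = 1 := by
  simp [numMessages]

theorem numMessages_le (n : ℕ) (R : ℝ) : (numMessages n R : ℝ) ≤ 2 ^ (n * R) :=
  Nat.floor_le (by positivity)

/-- Of the margin 2δ, one δ pays for the lowered threshold and the other gives the exponential
decay. With M = 1 there is no wrong codeword and no margin is needed. -/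
theorem sub_one_div_rpow_le (n : ℕ) {M r I δ : ℝ}
    (h : M = 1 ∨ M ≤ 2 ^ (n * r) ∧ r + 2 * δ ≤ I) :
    (M - 1) / 2 ^ (n * (I - δ)) ≤ ((2 : ℝ) ^ (-δ)) ^ n := by
  rcases h with h | ⟨h, h'⟩
  · rw [h, sub_self, zero_div]
    positivity
  · rw [← Real.rpow_natCast, ← Real.rpow_mul two_pos.le, div_le_iff₀ (by positivity),
      ← Real.rpow_add two_pos]
    have h1 : (2 : ℝ) ^ (n * r) ≤ 2 ^ (-δ * n + n * (I - δ)) := by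
      refine Real.rpow_le_rpow_of_exponent_le one_le_two ?_
      nlinarith [(Nat.cast_nonneg n : (0 : ℝ) ≤ n)]
    linarith

theorem exists_margin {r I : ℝ} (h : r = 0 ∨ r < I) :
    ∃ δ > 0, ∀ δ' ≤ δ, r = 0 ∨ r + 2 * δ' ≤ I := by
  rcases h with h | h
  · exact ⟨1, one_pos, fun _ _ => Or.inl h⟩
  · exact ⟨(I - r) / 2, by linarith, fun δ' hδ' => Or.inr (by linarith)⟩

theorem tendsto_of_sq_sub_le {x B : ℕ → ℝ} {E : ℝ} (hB : Tendsto B atTop (𝓝 0))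
    (h : ∀ᶠ n in atTop, (x n - E) ^ 2 ≤ B n) : Tendsto x atTop (𝓝 E) := by
  have h1 : Tendsto (fun n => (x n - E) ^ 2) atTop (𝓝 0) :=
    squeeze_zero' (Eventually.of_forall fun n => sq_nonneg _) h hB
  have h2 := h1.sqrt
  simp only [Real.sqrt_sq_eq_abs, Real.sqrt_zero] at h2
  have h3 := (tendsto_zero_iff_abs_tendsto_zero _).2 h2
  simpa using h3.add_const E

/-- The alternative of rate zero covers the case where the mutual information vanishes and no strict
inequality is available. -/
theorem mem_achievableIgnoringFeedback (ch : SDMBC X Y₁ Y₂ Z S₁ S₂) (hdeg : ch.PhysicallyDegraded)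
    {U : Type*} [Fintype U] (PUX : stdSimplex ℝ (U × X)) (d₁ : S₁ → T₁ → ℝ) (d₂ : S₂ → T₂ → ℝ)
    (sh₁ : X → Z → T₁) (sh₂ : X → Z → T₂) {R₀ R₁ R₂ D₁ D₂ : ℝ}
    (hR₀ : 0 ≤ R₀) (hR₁ : 0 ≤ R₁) (hR₂ : 0 ≤ R₂)
    (hI₁ : R₁ = 0 ∨ R₁ < condMutualInfo (ch.singleLetterLaw PUX)
      (fun ω => ω.1.2) (fun ω => ω.2.2.1) (fun ω => (ω.1.1, ω.2.1.1)))
    (hI₂ : R₀ + R₂ = 0 ∨ R₀ + R₂ < condMutualInfo (ch.singleLetterLaw PUX)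
      (fun ω => ω.1.1) (fun ω => ω.2.2.2.1) (fun ω => ω.2.1.2))
    (hD₁ : expect (ch.singleLetterLaw PUX) (fun ω => d₁ ω.2.1.1 (sh₁ ω.1.2 ω.2.2.2.2)) ≤ D₁)
    (hD₂ : expect (ch.singleLetterLaw PUX) (fun ω => d₂ ω.2.1.2 (sh₂ ω.1.2 ω.2.2.2.2)) ≤ D₂) :
    (R₀, R₁, R₂, D₁, D₂) ∈ ch.achievableIgnoringFeedback d₁ d₂ := by
  have hI₀₂ := mutualInfo_cloud_le ch hdeg PUX
  obtain ⟨δ₁, hδ₁, hm₁⟩ := exists_margin hI₁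
  obtain ⟨δ₂, hδ₂, hm₂⟩ := exists_margin hI₂
  set δ := min δ₁ δ₂ with hδdef
  have hδ : 0 < δ := lt_min hδ₁ hδ₂
  obtain ⟨K, hK⟩ := exists_code_of_singleLetter ch PUX d₁ d₂ sh₁ sh₂ hδ rfl rfl rfl rfl rfl
  -- One exponential term for each of the three tests.
  let B : ℕ → ℝ := fun n => K / n + 3 * ((2 : ℝ) ^ (-δ)) ^ n
  have hB : Tendsto B atTop (𝓝 0) := by
    have h1 : (2 : ℝ) ^ (-δ) < 1 := Real.rpow_lt_one_of_one_lt_of_neg one_lt_two (by linarith)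
    have h2 := (tendsto_pow_atTop_nhds_zero_of_lt_one (by positivity) h1).const_mul 3
    simpa using (tendsto_const_div_atTop_nhds_zero_nat K).add h2
  have hcode : ∀ n : ℕ, ∃ c : Code X Y₁ Y₂ Z S₁ S₂ T₁ T₂ n (numMessages n R₀) (numMessages n R₁)
      (numMessages n R₂), c.IgnoresFeedback ∧ (0 < n → c.errorProb ch +
        (c.distortion₁ ch d₁ - expect (ch.singleLetterLaw PUX)
          (fun ω => d₁ ω.2.1.1 (sh₁ ω.1.2 ω.2.2.2.2))) ^ 2 +
        (c.distortion₂ ch d₂ - expect (ch.singleLetterLaw PUX)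
          (fun ω => d₂ ω.2.1.2 (sh₂ ω.1.2 ω.2.2.2.2))) ^ 2 ≤ B n) := by
    intro n
    have hM₀ := numMessages_pos n hR₀
    have hM₁ := numMessages_pos n hR₁
    have hM₂ := numMessages_pos n hR₂
    -- A code sequence must have a term at blocklength 0; any code serves there.
    rcases Nat.eq_zero_or_pos n with rfl | hn
    · exact ⟨⟨fun i => i.elim0, fun _ _ => (⟨0, hM₀⟩, ⟨0, hM₁⟩), fun _ _ => (⟨0, hM₀⟩, ⟨0, hM₂⟩),
        fun _ _ i => i.elim0, fun _ _ i => i.elim0⟩, fun i => i.elim0,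
        fun h => absurd h (lt_irrefl 0)⟩
    · obtain ⟨c, hc, hb⟩ := hK n _ _ _ hn hM₀ hM₁ hM₂
      refine ⟨c, hc, fun _ => hb.trans ?_⟩
      have h₁ : (numMessages n R₁ : ℝ) = 1 ∨ (numMessages n R₁ : ℝ) ≤ 2 ^ (n * R₁) ∧ _ :=
        (hm₁ δ (min_le_left _ _)).imp (fun h => by rw [h, numMessages_zero, Nat.cast_one])
          fun h => ⟨numMessages_le n R₁, h⟩
      have h₂ : (numMessages n R₀ : ℝ) * numMessages n R₂ = 1 ∨
          (numMessages n R₀ : ℝ) * numMessages n R₂ ≤ 2 ^ (n * (R₀ + R₂)) ∧ _ :=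
        (hm₂ δ (min_le_right _ _)).imp (fun h => by
          have h0 : R₀ = 0 := by linarith
          have h2 : R₂ = 0 := by linarith
          rw [h0, h2, numMessages_zero]
          simp) fun h => ⟨by
            rw [mul_add, Real.rpow_add two_pos]
            exact mul_le_mul (numMessages_le n R₀) (numMessages_le n R₂) (Nat.cast_nonneg _)
              (by positivity), h⟩
      -- Degradedness: a cloud rate that receiver 2 can decode is also decodable by receiver 1.
      have h₀ := h₂.imp_right fun h => And.intro h.1 (h.2.trans hI₀₂)
      have e₀ := sub_one_div_rpow_le n h₀
      have e₁ := sub_one_div_rpow_le n h₁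
      have e₂ := sub_one_div_rpow_le n h₂
      simp only [B]
      linarith
  choose c hc hb using hcode
  have hev : ∀ᶠ n : ℕ in atTop, 0 < n := eventually_gt_atTop 0
  have herr0 : ∀ n, 0 ≤ (c n).errorProb ch := fun n => prob_nonneg ((c n).blockLaw_nonneg ch) _
  refine ⟨hR₀, hR₁, hR₂, c, hc, ?_, ?_, ?_⟩
  · refine squeeze_zero' (Eventually.of_forall herr0) ?_ hB
    filter_upwards [hev] with n hn
    have := hb n hn
    nlinarith [sq_nonneg ((c n).distortion₁ ch d₁ - expect (ch.singleLetterLaw PUX)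
          (fun ω => d₁ ω.2.1.1 (sh₁ ω.1.2 ω.2.2.2.2))), sq_nonneg ((c n).distortion₂ ch d₂ -
          expect (ch.singleLetterLaw PUX) (fun ω => d₂ ω.2.1.2 (sh₂ ω.1.2 ω.2.2.2.2)))]
  · have h := tendsto_of_sq_sub_le (x := fun n => (c n).distortion₁ ch d₁)
      (E := expect (ch.singleLetterLaw PUX) (fun ω => d₁ ω.2.1.1 (sh₁ ω.1.2 ω.2.2.2.2))) hB (by
        filter_upwards [hev] with n hn
        have := hb n hn
        nlinarith [herr0 n, sq_nonneg ((c n).distortion₂ ch d₂ -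
          expect (ch.singleLetterLaw PUX) (fun ω => d₂ ω.2.1.2 (sh₂ ω.1.2 ω.2.2.2.2)))])
    exact le_trans (le_of_eq ((continuous_coe_real_ereal.tendsto _).comp h).limsup_eq)
      (EReal.coe_le_coe_iff.2 hD₁)
  · have h := tendsto_of_sq_sub_le (x := fun n => (c n).distortion₂ ch d₂)
      (E := expect (ch.singleLetterLaw PUX) (fun ω => d₂ ω.2.1.2 (sh₂ ω.1.2 ω.2.2.2.2))) hB (by
        filter_upwards [hev] with n hn
        have := hb n hn
        nlinarith [herr0 n, sq_nonneg ((c n).distortion₁ ch d₁ -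
          expect (ch.singleLetterLaw PUX) (fun ω => d₁ ω.2.1.1 (sh₁ ω.1.2 ω.2.2.2.2)))])
    exact le_trans (le_of_eq ((continuous_coe_real_ereal.tendsto _).comp h).limsup_eq)
      (EReal.coe_le_coe_iff.2 hD₂)

/-- Scaling the rates by 1 − 1/(n + 1) makes each rate constraint strict unless the rate is zero,
while the law and the distortions stay the same. -/
theorem singleLetterSet_subset (ch : SDMBC X Y₁ Y₂ Z S₁ S₂) (hdeg : ch.PhysicallyDegraded)
    (d₁ : S₁ → T₁ → ℝ) (d₂ : S₂ → T₂ → ℝ) (sh₁ : X → Z → T₁) (sh₂ : X → Z → T₂) :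
    ch.singleLetterSet d₁ d₂ sh₁ sh₂ ⊆ closure (ch.achievableIgnoringFeedback d₁ d₂) := by
  rintro ⟨R₀, R₁, R₂, D₁, D₂⟩ ⟨hR₀, hR₁, hR₂, m, PUX, hI₁, hI₂, hD₁, hD₂⟩
  have h : Tendsto (fun n : ℕ => 1 - 1 / ((n : ℝ) + 1)) atTop (𝓝 1) := by
    simpa using (tendsto_one_div_add_atTop_nhds_zero_nat (𝕜 := ℝ)).const_sub 1
  have hR : ∀ R : ℝ, Tendsto (fun n : ℕ => (1 - 1 / ((n : ℝ) + 1)) * R) atTop (𝓝 R) := by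
    intro R
    simpa using h.mul_const R
  refine mem_closure_of_tendsto (f := fun n : ℕ => ((1 - 1 / ((n : ℝ) + 1)) * R₀,
    (1 - 1 / ((n : ℝ) + 1)) * R₁, (1 - 1 / ((n : ℝ) + 1)) * R₂, D₁, D₂)) (b := atTop)
    ((hR R₀).prodMk_nhds ((hR R₁).prodMk_nhds ((hR R₂).prodMk_nhds
      (tendsto_const_nhds.prodMk_nhds tendsto_const_nhds)))) (Eventually.of_forall fun n => ?_)
  have h1 : 0 < 1 / ((n : ℝ) + 1) := by positivity
  have h2 : 0 ≤ 1 - 1 / ((n : ℝ) + 1) := by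
    rw [sub_nonneg, div_le_one (by positivity)]
    linarith [(Nat.cast_nonneg n : (0 : ℝ) ≤ n)]
  have hlt : ∀ {R I : ℝ}, 0 ≤ R → R ≤ I →
      (1 - 1 / ((n : ℝ) + 1)) * R = 0 ∨ (1 - 1 / ((n : ℝ) + 1)) * R < I := by
    intro R I hR hI
    rcases hR.eq_or_lt with h | h
    · exact Or.inl (by rw [← h, mul_zero])
    · exact Or.inr (by nlinarith)
  refine mem_achievableIgnoringFeedback ch hdeg PUX d₁ d₂ sh₁ sh₂ (mul_nonneg h2 hR₀)
    (mul_nonneg h2 hR₁) (mul_nonneg h2 hR₂) (hlt hR₁ hI₁) ?_ hD₁ hD₂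
  rw [← mul_add]
  exact hlt (add_nonneg hR₀ hR₂) hI₂

end Achievability

end SDMBC

/-! ### The capacity-distortion region -/

theorem theorem3 {X Y₁ Y₂ Z S₁ S₂ T₁ T₂ : Type*} [Fintype X] [Fintype Y₁] [Fintype Y₂]
    [Fintype Z] [Fintype S₁] [Fintype S₂]
    (ch : SDMBC X Y₁ Y₂ Z S₁ S₂) (hdeg : ch.PhysicallyDegraded)
    (d₁ : S₁ → T₁ → ℝ) (d₂ : S₂ → T₂ → ℝ)
    (hd₁ : ∀ s t, 0 ≤ d₁ s t) (hd₂ : ∀ s t, 0 ≤ d₂ s t)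
    (hb₁ : ∃ C : ℝ, ∀ s t, d₁ s t ≤ C) (hb₂ : ∃ C : ℝ, ∀ s t, d₂ s t ≤ C)
    (sh₁ : X → Z → T₁) (sh₂ : X → Z → T₂)
    (hsh₁ : SDMBC.IsOptimalEstimator ch.posterior₁ d₁ sh₁)
    (hsh₂ : SDMBC.IsOptimalEstimator ch.posterior₂ d₂ sh₂) :
    ch.capacityDistortionRegion d₁ d₂ = closure (ch.singleLetterSet d₁ d₂ sh₁ sh₂) ∧
    ch.capacityDistortionRegionIgnoringFeedback d₁ d₂ = ch.capacityDistortionRegion d₁ d₂ := by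
  -- The three inclusions form a cycle, so all three closed sets coincide.
  have h1 : ch.capacityDistortionRegionIgnoringFeedback d₁ d₂ ⊆
      ch.capacityDistortionRegion d₁ d₂ :=
    closure_mono fun _ ⟨hR₀, hR₁, hR₂, c, _, hc⟩ => ⟨hR₀, hR₁, hR₂, c, hc⟩
  have h2 : ch.capacityDistortionRegion d₁ d₂ ⊆ closure (ch.singleLetterSet d₁ d₂ sh₁ sh₂) :=
    closure_minimal (ch.achievable_subset hdeg d₁ d₂ sh₁ sh₂ hsh₁ hsh₂) isClosed_closure
  have h3 : closure (ch.singleLetterSet d₁ d₂ sh₁ sh₂) ⊆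
      ch.capacityDistortionRegionIgnoringFeedback d₁ d₂ :=
    closure_minimal (ch.singleLetterSet_subset hdeg d₁ d₂ sh₁ sh₂) isClosed_closure
  exact ⟨h2.antisymm (h3.trans h1), h1.antisymm (h2.trans h3)⟩
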